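/- **Definitions.** An $n$-variable randomized decision tree $R$ is a binary tree with decision nodes, which branch on a variable $x_i$ ($1\le i\le n$), stochastic nodes, which branch on a fair coin, and leaves labelled by rational numbers in $[0,1]$. Its query complexity (randomness complexity $m$) is the maximum number of decision (stochastic) nodes on a root-to-leaf path. $R$ is a $q$-query tree if its query complexity is at most $q$. It computes $R:\{0,1\}^n\times\{0,1\}^m\to[0,1]$, where the stochastic nodes along a path consume the bits of $r\in\{0,1\}^m$ one after the other, and its mean function is $\mu_R(x)=\mathbb E_{r}[R(x,r)]$, with $r$ uniform in $\{0,1\}^m$. A deterministic decision tree $D$ is one without stochastic nodes; it computes $D:\{0,1\}^n\to[0,1]$. Trees are described by strings in prefix notation, with variable indices and the numerators and denominators of leaf values (fractions not necessarily in lowest terms) written in binary; the description length is the length of this string. **Theorem.** There are a deterministic (multi-stack Turing machine) algorithm $\mathcal A$ and an absolute constant $C$ with the following guarantee. Let $n,q\ge 0$, let $R$ be an $n$-variable randomized $q$-query decision tree with description length $N$, and let $\varepsilon=a/b\in(0,\tfrac12)$ be a rational number given by $a,b\in\mathbb N$ in binary, with description length $\ell$. Given $R$ and $(a,b)$ as input,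 $\mathcal A$ runs in time at most $$C\,N^{C}\cdot 2^{C q/\varepsilon}+C\,\ell^{\,C}$$ (that is, $\mathrm{poly}(N)\cdot 2^{O(q/\varepsilon)}$, plus $\mathrm{poly}(\ell)$ for processing the representation of $\varepsilon$) and outputs the description of an $n$-variable deterministic decision tree $D$ of query complexity at most $C q/\varepsilon$ such that $$\mathbb E_{x}\big[(D(x)-\mu_R(x))^2\big]\le\varepsilon ,$$ where $x$ is uniform in $\{0,1\}^n$. -/

import Mathlib

open scoped BigOperators

namespace QueryDerand

/-- A rational number in `[0,1]`, written as a fraction that need not be in lowest terms. -/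
structure UnitFrac where
  num : ℕ
  den : ℕ
  den_pos : 0 < den
  num_le_den : num ≤ den

/-- The real number that a fraction denotes. -/
noncomputable def UnitFrac.value (v : UnitFrac) : ℝ := (v.num : ℝ) / (v.den : ℝ)

/-- An `n`-variable randomized decision tree: a binary tree whose internal nodes are decision nodes
(`query i t₀ t₁` goes to `t₀` if `x i = 0` and to `t₁` if `x i = 1`) and stochastic nodes
(`coin t₀ t₁` goes to either subtree with probability `1/2`), with leaves labelled by values
in `[0,1]`. -/
inductive RDT (n : ℕ) where
  | leaf (v : UnitFrac) : RDT n
  | query (i : Fin n) (t₀ t₁ : RDT n) : RDT n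
  | coin (t₀ t₁ : RDT n) : RDT n

namespace RDT

variable {n : ℕ}

/-- The maximum number of decision nodes on a root-to-leaf path. -/
def queryComplexity : RDT n → ℕ
  | leaf _ => 0
  | query _ t₀ t₁ => max t₀.queryComplexity t₁.queryComplexity + 1
  | coin t₀ t₁ => max t₀.queryComplexity t₁.queryComplexity

/-- The maximum number of stochastic nodes on a root-to-leaf path. -/
def randomnessComplexity : RDT n → ℕ
  | leaf _ => 0
  | query _ t₀ t₁ => max t₀.randomnessComplexity t₁.randomnessComplexity
  | coin t₀ t₁ => max t₀.randomnessComplexity t₁.randomnessComplexity + 1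

/-- A deterministic decision tree is a randomized one without stochastic nodes. -/
def IsDeterministic : RDT n → Prop
  | leaf _ => True
  | query _ t₀ t₁ => t₀.IsDeterministic ∧ t₁.IsDeterministic
  | coin _ _ => False

/-- `R.run x r` is the output `R(x, r)` on input `x` and random string `r`: the stochastic nodes met
along the path consume the bits of `r` one after the other.  (A string of length at least
`R.randomnessComplexity` is never exhausted; on an exhausted string a stochastic node goes left.) -/
noncomputable def run : RDT n → (Fin n → Bool) → List Bool → ℝ
  | leaf v, _, _ => v.value
  | query i t₀ t₁, x, r => if x i then t₁.run x r else t₀.run x r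
  | coin t₀ _, x, [] => t₀.run x []
  | coin t₀ t₁, x, b :: r => if b then t₁.run x r else t₀.run x r

/-- The mean function `μ_R(x) = E_r [R(x, r)]`, for uniform `r ∈ {0,1}^m`, where `m` is the
randomness complexity of `R`. -/
noncomputable def mean (R : RDT n) (x : Fin n → Bool) : ℝ :=
  𝔼 r : Fin R.randomnessComplexity → Bool, R.run x (List.ofFn r)

end RDT

/-- The input and output alphabet of the algorithm. -/
inductive Symb where
  | bit (b : Bool)
  | sep
  | leafMark
  | queryMark
  | coinMark
  deriving DecidableEq, Fintype

/-- A natural number in binary, least significant bit first, closed by a separator. -/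
def encodeNat (k : ℕ) : List Symb := k.bits.map Symb.bit ++ [Symb.sep]

/-- The description of a tree, in prefix notation with all numbers in binary. -/
def RDT.encode {n : ℕ} : RDT n → List Symb
  | .leaf v => Symb.leafMark :: (encodeNat v.num ++ encodeNat v.den)
  | .query i t₀ t₁ => Symb.queryMark :: (encodeNat i ++ (t₀.encode ++ t₁.encode))
  | .coin t₀ t₁ => Symb.coinMark :: (t₀.encode ++ t₁.encode)

/-- The description of the fraction `a / b`. -/
def encodeFraction (a b : ℕ) : List Symb := encodeNat a ++ encodeNat b

/-- The deterministic Turing machine `M` (Mathlib's multi-stack machine with finitely many states),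
started on the string `w`, halts with output `w'` after at most `t` steps. -/
def OutputsWithin (M : Turing.TM2ComputableAux Symb Symb) (w w' : List Symb) (t : ℕ) : Prop :=
  Nonempty (Turing.TM2OutputsInTime M.tm (w.map M.inputAlphabet.symm)
    (some (w'.map M.outputAlphabet.symm)) t)

end QueryDerand

/-!
# Derandomization of randomized decision trees

Let `μ` be the mean function of a randomized `q`-query tree `R`. If `k` independent copies of `R`
are run on the same input `x`, the average of their outputs has expected squared distance at most
`1 / k` from `μ x`, so that for `k ≥ 1 / ε` some choice of the coins is good on average over `x`.
Such a choice is found by the method of conditional expectations (`RDT.build`, `RDT.walk`): the copies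
are run one after the other, a decision node of the current copy becomes a decision node of the
output tree `D` unless its variable is already known, and at a stochastic node the algorithm goes to
the subtree with the smaller conditional expectation of the squared distance between the sum of all
outputs and `k • μ`. Every node of `D` makes its own choices, with `x` conditioned on the partial
assignment read so far. In the last step `D` outputs not the average of the values it has seen
but the conditional expectation of `μ`, which is at least as good (`condExp_sq_sub_mean_le`) and is
an exact fraction between `0` and `1`. The conditional expectations never increase along this
process (`RDT.condExp_sq_walk_le`, `RDT.condExp_sq_build_le`), which gives the error bound `1 / k`
(`RDT.expect_sq_build_le`), and `D` has depth at most `k * q`.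

In the difference of the two conditional expectations at a stochastic node, all terms cancel except
`𝔼 (v² + 2 s v) - 𝔼 (c v μ)`, where `v` is the output of the subtree, `s` the sum of the earlier
outputs and `c / 2` the number of copies started. `RDT.score` computes these two expectations
as fractions, without cancelling common factors; each averaging adds the numbers of digits of two
fractions, so that the numbers of digits remain polynomial. Hence all work per node of `D` is
polynomial in the size of `R` and in `k`, and `D` has at most `2 ^ (k * q)` paths. If `R` makes no
queries at all, `μ` is constant and `k = 0` copies suffice; otherwise `k ≤ 2 ^ (k * q)`, so that
factors polynomial in `k` are absorbed.

For the machine, a first-order recursive programming language on binary trees (`Exp`, `Eval`) is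
compiled to multi-stack machines whose running time is at most the number of evaluation steps times
the size of the largest value, up to a constant factor (`outputsWithin_interpreter`). The algorithm
is a program `body` in this language. The theorems named `computes_…` determine the results and
bound the numbers of steps of its procedures.
-/


namespace QueryDerand

/-! ### Binary trees and a first-order recursive language on them -/

/-- The data of the programming language: binary trees without labels. -/
inductive Val where
  | nil : Val
  | cons (a b : Val) : Val
  deriving DecidableEq

namespace Val

/-- The number of nodes, leaves included; this is also the length of `Val.ser`. -/
def size : Val → ℕ
  | nil => 1
  | cons a b => 1 + a.size + b.size

/-- Serialization in prefix notation: `true` for `cons`, `false` for `nil`. -/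
def ser : Val → List Bool
  | nil => [false]
  | cons a b => true :: (a.ser ++ b.ser)

theorem length_ser (v : Val) : v.ser.length = v.size := by
  induction v with
  | nil => rfl
  | cons a b iha ihb => simp [ser, size, iha, ihb]; omega

theorem size_pos (v : Val) : 0 < v.size := by
  cases v <;> simp [size]

/-- The list `a₁, …, aₖ` as the right comb `cons a₁ (cons a₂ (… nil))`. -/
def ofList : List Val → Val
  | [] => nil
  | a :: l => cons a (ofList l)

/-- The natural number `k` in unary, as the right comb of `k` copies of `nil`. -/
def unary : ℕ → Val
  | 0 => nil
  | k + 1 => cons nil (unary k)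

theorem size_unary (k : ℕ) : (unary k).size = 2 * k + 1 := by
  induction k with
  | zero => rfl
  | succ k ih => simp [unary, size, ih]; omega

end Val

/-- The serialization of an environment: its values one after the other. -/
def serEnv (env : List Val) : List Bool := env.flatMap Val.ser

/-- Expressions of the language; variables are de Bruijn indices into an environment of values.
`cons b a` evaluates `b`, then `a` in the environment extended by the value of `b`, and pairs them
with the value of `a` in front.  `branch e l r` evaluates `e` and goes to `l` if the value is `nil`,
and to `r`, with the two components pushed on the environment, otherwise.  `call f` runs the body of
procedure `f` in the current environment, whose first entries are the arguments. -/
inductive Exp (ι : Type) where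
  | var (i : ℕ) : Exp ι
  | nil : Exp ι
  | cons (b a : Exp ι) : Exp ι
  | bind (e b : Exp ι) : Exp ι
  | branch (e l r : Exp ι) : Exp ι
  | call (f : ι) : Exp ι

/-- `Eval P M e env v n`: in the program `P`, the expression `e` has the value `v` in the
environment `env`; the evaluation takes `n` steps, where access to variable `i` counts as `i + 1`,
and every value that it builds has size at most `M`. -/
inductive Eval {ι : Type} (P : ι → Exp ι) (M : ℕ) : Exp ι → List Val → Val → ℕ → Prop
  | var {i env v} (h : env[i]? = some v) : Eval P M (.var i) env v (i + 1)
  | nil {env} : Eval P M .nil env .nil 1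
  | cons {b a env vb va nb na} (hb : Eval P M b env vb nb) (ha : Eval P M a (vb :: env) va na)
      (hM : 1 + va.size + vb.size ≤ M) : Eval P M (.cons b a) env (.cons va vb) (nb + na + 1)
  | bind {e b env v w n m} (he : Eval P M e env v n) (hb : Eval P M b (v :: env) w m) :
      Eval P M (.bind e b) env w (n + m + 1)
  | branch_nil {e l r env w n m} (he : Eval P M e env .nil n) (hl : Eval P M l env w m) :
      Eval P M (.branch e l r) env w (n + m + 1)
  | branch_cons {e l r env a b w n m} (he : Eval P M e env (.cons a b) n)
      (hr : Eval P M r (a :: b :: env) w m) : Eval P M (.branch e l r) env w (n + m + 1)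
  | call {f env v n} (h : Eval P M (P f) env v n) : Eval P M (.call f) env v (n + 1)

/-- No value in a run exceeds the size bound `M`: only `cons` builds larger values. -/
theorem Eval.size_le {ι : Type} {P : ι → Exp ι} {M : ℕ} (hM : 1 ≤ M) {e : Exp ι} {env : List Val}
    {v : Val} {n : ℕ} (h : Eval P M e env v n) (henv : ∀ u ∈ env, u.size ≤ M) : v.size ≤ M := by
  induction h with
  | var h => exact henv _ (List.mem_of_getElem? h)
  | nil => simpa [Val.size] using hM
  | cons hb ha hM' _ _ => simpa [Val.size] using hM'
  | bind he hb ihe ihb =>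
    exact ihb (by simpa using ⟨ihe henv, henv⟩)
  | branch_nil he hl ihe ihl => exact ihl henv
  | branch_cons he hr ihe ihr =>
    have := ihe henv
    simp only [Val.size] at this
    refine ihr ?_
    simp only [List.mem_cons, forall_eq_or_imp]
    exact ⟨by omega, by omega, henv⟩
  | call h ih => exact ih henv

/-! ### Control-flow graphs -/

/-- An instruction of a control-flow graph with node set `T`: an expression whose immediate
subexpressions are nodes. -/
inductive Instr (T : Type) where
  | var (i : ℕ) : Instr T
  | nil : Instr T
  | cons (b a : T) : Instr T
  | bind (e b : T) : Instr T
  | branch (e l r : T) : Instr T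
  | jump (t : T) : Instr T

/-- The immediate operations on the stack machine that move serialized values around: `mv none`
deletes the top value of the work stack, `mv (some d)` moves it to buffer `B` (`d = false`) or `C`
(`d = true`), `dup` empties `C` onto the work stack and `D` simultaneously, `flushB`, `flushC`
empty a buffer onto the work stack, `flushD` empties `D` onto `C`, and `pair` joins the two top values. -/
inductive Micro where
  | mv (d : Option Bool)
  | dup
  | flushB
  | flushC
  | flushD
  | pair
  deriving Fintype

/-- The alphabet of the control stack: pending tasks. `ev t` evaluates node `t`; `br t` decides the
branch of node `t` when its scrutinee is on top of the work stack. -/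
inductive Task (T : Type) where
  | ev (t : T)
  | br (t : T)
  | micro (m : Micro)

theorem Task.finite (T : Type) [Finite T] : Finite (Task T) := by
  have : Finite (T ⊕ T ⊕ Micro) := inferInstance
  refine Finite.of_surjective
    (fun x : T ⊕ T ⊕ Micro => match x with
      | .inl t => Task.ev t
      | .inr (.inl t) => Task.br t
      | .inr (.inr m) => Task.micro m) ?_
  rintro (t | t | m)
  · exact ⟨.inl t, rfl⟩
  · exact ⟨.inr (.inl t), rfl⟩
  · exact ⟨.inr (.inr m), rfl⟩

/-- The labels of the machine. -/
inductive Lbl (T : Type) where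
  | in1
  | in2
  | main
  | out1
  | out2 (k : Fin 6)
  | out3
  | task (t : Task T)

theorem Lbl.finite (T : Type) [Finite T] : Finite (Lbl T) := by
  have := Task.finite T
  have : Finite (Fin 5 ⊕ Fin 6 ⊕ Task T) := inferInstance
  refine Finite.of_surjective
    (fun x : Fin 5 ⊕ Fin 6 ⊕ Task T => match x with
      | .inl 0 => Lbl.in1
      | .inl 1 => Lbl.in2
      | .inl 2 => Lbl.main
      | .inl 3 => Lbl.out1
      | .inl 4 => Lbl.out3
      | .inr (.inl k) => Lbl.out2 k
      | .inr (.inr m) => Lbl.task m) ?_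
  rintro (_ | _ | _ | _ | k | _ | t)
  · exact ⟨.inl 0, rfl⟩
  · exact ⟨.inl 1, rfl⟩
  · exact ⟨.inl 2, rfl⟩
  · exact ⟨.inl 3, rfl⟩
  · exact ⟨.inr (.inl k), rfl⟩
  · exact ⟨.inl 4, rfl⟩
  · exact ⟨.inr (.inr t), rfl⟩

/-- The internal state of the machine: the result of the last `pop`. -/
inductive Reg (T : Type) where
  | idle
  | bit (b : Option Bool)
  | symb (s : Option Symb)
  | unit (u : Option Unit)
  | task (t : Option (Task T))

theorem Reg.finite (T : Type) [Finite T] : Finite (Reg T) := by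
  have := Task.finite T
  have : Finite (Unit ⊕ Option Bool ⊕ Option Symb ⊕ Option Unit ⊕ Option (Task T)) := inferInstance
  refine Finite.of_surjective
    (fun x : Unit ⊕ Option Bool ⊕ Option Symb ⊕ Option Unit ⊕ Option (Task T) => match x with
      | .inl _ => Reg.idle
      | .inr (.inl k) => Reg.bit k
      | .inr (.inr (.inl k)) => Reg.symb k
      | .inr (.inr (.inr (.inl k))) => Reg.unit k
      | .inr (.inr (.inr (.inr k))) => Reg.task k) ?_
  rintro (_ | k | k | k | k)
  · exact ⟨.inl (), rfl⟩
  · exact ⟨.inr (.inl k), rfl⟩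
  · exact ⟨.inr (.inr (.inl k)), rfl⟩
  · exact ⟨.inr (.inr (.inr (.inl k))), rfl⟩
  · exact ⟨.inr (.inr (.inr (.inr k))), rfl⟩

namespace Reg

variable {T : Type}

/-- The bit in the register, `false` by default. -/
def getBit : Reg T → Bool
  | bit (some b) => b
  | _ => false

/-- The symbol in the register. -/
def getSymb : Reg T → Symb
  | symb (some s) => s
  | _ => .sep

/-- Whether the last `pop` met an empty stack. -/
def isNone : Reg T → Bool
  | bit none => true
  | symb none => true
  | unit none => true
  | _ => false

end Reg

/-- The stacks of the machine: input, output, the work stack `A` with the serialized environment,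
three buffers, a unary counter and the control stack. -/
inductive Stk where
  | inp | out | A | B | C | D | ctr | ctl
  deriving DecidableEq

instance : Fintype Stk where
  elems := {.inp, .out, .A, .B, .C, .D, .ctr, .ctl}
  complete k := by cases k <;> decide

/-- The alphabets of the stacks. -/
@[reducible] def Alph (T : Type) : Stk → Type
  | .inp => Symb
  | .out => Symb
  | .A => Bool
  | .B => Bool
  | .C => Bool
  | .D => Bool
  | .ctr => Unit
  | .ctl => Task T

theorem Alph.finite (T : Type) [Finite T] (k : Stk) : Finite (Alph T k) := by
  have := Task.finite T
  cases k <;> dsimp [Alph] <;> infer_instance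

/-- The number of the token that stands for a symbol: symbol `s` is the value `unary s.code`. -/
def Symb.code : Symb → ℕ
  | .bit false => 0
  | .bit true => 1
  | .sep => 2
  | .leafMark => 3
  | .queryMark => 4
  | .coinMark => 5

/-- The symbol with a given token number. -/
def Symb.ofCode : Fin 6 → Symb
  | 0 => .bit false
  | 1 => .bit true
  | 2 => .sep
  | 3 => .leafMark
  | 4 => .queryMark
  | 5 => .coinMark

open Turing.TM2 (Stmt)
open Turing.TM2.Stmt

section Machine

variable {T : Type}

/-- Push a list of tasks, the first one ending on top. -/
def pushes : List (Task T) → Stmt (Alph T) (Lbl T) (Reg T) → Stmt (Alph T) (Lbl T) (Reg T)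
  | [], q => q
  | t :: ts, q => pushes ts (push .ctl (fun _ => t) q)

/-- Push a list of bits on the work stack, the first one ending on top. -/
def pushBits : List Bool → Stmt (Alph T) (Lbl T) (Reg T) → Stmt (Alph T) (Lbl T) (Reg T)
  | [], q => q
  | t :: ts, q => pushBits ts (push .A (fun _ => t) q)

/-- The tasks that evaluate a node. Variable `i` is copied to the top of the work stack: the `i`
values above it go to buffer `B`, the value itself goes through `C` to the work stack and to `D`, then
the buffered values return, and the copy in `D` goes on top. -/
def Instr.tasks (t : T) : Instr T → List (Task T)
  | .var i => List.replicate i (.micro (.mv (some false))) ++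
      [.micro (.mv (some true)), .micro .dup, .micro .flushB, .micro .flushD, .micro .flushC]
  | .nil => []
  | .cons b a => [.ev b, .ev a, .micro .pair]
  | .bind e b => [.ev e, .ev b, .micro (.mv (some true)), .micro (.mv none), .micro .flushC]
  | .branch e _ _ => [.ev e, .br t]
  | .jump t => [.ev t]

/-- The tasks that delete the value below the top value of the work stack. -/
def slide : List (Task T) := [.micro (.mv (some true)), .micro (.mv none), .micro .flushC]

/-- Empties a stack, one bit per step: `popStmt` pops it, `pushStmt` pushes the bit elsewhere, and `l`
is the label of the loop. -/
def flushStmt (popStmt : Stmt (Alph T) (Lbl T) (Reg T) → Stmt (Alph T) (Lbl T) (Reg T))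
    (pushStmt : Stmt (Alph T) (Lbl T) (Reg T) → Stmt (Alph T) (Lbl T) (Reg T)) (l : Lbl T) :
    Stmt (Alph T) (Lbl T) (Reg T) :=
  popStmt (branch Reg.isNone (goto fun _ => .main) (pushStmt (goto fun _ => l)))

/-- The statement of a micro task. The counter holds the number of pending subtrees minus one. -/
def Micro.stmt : Micro → Stmt (Alph T) (Lbl T) (Reg T)
  | .mv d =>
    let loop : Stmt (Alph T) (Lbl T) (Reg T) :=
      branch Reg.getBit (push .ctr (fun _ => ()) (goto fun _ => .task (.micro (.mv d))))
        (pop .ctr (fun _ o => .unit o)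
          (branch Reg.isNone (goto fun _ => .main) (goto fun _ => .task (.micro (.mv d)))))
    pop .A (fun _ o => .bit o)
      (match d with
        | none => loop
        | some false => push .B Reg.getBit loop
        | some true => push .C Reg.getBit loop)
  | .dup => flushStmt (pop .C (fun _ o => .bit o))
      (fun q => push .A Reg.getBit (push .D Reg.getBit q)) (.task (.micro .dup))
  | .flushB => flushStmt (pop .B (fun _ o => .bit o)) (push .A Reg.getBit) (.task (.micro .flushB))
  | .flushC => flushStmt (pop .C (fun _ o => .bit o)) (push .A Reg.getBit) (.task (.micro .flushC))
  | .flushD => flushStmt (pop .D (fun _ o => .bit o)) (push .C Reg.getBit) (.task (.micro .flushD))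
  | .pair => push .A (fun _ => true) (goto fun _ => .main)

/-- The program of the machine that interprets the control-flow graph `code` from node `start`.
`in1` and `in2` turn the input into the serialized list of its tokens; `main` executes the control
stack; `out1`, `out2`, `out3` turn the serialized result into the output. -/
def machineStmt (code : T → Instr T) (start : T) : Lbl T → Stmt (Alph T) (Lbl T) (Reg T)
  | .in1 => pop .inp (fun _ o => .symb o)
      (branch Reg.isNone
        (push .A (fun _ => false) (goto fun _ => .in2))
        (push .out Reg.getSymb (goto fun _ => .in1)))
  | .in2 => pop .out (fun _ o => .symb o)
      (branch Reg.isNone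
        (pushes (.ev start :: slide) (goto fun _ => .main))
        (branch (fun r => r.getSymb = .bit false) (pushBits (true :: (Val.unary 0).ser) (goto fun _ => .in2))
        (branch (fun r => r.getSymb = .bit true) (pushBits (true :: (Val.unary 1).ser) (goto fun _ => .in2))
        (branch (fun r => r.getSymb = .sep) (pushBits (true :: (Val.unary 2).ser) (goto fun _ => .in2))
        (branch (fun r => r.getSymb = .leafMark) (pushBits (true :: (Val.unary 3).ser) (goto fun _ => .in2))
        (branch (fun r => r.getSymb = .queryMark) (pushBits (true :: (Val.unary 4).ser) (goto fun _ => .in2))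
        (pushBits (true :: (Val.unary 5).ser) (goto fun _ => .in2))))))))
  | .main => pop .ctl (fun _ o => .task o)
      (goto fun r => match r with
        | .task (some t) => .task t
        | _ => .out1)
  | .task (.ev t) =>
    match code t with
    | .nil => push .A (fun _ => false) (goto fun _ => .main)
    | c => pushes (c.tasks t) (goto fun _ => .main)
  | .task (.br t) =>
    match code t with
    | .branch _ l r => pop .A (fun _ o => .bit o)
        (branch Reg.getBit (pushes (.ev r :: (slide ++ slide)) (goto fun _ => .main))
          (pushes [.ev l] (goto fun _ => .main)))
    | _ => goto fun _ => .main
  | .task (.micro m) => m.stmt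
  | .out1 => pop .A (fun _ o => .bit o)
      (branch Reg.getBit (goto fun _ => .out2 0) (goto fun _ => .out3))
  | .out2 k => pop .A (fun _ o => .bit o)
      (branch Reg.getBit (pop .A (fun _ o => .bit o) (goto fun _ => .out2 (k + 1)))
        (push .inp (fun _ => Symb.ofCode k) (goto fun _ => .out1)))
  | .out3 => pop .inp (fun _ o => .symb o)
      (branch Reg.isNone (load (fun _ => .idle) halt)
        (push .out Reg.getSymb (goto fun _ => .out3)))

/-- The interpreter as a bundled machine. -/
noncomputable def machine [Finite T] (code : T → Instr T) (start : T) : Turing.FinTM2 where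
  K := Stk
  k₀ := .inp
  k₁ := .out
  Γ := Alph T
  Λ := Lbl T
  main := .in1
  ΛFin := @Fintype.ofFinite _ (Lbl.finite T)
  σ := Reg T
  initialState := .idle
  σFin := @Fintype.ofFinite _ (Reg.finite T)
  Γk₀Fin := inferInstanceAs (Fintype Symb)
  m := machineStmt code start

/-- The contents of all stacks. -/
def stk (i o : List Symb) (a b c d : List Bool) (u : List Unit) (t : List (Task T)) :
    ∀ k, List (Alph T k)
  | .inp => i
  | .out => o
  | .A => a
  | .B => b
  | .C => c
  | .D => d
  | .ctr => u
  | .ctl => t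

variable {i o : List Symb} {a b c d : List Bool} {u : List Unit} {t : List (Task T)}

@[simp] theorem update_inp (x : List Symb) :
    Function.update (stk i o a b c d u t) .inp x = stk x o a b c d u t := by
  funext k; cases k <;> rfl
@[simp] theorem update_out (x : List Symb) :
    Function.update (stk i o a b c d u t) .out x = stk i x a b c d u t := by
  funext k; cases k <;> rfl
@[simp] theorem update_A (x : List Bool) :
    Function.update (stk i o a b c d u t) .A x = stk i o x b c d u t := by
  funext k; cases k <;> rfl
@[simp] theorem update_B (x : List Bool) :
    Function.update (stk i o a b c d u t) .B x = stk i o a x c d u t := by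
  funext k; cases k <;> rfl
@[simp] theorem update_C (x : List Bool) :
    Function.update (stk i o a b c d u t) .C x = stk i o a b x d u t := by
  funext k; cases k <;> rfl
@[simp] theorem update_D (x : List Bool) :
    Function.update (stk i o a b c d u t) .D x = stk i o a b c x u t := by
  funext k; cases k <;> rfl
@[simp] theorem update_ctr (x : List Unit) :
    Function.update (stk i o a b c d u t) .ctr x = stk i o a b c d x t := by
  funext k; cases k <;> rfl
@[simp] theorem update_ctl (x : List (Task T)) :
    Function.update (stk i o a b c d u t) .ctl x = stk i o a b c d u x := by
  funext k; cases k <;> rfl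

@[simp] theorem stk_inp : stk i o a b c d u t .inp = i := rfl
@[simp] theorem stk_out : stk i o a b c d u t .out = o := rfl
@[simp] theorem stk_A : stk i o a b c d u t .A = a := rfl
@[simp] theorem stk_B : stk i o a b c d u t .B = b := rfl
@[simp] theorem stk_C : stk i o a b c d u t .C = c := rfl
@[simp] theorem stk_D : stk i o a b c d u t .D = d := rfl
@[simp] theorem stk_ctr : stk i o a b c d u t .ctr = u := rfl
@[simp] theorem stk_ctl : stk i o a b c d u t .ctl = t := rfl

theorem stepAux_pushes (l : List (Task T)) (q : Stmt (Alph T) (Lbl T) (Reg T)) (v : Reg T) :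
    Turing.TM2.stepAux (pushes l q) v (stk i o a b c d u t) =
      Turing.TM2.stepAux q v (stk i o a b c d u (l ++ t)) := by
  induction l generalizing q with
  | nil => rfl
  | cons x l ih => rw [pushes, ih]; simp

theorem stepAux_pushBits (l : List Bool) (q : Stmt (Alph T) (Lbl T) (Reg T)) (v : Reg T) :
    Turing.TM2.stepAux (pushBits l q) v (stk i o a b c d u t) =
      Turing.TM2.stepAux q v (stk i o (l ++ a) b c d u t) := by
  induction l generalizing q with
  | nil => rfl
  | cons x l ih => rw [pushBits, ih]; simp

end Machine

/-! ### Runs of the machine -/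

section Runs

open Turing.TM2 (Stmt)

variable {T : Type} {code : T → Instr T} {start : T}

/-- The machine goes from label `l` and stacks `S` to label `l'` and stacks `S'` in `n` steps,
whatever its register holds. -/
def Steps (code : T → Instr T) (start : T) (n : ℕ) (l : Lbl T) (S : ∀ k, List (Alph T k))
    (l' : Lbl T) (S' : ∀ k, List (Alph T k)) : Prop :=
  ∀ v, ∃ v', (flip bind (Turing.TM2.step (machineStmt code start)))^[n] (some ⟨some l, v, S⟩) =
    some ⟨some l', v', S'⟩

theorem Steps.refl (l : Lbl T) (S : ∀ k, List (Alph T k)) : Steps code start 0 l S l S :=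
  fun v => ⟨v, rfl⟩

theorem Steps.trans {n m : ℕ} {l l' l'' : Lbl T} {S S' S'' : ∀ k, List (Alph T k)}
    (h : Steps code start n l S l' S') (h' : Steps code start m l' S' l'' S'') :
    Steps code start (n + m) l S l'' S'' := by
  intro v
  obtain ⟨v', hv'⟩ := h v
  obtain ⟨v'', hv''⟩ := h' v'
  refine ⟨v'', ?_⟩
  rw [Nat.add_comm, Function.iterate_add_apply, hv', hv'']

theorem Steps.single {l l' : Lbl T} {S S' : ∀ k, List (Alph T k)}
    (h : ∀ v, ∃ v', Turing.TM2.stepAux (machineStmt code start l) v S = ⟨some l', v', S'⟩) :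
    Steps code start 1 l S l' S' := by
  intro v
  obtain ⟨v', hv'⟩ := h v
  exact ⟨v', by simp [flip, hv']⟩

theorem Steps.cast {n m : ℕ} {l l' : Lbl T} {S S' R R' : ∀ k, List (Alph T k)}
    (h : Steps code start n l S l' S') (hn : n = m) (hS : S = R) (hS' : S' = R') :
    Steps code start m l R l' R' := by
  subst hn hS hS'
  exact h

variable {i o : List Symb} {a b c d : List Bool} {u : List Unit} {t : List (Task T)}

theorem steps_dispatch (x : Task T) :
    Steps code start 1 .main (stk i o a b c d u (x :: t)) (.task x) (stk i o a b c d u t) :=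
  Steps.single fun v => ⟨_, by simp [machineStmt]; rfl⟩

/-- The buffer `B` after a value has been moved. -/
def bufB (δ : Option Bool) (v : Val) (b : List Bool) : List Bool :=
  if δ = some false then v.ser.reverse ++ b else b

/-- The buffer `C` after a value has been moved. -/
def bufC (δ : Option Bool) (v : Val) (c : List Bool) : List Bool :=
  if δ = some true then v.ser.reverse ++ c else c

/-- The label at which a moved value is left, given the counter at the start. -/
def afterMv (δ : Option Bool) : List Unit → Lbl T
  | [] => .main
  | _ :: _ => .task (.micro (.mv δ))

/-- The counter makes the end of the value recognizable: the loop stops when a leaf is moved while no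
further subtree is pending. -/
theorem steps_mv_loop (δ : Option Bool) (v : Val) (a b c : List Bool) (u : List Unit) :
    Steps code start v.size (.task (.micro (.mv δ))) (stk i o (v.ser ++ a) b c d u t)
      (afterMv δ u) (stk i o a (bufB δ v b) (bufC δ v c) d u.tail t) := by
  induction v generalizing a b c u with
  | nil =>
    refine Steps.single fun v => ?_
    rcases δ with _ | _ | _ <;> cases u <;>
      simp [machineStmt, Micro.stmt, Val.ser, Reg.getBit, Reg.isNone, afterMv, bufB, bufC]
  | cons x y ihx ihy =>
    have h1 : Steps code start 1 (.task (.micro (.mv δ)))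
        (stk i o ((Val.cons x y).ser ++ a) b c d u t) (.task (.micro (.mv δ)))
        (stk i o (x.ser ++ (y.ser ++ a)) (if δ = some false then true :: b else b)
          (if δ = some true then true :: c else c) d (() :: u) t) := by
      refine Steps.single fun v => ?_
      rcases δ with _ | _ | _ <;>
        simp [machineStmt, Micro.stmt, Val.ser, Reg.getBit]
    have h2 := (h1.trans (ihx (y.ser ++ a) _ _ (() :: u))).trans (ihy a _ _ u)
    refine h2.cast rfl rfl ?_
    rcases δ with _ | _ | _ <;> simp [bufB, bufC, Val.ser]

theorem steps_mv (δ : Option Bool) (v : Val) :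
    Steps code start (1 + v.size) .main
      (stk i o (v.ser ++ a) b c d [] (.micro (.mv δ) :: t)) .main
      (stk i o a (bufB δ v b) (bufC δ v c) d [] t) :=
  (steps_dispatch _).trans (steps_mv_loop δ v a b c [])

theorem steps_flushB_loop (a b : List Bool) :
    Steps code start (b.length + 1) (.task (.micro .flushB)) (stk i o a b c d u t) .main
      (stk i o (b.reverse ++ a) [] c d u t) := by
  induction b generalizing a with
  | nil =>
    refine Steps.single fun v => ?_
    simp [machineStmt, Micro.stmt, flushStmt, Reg.isNone]
  | cons x b ih =>
    have h1 : Steps code start 1 (.task (.micro .flushB)) (stk i o a (x :: b) c d u t)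
        (.task (.micro .flushB)) (stk i o (x :: a) b c d u t) :=
      Steps.single fun v => by simp [machineStmt, Micro.stmt, flushStmt, Reg.isNone, Reg.getBit]
    exact (h1.trans (ih (x :: a))).cast (by simp; omega) rfl (by simp)

theorem steps_flushC_loop (a c : List Bool) :
    Steps code start (c.length + 1) (.task (.micro .flushC)) (stk i o a b c d u t) .main
      (stk i o (c.reverse ++ a) b [] d u t) := by
  induction c generalizing a with
  | nil =>
    refine Steps.single fun v => ?_
    simp [machineStmt, Micro.stmt, flushStmt, Reg.isNone]
  | cons x c ih =>
    have h1 : Steps code start 1 (.task (.micro .flushC)) (stk i o a b (x :: c) d u t)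
        (.task (.micro .flushC)) (stk i o (x :: a) b c d u t) :=
      Steps.single fun v => by simp [machineStmt, Micro.stmt, flushStmt, Reg.isNone, Reg.getBit]
    exact (h1.trans (ih (x :: a))).cast (by simp; omega) rfl (by simp)

theorem steps_flushD_loop (c d : List Bool) :
    Steps code start (d.length + 1) (.task (.micro .flushD)) (stk i o a b c d u t) .main
      (stk i o a b (d.reverse ++ c) [] u t) := by
  induction d generalizing c with
  | nil =>
    refine Steps.single fun v => ?_
    simp [machineStmt, Micro.stmt, flushStmt, Reg.isNone]
  | cons x d ih =>
    have h1 : Steps code start 1 (.task (.micro .flushD)) (stk i o a b c (x :: d) u t)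
        (.task (.micro .flushD)) (stk i o a b (x :: c) d u t) :=
      Steps.single fun v => by simp [machineStmt, Micro.stmt, flushStmt, Reg.isNone, Reg.getBit]
    exact (h1.trans (ih (x :: c))).cast (by simp; omega) rfl (by simp)

theorem steps_dup_loop (a c d : List Bool) :
    Steps code start (c.length + 1) (.task (.micro .dup)) (stk i o a b c d u t) .main
      (stk i o (c.reverse ++ a) b [] (c.reverse ++ d) u t) := by
  induction c generalizing a d with
  | nil =>
    refine Steps.single fun v => ?_
    simp [machineStmt, Micro.stmt, flushStmt, Reg.isNone]
  | cons x c ih =>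
    have h1 : Steps code start 1 (.task (.micro .dup)) (stk i o a b (x :: c) d u t)
        (.task (.micro .dup)) (stk i o (x :: a) b c (x :: d) u t) :=
      Steps.single fun v => by simp [machineStmt, Micro.stmt, flushStmt, Reg.isNone, Reg.getBit]
    exact (h1.trans (ih (x :: a) (x :: d))).cast (by simp; omega) rfl (by simp)

/-- A run of at most `n` steps. -/
def StepsLE (code : T → Instr T) (start : T) (n : ℕ) (l : Lbl T) (S : ∀ k, List (Alph T k))
    (l' : Lbl T) (S' : ∀ k, List (Alph T k)) : Prop :=
  ∃ m ≤ n, Steps code start m l S l' S'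

theorem Steps.le {n m : ℕ} {l l' : Lbl T} {S S' : ∀ k, List (Alph T k)}
    (h : Steps code start n l S l' S') (hn : n ≤ m) : StepsLE code start m l S l' S' :=
  ⟨n, hn, h⟩

theorem StepsLE.trans {n m k : ℕ} {l l' l'' : Lbl T} {S S' S'' : ∀ k, List (Alph T k)}
    (h : StepsLE code start n l S l' S') (h' : StepsLE code start m l' S' l'' S'')
    (hk : n + m ≤ k) : StepsLE code start k l S l'' S'' := by
  obtain ⟨n', hn', hs⟩ := h
  obtain ⟨m', hm', hs'⟩ := h'
  exact ⟨n' + m', by omega, hs.trans hs'⟩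

theorem StepsLE.congr {n : ℕ} {l l' : Lbl T} {S S' S'' : ∀ k, List (Alph T k)}
    (h : StepsLE code start n l S l' S') (hS : S' = S'') : StepsLE code start n l S l' S'' :=
  hS ▸ h

theorem stepsLE_slide {v w : Val} {M : ℕ} (hv : v.size ≤ M) (hw : w.size ≤ M) :
    StepsLE code start (4 * (M + 1)) .main
      (stk i o (v.ser ++ (w.ser ++ a)) [] [] [] [] (slide ++ t)) .main
      (stk i o (v.ser ++ a) [] [] [] [] t) := by
  have h := ((steps_mv (code := code) (start := start) (i := i) (o := o) (a := w.ser ++ a)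
    (b := []) (c := []) (d := []) (t := [.micro (.mv none), .micro .flushC] ++ t) (some true) v).trans
    (steps_mv none w)).trans ((steps_dispatch _).trans (steps_flushC_loop _ _))
  exact (h.cast rfl (by simp [slide]) (by simp [bufB, bufC])).le (by
    simp [bufC, Val.length_ser]; omega)

theorem steps_mv_many (l : List Val) (b : List Bool) :
    Steps code start (l.length + (serEnv l).length) .main
      (stk i o (serEnv l ++ a) b c d []
        (List.replicate l.length (.micro (.mv (some false))) ++ t)) .main
      (stk i o a ((serEnv l).reverse ++ b) c d [] t) := by
  induction l generalizing b with
  | nil => exact Steps.refl _ _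
  | cons v l ih =>
    have h := (steps_mv (code := code) (start := start) (i := i) (o := o) (a := serEnv l ++ a)
      (b := b) (c := c) (d := d)
      (t := List.replicate l.length (.micro (.mv (some false))) ++ t) (some false) v).trans (ih _)
    refine h.cast ?_ ?_ ?_
    · simp [serEnv, Val.length_ser]; omega
    · simp [serEnv, List.replicate_succ]
    · simp [serEnv, bufB]

theorem serEnv_cons (v : Val) (l : List Val) : serEnv (v :: l) = v.ser ++ serEnv l := rfl

theorem serEnv_append (l l' : List Val) : serEnv (l ++ l') = serEnv l ++ serEnv l' := by
  simp [serEnv]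

theorem length_serEnv_le {l : List Val} {M : ℕ} (h : ∀ u ∈ l, u.size ≤ M) :
    (serEnv l).length ≤ l.length * M := by
  induction l with
  | nil => simp [serEnv]
  | cons v l ih =>
    have h1 := h v (by simp)
    have h2 := ih fun u hu => h u (by simp [hu])
    simp only [serEnv_cons, List.length_append, Val.length_ser, List.length_cons, Nat.add_mul]
    omega

/-- Copying the value of a variable to the top of the work stack. -/
theorem stepsLE_pick {env : List Val} {v : Val} {M k : ℕ} (h : env[k]? = some v)
    (henv : ∀ u ∈ env, u.size ≤ M) (x : T) :
    StepsLE code start (12 * (M + 1) * (k + 1)) .main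
      (stk i o (serEnv env ++ a) [] [] [] [] ((Instr.var k).tasks x ++ t)) .main
      (stk i o (v.ser ++ (serEnv env ++ a)) [] [] [] [] t) := by
  obtain ⟨hk, hv⟩ := List.getElem?_eq_some_iff.1 h
  have hsplit : env = env.take k ++ v :: env.drop (k + 1) := by
    rw [← hv, List.getElem_cons_drop, List.take_append_drop]
  have hlen : (env.take k).length = k := by simp; omega
  set l₁ := env.take k with hl₁
  set l₂ := env.drop (k + 1) with hl₂
  have hsz : (serEnv l₁).length ≤ k * M := by
    have := length_serEnv_le (l := l₁) (M := M) fun u hu => henv u (by rw [hsplit]; simp [hu])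
    rwa [hlen] at this
  have hvM : v.size ≤ M := henv v (by rw [hsplit]; simp)
  have h1 := steps_mv_many (code := code) (start := start) (i := i) (o := o)
    (a := v.ser ++ (serEnv l₂ ++ a)) (c := []) (d := [])
    (t := [.micro (.mv (some true)), .micro .dup, .micro .flushB, .micro .flushD, .micro .flushC] ++ t)
    l₁ []
  have h2 := ((((h1.trans (steps_mv (some true) v)).trans
    ((steps_dispatch _).trans (steps_dup_loop _ _ _))).trans
    ((steps_dispatch _).trans (steps_flushB_loop _ _))).trans
    ((steps_dispatch _).trans (steps_flushD_loop _ _))).trans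
    ((steps_dispatch _).trans (steps_flushC_loop _ _))
  rw [hsplit]
  refine (h2.cast rfl ?_ ?_).le (m := 12 * (M + 1) * (k + 1)) ?_
  · simp [serEnv_append, serEnv_cons, Instr.tasks, hlen]
  · simp [serEnv_append, serEnv_cons, bufB, bufC]
  · simp [bufB, bufC, Val.length_ser, hlen]
    nlinarith

end Runs

/-! ### Interpreting a program on the machine -/

section Programs

variable {ι : Type}

/-- The set of subexpressions of an expression. -/
def Exp.subs : Exp ι → Set (Exp ι)
  | .var i => {.var i}
  | .nil => {.nil}
  | .cons b a => {.cons b a} ∪ (b.subs ∪ a.subs)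
  | .bind e b => {.bind e b} ∪ (e.subs ∪ b.subs)
  | .branch e l r => {.branch e l r} ∪ (e.subs ∪ (l.subs ∪ r.subs))
  | .call f => {.call f}

theorem Exp.finite_subs (e : Exp ι) : e.subs.Finite := by
  induction e with
  | var | nil | call => exact Set.finite_singleton _
  | cons _ _ h1 h2 | bind _ _ h1 h2 => exact (Set.finite_singleton _).union (h1.union h2)
  | branch _ _ _ h1 h2 h3 => exact (Set.finite_singleton _).union (h1.union (h2.union h3))

theorem Exp.mem_subs_self (e : Exp ι) : e ∈ e.subs := by
  cases e <;> simp [Exp.subs]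

namespace Exp

theorem mem_subs_cons_left (b a : Exp ι) : b ∈ (Exp.cons b a).subs := .inr (.inl b.mem_subs_self)
theorem mem_subs_cons_right (b a : Exp ι) : a ∈ (Exp.cons b a).subs := .inr (.inr a.mem_subs_self)
theorem mem_subs_bind_left (e b : Exp ι) : e ∈ (Exp.bind e b).subs := .inr (.inl e.mem_subs_self)
theorem mem_subs_bind_right (e b : Exp ι) : b ∈ (Exp.bind e b).subs := .inr (.inr b.mem_subs_self)
theorem mem_subs_branch (e l r : Exp ι) : e ∈ (Exp.branch e l r).subs :=
  .inr (.inl e.mem_subs_self)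
theorem mem_subs_branch_left (e l r : Exp ι) : l ∈ (Exp.branch e l r).subs :=
  .inr (.inr (.inl l.mem_subs_self))
theorem mem_subs_branch_right (e l r : Exp ι) : r ∈ (Exp.branch e l r).subs :=
  .inr (.inr (.inr r.mem_subs_self))

end Exp

theorem Exp.subs_subset {e e' : Exp ι} (h : e ∈ e'.subs) : e.subs ⊆ e'.subs := by
  induction e' with
  | var | nil | call =>
    obtain rfl := h
    exact subset_rfl
  | cons b a h1 h2 | bind b a h1 h2 =>
    rcases h with rfl | h | h
    · exact subset_rfl
    · exact ((h1 h).trans Set.subset_union_left).trans Set.subset_union_right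
    · exact ((h2 h).trans Set.subset_union_right).trans Set.subset_union_right
  | branch e l r h1 h2 h3 =>
    rcases h with rfl | h | h | h
    · exact subset_rfl
    · exact ((h1 h).trans Set.subset_union_left).trans Set.subset_union_right
    · exact (((h2 h).trans Set.subset_union_left).trans Set.subset_union_right).trans
        Set.subset_union_right
    · exact (((h3 h).trans Set.subset_union_right).trans Set.subset_union_right).trans
        Set.subset_union_right

/-- The nodes of the control-flow graph of a program: all subexpressions of its procedures. -/
def Node (P : ι → Exp ι) : Type := {e : Exp ι // ∃ f, e ∈ (P f).subs}

theorem Node.finite [Finite ι] (P : ι → Exp ι) : Finite (Node P) := by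
  have h : (⋃ f, (P f).subs).Finite := Set.finite_iUnion fun f => (P f).finite_subs
  have := h.to_subtype
  exact Finite.of_injective (fun e : Node P => (⟨e.1, Set.mem_iUnion.2 e.2⟩ : ⋃ f, (P f).subs))
    fun a b hab => Subtype.ext (congrArg (fun x => x.1) hab)

theorem node_sub {P : ι → Exp ι} {e e' : Exp ι} (h : ∃ f, e ∈ (P f).subs) (h' : e' ∈ e.subs) :
    ∃ f, e' ∈ (P f).subs :=
  h.imp fun _ hf => Exp.subs_subset hf h'

/-- The control-flow graph of a program. -/
def nodeCode (P : ι → Exp ι) : Node P → Instr (Node P)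
  | ⟨.var i, _⟩ => .var i
  | ⟨.nil, _⟩ => .nil
  | ⟨.cons b a, h⟩ => .cons ⟨b, node_sub h (b.mem_subs_cons_left a)⟩
      ⟨a, node_sub h (b.mem_subs_cons_right a)⟩
  | ⟨.bind e b, h⟩ => .bind ⟨e, node_sub h (e.mem_subs_bind_left b)⟩
      ⟨b, node_sub h (e.mem_subs_bind_right b)⟩
  | ⟨.branch e l r, h⟩ => .branch ⟨e, node_sub h (e.mem_subs_branch l r)⟩
      ⟨l, node_sub h (e.mem_subs_branch_left l r)⟩ ⟨r, node_sub h (e.mem_subs_branch_right l r)⟩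
  | ⟨.call f, _⟩ => .jump ⟨P f, f, (P f).mem_subs_self⟩

variable {P : ι → Exp ι} {start : Node P}

/-- Evaluation of a node other than `nil` starts by pushing its tasks. -/
theorem steps_ev {i o : List Symb} {a : List Bool} {t : List (Task (Node P))} (x : Node P)
    (hx : nodeCode P x ≠ .nil) :
    Steps (nodeCode P) start 2 .main (stk i o a [] [] [] [] (.ev x :: t)) .main
      (stk i o a [] [] [] [] ((nodeCode P x).tasks x ++ t)) := by
  refine (steps_dispatch _).trans (Steps.single fun v => ?_)
  simp only [machineStmt]
  exact ⟨v, by rw [stepAux_pushes]; simp⟩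

theorem forall_size_cons {M : ℕ} {v : Val} {env : List Val} (hv : v.size ≤ M)
    (henv : ∀ u ∈ env, u.size ≤ M) : ∀ u ∈ v :: env, u.size ≤ M := by
  simpa using ⟨hv, henv⟩

/-- The machine evaluates expressions, with time linear in the number of evaluation steps times the
bound on the size of values. -/
theorem stepsLE_eval {M : ℕ} (hM : 1 ≤ M) {e : Exp ι} {env : List Val} {v : Val} {n : ℕ}
    (h : Eval P M e env v n) (henv : ∀ u ∈ env, u.size ≤ M) (he : ∃ f, e ∈ (P f).subs)
    (i o : List Symb) (a : List Bool) (t : List (Task (Node P))) :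
    StepsLE (nodeCode P) start (20 * (M + 1) * n) .main
      (stk i o (serEnv env ++ a) [] [] [] [] (.ev ⟨e, he⟩ :: t)) .main
      (stk i o (v.ser ++ (serEnv env ++ a)) [] [] [] [] t) := by
  induction h generalizing a t with
  | var h =>
    refine ((steps_ev _ (by simp [nodeCode])).le le_rfl).trans (stepsLE_pick h henv ⟨_, he⟩) ?_
    nlinarith
  | nil =>
    refine ((steps_dispatch _).trans (Steps.single fun v => ?_)).le (n := 1 + 1) ?_
    · simp [machineStmt, nodeCode, Val.ser]
    · omega
  | @cons b x env vb va nb na hb ha hle ihb iha =>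
    have hvb := hb.size_le hM henv
    have h3 : Steps (nodeCode P) start 2 .main
        (stk i o (va.ser ++ (serEnv (vb :: env) ++ a)) [] [] [] [] (.micro .pair :: t)) .main
        (stk i o ((Val.cons va vb).ser ++ (serEnv env ++ a)) [] [] [] [] t) :=
      (steps_dispatch _).trans (Steps.single fun v => by
        simp [machineStmt, Micro.stmt, Val.ser, serEnv_cons])
    have h2 := iha (forall_size_cons hvb henv)
      (node_sub he (b.mem_subs_cons_right x)) a (.micro .pair :: t)
    rw [serEnv_cons, List.append_assoc] at h2
    have h1 := ihb henv
      (node_sub he (b.mem_subs_cons_left x)) a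
      (.ev ⟨x, (node_sub he (b.mem_subs_cons_right x))⟩ ::
        .micro .pair :: t)
    rw [serEnv_cons, List.append_assoc] at h3
    refine ((steps_ev _ (by simp [nodeCode])).le le_rfl).trans
      (h1.trans (h2.trans (h3.le le_rfl) le_rfl) le_rfl) ?_
    nlinarith
  | @bind e b env v w n m hv hw ihe ihb =>
    have hvM := hv.size_le hM henv
    have henv' := forall_size_cons hvM henv
    have h2 := ihb henv'
      (node_sub he (e.mem_subs_bind_right b)) a (slide ++ t)
    rw [serEnv_cons, List.append_assoc] at h2
    have h1 := ihe henv
      (node_sub he (e.mem_subs_bind_left b)) a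
      (.ev ⟨b, (node_sub he (e.mem_subs_bind_right b))⟩ ::
        (slide ++ t))
    refine ((steps_ev _ (by simp [nodeCode])).le le_rfl).trans
      (h1.trans (h2.trans (stepsLE_slide (hw.size_le hM henv') hvM) le_rfl) le_rfl) ?_
    nlinarith
  | @branch_nil e l r env w n m hv hw ihe ihl =>
    have hl' := node_sub he (e.mem_subs_branch_left l r)
    have h2 := ihl henv hl' a t
    have h1 := ihe henv
      (node_sub he (e.mem_subs_branch l r)) a
      (.br ⟨_, he⟩ :: t)
    have h3 : Steps (nodeCode P) start 2 .main
        (stk i o (Val.nil.ser ++ (serEnv env ++ a)) [] [] [] [] (.br ⟨_, he⟩ :: t)) .main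
        (stk i o (serEnv env ++ a) [] [] [] [] (.ev ⟨l, hl'⟩ :: t)) :=
      (steps_dispatch _).trans (Steps.single fun v => by
        simp [machineStmt, nodeCode, Val.ser, Reg.getBit, stepAux_pushes])
    refine ((steps_ev _ (by simp [nodeCode])).le le_rfl).trans
      (h1.trans ((h3.le le_rfl).trans h2 le_rfl) le_rfl) ?_
    nlinarith
  | @branch_cons e l r env x y w n m hv hw ihe ihr =>
    have hr' := node_sub he (e.mem_subs_branch_right l r)
    have hxy := hv.size_le hM henv
    simp only [Val.size] at hxy
    have hx : x.size ≤ M := by omega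
    have hy : y.size ≤ M := by omega
    have henv' := forall_size_cons hx (forall_size_cons hy henv)
    have h2 := ihr henv' hr' a (slide ++ (slide ++ t))
    have hwM := hw.size_le hM henv'
    simp only [serEnv_cons, List.append_assoc] at h2
    have h1 := ihe henv
      (node_sub he (e.mem_subs_branch l r)) a
      (.br ⟨_, he⟩ :: t)
    have h3 : Steps (nodeCode P) start 2 .main
        (stk i o ((Val.cons x y).ser ++ (serEnv env ++ a)) [] [] [] [] (.br ⟨_, he⟩ :: t)) .main
        (stk i o (x.ser ++ (y.ser ++ (serEnv env ++ a))) [] [] [] []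
          (.ev ⟨r, hr'⟩ :: (slide ++ (slide ++ t)))) :=
      (steps_dispatch _).trans (Steps.single fun v => by
        simp [machineStmt, nodeCode, Val.ser, Reg.getBit, stepAux_pushes])
    refine ((steps_ev _ (by simp [nodeCode])).le le_rfl).trans
      (h1.trans ((h3.le le_rfl).trans (h2.trans ((stepsLE_slide hwM hx).trans
        (stepsLE_slide hwM hy) le_rfl) le_rfl) le_rfl) le_rfl) ?_
    nlinarith
  | @call f env v n h ih =>
    have h1 := ih henv ⟨f, (P f).mem_subs_self⟩ a t
    refine ((steps_ev _ (by simp [nodeCode])).le le_rfl).trans h1 ?_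
    nlinarith

/-! ### Input and output of the machine -/

/-- The list of tokens of a string. -/
def tokens (w : List Symb) : Val := Val.ofList (w.map fun s => Val.unary s.code)

theorem size_unary_code (s : Symb) : (Val.unary s.code).size ≤ 11 := by
  rcases s with (_ | _) | _ | _ | _ | _ <;> simp [Symb.code, Val.size_unary]

theorem size_tokens_le (w : List Symb) : (tokens w).size ≤ 12 * w.length + 1 := by
  induction w with
  | nil => simp [tokens, Val.ofList, Val.size]
  | cons s w ih =>
    have := size_unary_code s
    simp only [tokens, List.map_cons, Val.ofList, Val.size, List.length_cons] at ih ⊢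
    omega

theorem length_le_size_tokens (w : List Symb) : w.length ≤ (tokens w).size := by
  induction w with
  | nil => simp
  | cons s w ih =>
    simp only [tokens, List.map_cons, Val.ofList, Val.size, List.length_cons] at ih ⊢
    omega

theorem tokens_cons (s : Symb) (w : List Symb) :
    tokens (s :: w) = .cons (Val.unary s.code) (tokens w) := rfl

variable {T : Type} {code : T → Instr T} {st : T}

theorem steps_in1 (w o : List Symb) :
    Steps code st (w.length + 1) .in1 (stk w o [] [] [] [] [] []) .in2
      (stk [] (w.reverse ++ o) [false] [] [] [] [] []) := by
  induction w generalizing o with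
  | nil => exact Steps.single fun v => ⟨_, by simp [machineStmt, Reg.isNone]; rfl⟩
  | cons s w ih =>
    have h1 : Steps code st 1 .in1 (stk (s :: w) o [] [] [] [] [] []) .in1
        (stk w (s :: o) [] [] [] [] [] []) :=
      Steps.single fun v => ⟨_, by simp [machineStmt, Reg.isNone, Reg.getSymb]; rfl⟩
    exact (h1.trans (ih (s :: o))).cast (by simp; omega) rfl (by simp)

theorem steps_in2 (w w' : List Symb) :
    Steps code st (w.length + 1) .in2 (stk [] w (tokens w').ser [] [] [] [] []) .main
      (stk [] [] (tokens (w.reverse ++ w')).ser [] [] [] [] (.ev st :: slide)) := by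
  induction w generalizing w' with
  | nil => exact Steps.single fun v => ⟨_, by simp [machineStmt, Reg.isNone, stepAux_pushes]; rfl⟩
  | cons s w ih =>
    have h1 : Steps code st 1 .in2 (stk [] (s :: w) (tokens w').ser [] [] [] [] []) .in2
        (stk [] w (tokens (s :: w')).ser [] [] [] [] []) := by
      refine Steps.single fun v => ⟨.symb (some s), ?_⟩
      rcases s with (_ | _) | _ | _ | _ | _ <;>
        simp [machineStmt, Reg.isNone, Reg.getSymb, stepAux_pushBits, tokens_cons, Val.ser,
          Symb.code, Val.unary]
    exact (h1.trans (ih (s :: w'))).cast (by simp; omega) rfl (by simp)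

theorem steps_out2 (s : Symb) (w : List Symb) (a : List Bool) :
    Steps code st (s.code + 1) (.out2 0) (stk w [] ((Val.unary s.code).ser ++ a) [] [] [] [] [])
      .out1 (stk (s :: w) [] a [] [] [] [] []) := by
  have h1 (k : Fin 6) (b : List Bool) : Steps code st 1 (.out2 k)
      (stk w [] (true :: false :: b) [] [] [] [] []) (.out2 (k + 1))
      (stk w [] b [] [] [] [] []) :=
    Steps.single fun v => ⟨_, by simp [machineStmt, Reg.getBit]; rfl⟩
  have h2 (k : Fin 6) : Steps code st 1 (.out2 k)
      (stk w [] (false :: a) [] [] [] [] []) .out1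
      (stk (Symb.ofCode k :: w) [] a [] [] [] [] []) :=
    Steps.single fun v => ⟨_, by simp [machineStmt, Reg.getBit]; rfl⟩
  rcases s with (_ | _) | _ | _ | _ | _
  · exact h2 0
  · exact (h1 0 _).trans (h2 1)
  · exact ((h1 0 _).trans (h1 1 _)).trans (h2 2)
  · exact (((h1 0 _).trans (h1 1 _)).trans (h1 2 _)).trans (h2 3)
  · exact ((((h1 0 _).trans (h1 1 _)).trans (h1 2 _)).trans (h1 3 _)).trans (h2 4)
  · exact (((((h1 0 _).trans (h1 1 _)).trans (h1 2 _)).trans (h1 3 _)).trans (h1 4 _)).trans (h2 5)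

theorem steps_out1 (w w' : List Symb) :
    StepsLE code st (7 * w.length + 1) .out1 (stk w' [] (tokens w).ser [] [] [] [] []) .out3
      (stk (w.reverse ++ w') [] [] [] [] [] [] []) := by
  induction w generalizing w' with
  | nil => exact (Steps.single fun v => ⟨_, by
      simp [machineStmt, Reg.getBit, tokens, Val.ofList, Val.ser]; rfl⟩).le (by simp)
  | cons s w ih =>
    have h1 : Steps code st 1 .out1 (stk w' [] (tokens (s :: w)).ser [] [] [] [] []) (.out2 0)
        (stk w' [] ((Val.unary s.code).ser ++ (tokens w).ser) [] [] [] [] []) :=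
      Steps.single fun v => ⟨_, by simp [machineStmt, Reg.getBit, tokens_cons, Val.ser]; rfl⟩
    have hs : s.code ≤ 5 := by rcases s with (_ | _) | _ | _ | _ | _ <;> simp [Symb.code]
    have h2 := ((h1.trans (steps_out2 s w' _)).le le_rfl).trans (ih (s :: w')) le_rfl
    obtain ⟨n, hn, h⟩ := h2
    exact (h.cast rfl rfl (by simp)).le (by simp only [List.length_cons]; omega)

/-- The final phase; the last step halts. -/
theorem iterate_out3 (w o : List Symb) (v : Reg T) :
    (flip bind (Turing.TM2.step (machineStmt code st)))^[w.length + 1]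
      (some ⟨some .out3, v, stk w o [] [] [] [] [] []⟩) =
      some ⟨none, .idle, stk [] (w.reverse ++ o) [] [] [] [] [] []⟩ := by
  induction w generalizing o v with
  | nil => simp [flip, machineStmt, Reg.isNone]
  | cons s w ih =>
    rw [List.length_cons, Function.iterate_succ_apply]
    have h1 : flip bind (Turing.TM2.step (machineStmt code st))
        (some ⟨some .out3, v, stk (s :: w) o [] [] [] [] [] []⟩) =
        some ⟨some .out3, .symb (some s), stk w (s :: o) [] [] [] [] [] []⟩ := by
      simp [flip, machineStmt, Reg.isNone, Reg.getSymb]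
    rw [h1, ih]
    simp

/-- The machine that runs the procedure `f` of a program on the tokens of its input. -/
noncomputable def interpreter [Finite ι] (P : ι → Exp ι) (f : ι) :
    Turing.TM2ComputableAux Symb Symb where
  tm := @machine _ (Node.finite P) (nodeCode P) ⟨P f, f, (P f).mem_subs_self⟩
  inputAlphabet := Equiv.refl _
  outputAlphabet := Equiv.refl _

theorem finite_alphabets_interpreter [Finite ι] (P : ι → Exp ι) (f : ι)
    (k : (interpreter P f).tm.K) : Finite ((interpreter P f).tm.Γ k) :=
  @Alph.finite _ (Node.finite P) k

theorem initList_eq [Finite T] (code : T → Instr T) (st : T) (w : List Symb) :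
    Turing.initList (machine code st) w = ⟨some .in1, .idle, stk w [] [] [] [] [] [] []⟩ := by
  unfold Turing.initList
  congr 1
  funext k
  cases k <;> rfl

theorem haltList_eq [Finite T] (code : T → Instr T) (st : T) (w : List Symb) :
    Turing.haltList (machine code st) w = ⟨none, .idle, stk [] w [] [] [] [] [] []⟩ := by
  unfold Turing.haltList
  congr 1
  funext k
  cases k <;> rfl

/-- If a procedure maps the tokens of `w` to those of `w'`, then its machine outputs `w'` on
input `w`, within time proportional to the number of evaluation steps times the size of values. -/
theorem outputsWithin_interpreter [Finite ι] (P : ι → Exp ι) (f : ι) {M n : ℕ} {w w' : List Symb}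
    (h : Eval P M (P f) [tokens w] (tokens w') n) (hM : (tokens w).size ≤ M) :
    OutputsWithin (interpreter P f) w w' (40 * (M + 1) * (n + 1)) := by
  have hM1 : 1 ≤ M := (Val.size_pos _).trans_le hM
  have henv : ∀ u ∈ [tokens w], u.size ≤ M := by simpa using hM
  have hM' := h.size_le hM1 henv
  have hf : ∃ g, P f ∈ (P g).subs := ⟨f, (P f).mem_subs_self⟩
  have e1 := (steps_in1 (code := nodeCode P) (st := ⟨P f, hf⟩) w []).trans
    ((steps_in2 w.reverse []).cast rfl (by simp [tokens, Val.ofList, Val.ser]) rfl)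
  rw [List.reverse_reverse, List.append_nil] at e1
  have e2 := stepsLE_eval (start := ⟨P f, hf⟩) hM1 h henv hf [] [] [] slide
  have e3 := stepsLE_slide (code := nodeCode P) (start := ⟨P f, hf⟩) (i := []) (o := []) (a := [])
    (t := []) hM' hM
  simp only [List.append_nil, serEnv, List.flatMap_cons, List.flatMap_nil] at e2 e3
  have e4 : Steps (nodeCode P) ⟨P f, hf⟩ 1 .main
      (stk [] [] (tokens w').ser [] [] [] [] []) .out1
      (stk [] [] (tokens w').ser [] [] [] [] []) :=
    Steps.single fun v => ⟨_, by simp [machineStmt]; rfl⟩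
  have e5 := steps_out1 (code := nodeCode P) (st := ⟨P f, hf⟩) w' []
  obtain ⟨m, hm, hs⟩ := ((e1.le le_rfl).trans (e2.trans (e3.trans ((e4.le le_rfl).trans e5 le_rfl)
    le_rfl) le_rfl) le_rfl)
  obtain ⟨v', hv'⟩ := hs .idle
  have e6 := iterate_out3 (code := nodeCode P) (st := ⟨P f, hf⟩) (w'.reverse ++ []) [] v'
  have hlen := length_le_size_tokens w
  have hlen' := length_le_size_tokens w'
  refine ⟨⟨⟨((w'.reverse ++ []).length + 1) + m, ?_⟩, ?_⟩⟩
  · have := Node.finite P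
    have hi := initList_eq (T := Node P) (code := nodeCode P) (st := ⟨P f, hf⟩)
    have hh := haltList_eq (T := Node P) (code := nodeCode P) (st := ⟨P f, hf⟩)
    rw [Function.iterate_add_apply]
    have h1 : Turing.initList (interpreter P f).tm (w.map (interpreter P f).inputAlphabet.symm) =
        (⟨some .in1, .idle, stk w [] [] [] [] [] [] []⟩ : Turing.TM2.Cfg _ _ _) := by
      have : w.map (interpreter P f).inputAlphabet.symm = w := List.map_id w
      rw [this]
      exact hi w
    have h2 : Option.map (Turing.haltList (interpreter P f).tm)
        (some (w'.map (interpreter P f).outputAlphabet.symm)) =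
        some (⟨none, .idle, stk [] w' [] [] [] [] [] []⟩ : Turing.TM2.Cfg _ _ _) := by
      have : w'.map (interpreter P f).outputAlphabet.symm = w' := List.map_id w'
      rw [this]
      exact congrArg some (hh w')
    rw [h1, h2]
    rw [List.append_nil, List.reverse_reverse, List.append_nil] at e6
    rw [List.append_nil] at hv' ⊢
    exact Eq.trans (congrArg _ hv') e6
  · simp only [List.length_append, List.length_reverse, List.length_nil] at hm ⊢
    nlinarith

end Programs

/-! ### Symbolic execution -/

section Wp

variable {ι : Type}

/-- `lookupThen Q i env`: variable `i` exists in `env` and its value satisfies `Q`. -/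
def lookupThen (Q : Val → Prop) : ℕ → List Val → Prop
  | _, [] => False
  | 0, v :: _ => Q v
  | i + 1, _ :: env => lookupThen Q i env

theorem exists_of_lookupThen {Q : Val → Prop} {i : ℕ} {env : List Val} (h : lookupThen Q i env) :
    ∃ v, env[i]? = some v ∧ Q v := by
  induction env generalizing i with
  | nil => cases i <;> exact h.elim
  | cons v env ih =>
    cases i with
    | zero => exact ⟨v, rfl, h⟩
    | succ i => exact ih h

/-- Weakest precondition: the evaluation of an expression terminates with a value and a number of
steps satisfying `Q`.

For a concrete expression, weak head normalization of `wp P M e env Q` executes `e` symbolically.  It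
stops at the size conditions of `cons`, which appear as conjunctions, and at calls, which appear as
existential statements and are resolved by `wp_call`.  The proofs below consist of such runs. -/
def wp (P : ι → Exp ι) (M : ℕ) : Exp ι → List Val → (Val → ℕ → Prop) → Prop
  | .var i, env, Q => lookupThen (fun v => Q v (i + 1)) i env
  | .nil, _, Q => Q .nil 1
  | .cons b a, env, Q => wp P M b env fun vb nb => wp P M a (vb :: env) fun va na =>
      1 + va.size + vb.size ≤ M ∧ Q (.cons va vb) (nb + na + 1)
  | .bind e b, env, Q => wp P M e env fun v n => wp P M b (v :: env) fun w m => Q w (n + m + 1)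
  | .branch e l r, env, Q => wp P M e env fun v n =>
      match v with
      | .nil => wp P M l env fun w m => Q w (n + m + 1)
      | .cons x y => wp P M r (x :: y :: env) fun w m => Q w (n + m + 1)
  | .call f, env, Q => ∃ v n, Eval P M (.call f) env v n ∧ Q v n

theorem exists_eval_of_wp {P : ι → Exp ι} {M : ℕ} {e : Exp ι} {env : List Val}
    {Q : Val → ℕ → Prop} (h : wp P M e env Q) : ∃ v n, Eval P M e env v n ∧ Q v n := by
  induction e generalizing env Q with
  | var i =>
    obtain ⟨v, hv, hQ⟩ := exists_of_lookupThen h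
    exact ⟨v, _, .var hv, hQ⟩
  | nil => exact ⟨_, _, .nil, h⟩
  | cons b a ihb iha =>
    obtain ⟨vb, nb, hb, h⟩ := ihb h
    obtain ⟨va, na, ha, hM, h⟩ := iha h
    exact ⟨_, _, .cons hb ha hM, h⟩
  | bind e b ihe ihb =>
    obtain ⟨v, n, he, h⟩ := ihe h
    obtain ⟨w, m, hb, h⟩ := ihb h
    exact ⟨_, _, .bind he hb, h⟩
  | branch e l r ihe ihl ihr =>
    obtain ⟨v, n, he, h⟩ := ihe h
    cases v with
    | nil =>
      obtain ⟨w, m, hl, h⟩ := ihl h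
      exact ⟨_, _, .branch_nil he hl, h⟩
    | cons x y =>
      obtain ⟨w, m, hr, h⟩ := ihr h
      exact ⟨_, _, .branch_cons he hr, h⟩
  | call f => exact h

/-- Procedure `f` maps the arguments `args` to `res` within `n` steps, in any environment. -/
def Computes (P : ι → Exp ι) (M : ℕ) (f : ι) (args : List Val) (res : Val) (n : ℕ) : Prop :=
  ∀ env, ∃ m ≤ n, Eval P M (.call f) (args ++ env) res m

theorem computes_of_wp {P : ι → Exp ι} {M : ℕ} {f : ι} {args : List Val} {res : Val} {n : ℕ}
    (h : ∀ env, wp P M (P f) (args ++ env) fun v m => v = res ∧ m + 1 ≤ n) :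
    Computes P M f args res n := by
  intro env
  obtain ⟨v, m, hv, rfl, hm⟩ := exists_eval_of_wp (h env)
  exact ⟨m + 1, hm, .call hv⟩

theorem wp_call {P : ι → Exp ι} {M : ℕ} {f : ι} {args env : List Val} {res : Val} {n : ℕ}
    {Q : Val → ℕ → Prop} (h : Computes P M f args res n) (hQ : ∀ m ≤ n, Q res m) :
    ∃ v n, Eval P M (.call f) (args ++ env) v n ∧ Q v n := by
  obtain ⟨m, hm, he⟩ := h env
  exact ⟨res, m, he, hQ m hm⟩

theorem Computes.mono {P : ι → Exp ι} {M : ℕ} {f : ι} {args : List Val} {res : Val} {n m : ℕ}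
    (h : Computes P M f args res n) (hm : n ≤ m) : Computes P M f args res m :=
  fun env => (h env).imp fun _ h => ⟨h.1.trans hm, h.2⟩

end Wp

/-! ### The program -/

/-- The names of the procedures. -/
inductive Proc where
  | add | mul | le | fmul | fadd | fle | eq | look | mean | score | gen | walk | hasQuery | copies
  | parseNat | parse | app | print | main
  deriving DecidableEq

instance : Fintype Proc where
  elems := {.add, .mul, .le, .fmul, .fadd, .fle, .eq, .look, .mean, .score, .gen, .walk, .hasQuery,
    .copies, .parseNat, .parse, .app, .print, .main}
  complete p := by cases p <;> decide

/-- Higher-order syntax: an expression as a function of the length of the environment in which it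
is evaluated, so that variables can be named by their level, counted from the bottom. -/
abbrev Tm := ℕ → Exp Proc

namespace Tm

/-- The variable with level `k`. -/
def level (k : ℕ) : Tm := fun d => .var (d - 1 - k)
def nil : Tm := fun _ => .nil
def cons (a b : Tm) : Tm := fun d => .cons (b d) (a (d + 1))
def bind (e : Tm) (f : Tm → Tm) : Tm := fun d => .bind (e d) (f (level d) (d + 1))
def branch (e l : Tm) (r : Tm → Tm → Tm) : Tm := fun d =>
  .branch (e d) (l d) (r (level (d + 1)) (level d) (d + 2))
/-- A call pushes the arguments on the environment, the last one first, so that they are the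
variables `0`, `1`, … of the body of the procedure. -/
def call1 (f : Proc) (a : Tm) : Tm := fun d => .bind (a d) (.call f)
def call2 (f : Proc) (a b : Tm) : Tm := fun d => .bind (b d) (.bind (a (d + 1)) (.call f))
def call3 (f : Proc) (a b c : Tm) : Tm := fun d =>
  .bind (c d) (.bind (b (d + 1)) (.bind (a (d + 2)) (.call f)))
def call5 (f : Proc) (a b c e g : Tm) : Tm := fun d =>
  .bind (g d) (.bind (e (d + 1)) (.bind (c (d + 2)) (.bind (b (d + 3))
    (.bind (a (d + 4)) (.call f)))))
def call6 (f : Proc) (a b c e g h : Tm) : Tm := fun d =>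
  .bind (h d) (.bind (g (d + 1)) (.bind (e (d + 2)) (.bind (c (d + 3)) (.bind (b (d + 4))
    (.bind (a (d + 5)) (.call f))))))

/-- Bits are the values `nil` (false) and `cons nil nil` (true), so branching tests them. -/
def ite (b t e : Tm) : Tm := branch b e fun _ _ => t

/-- The bit `false`. -/
def b0 : Tm := nil

/-- The bit `true`. -/
def b1 : Tm := cons nil nil

/-- The tag of a stochastic node. Leaves and decision nodes are tagged by `b0` and `b1`. -/
def tag2 : Tm := cons nil b1

/-- The token of the separator: tokens are numbered in unary, see `Symb.code`. -/
def tok2 : Tm := tag2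

/-- The token of a leaf. -/
def tok3 : Tm := cons nil tok2

/-- The token of a decision node. -/
def tok4 : Tm := cons nil tok3

/-- The number `1` in binary. -/
def one : Tm := cons b1 nil

/-- The number `2` in binary. -/
def two : Tm := cons b0 one

/-- Case distinction on the root of a decision tree, which is a pair of a tag and of the components. -/
def caseTree (t : Tm) (leaf : Tm → Tm) (query : Tm → Tm → Tm → Tm) (coin : Tm → Tm → Tm) : Tm :=
  branch t nil fun tag body =>
    branch tag (leaf body) fun _ tag' =>
      branch tag' (branch body nil fun i ts => branch ts nil fun t₀ t₁ => query i t₀ t₁)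
        fun _ _ => branch body nil fun t₀ t₁ => coin t₀ t₁

/-- The average of two fractions. -/
def avg (f g : Tm) : Tm := call2 .fmul (cons one two) (call2 .fadd f g)

end Tm

open Tm in
/-- The bodies of the procedures, in higher-order syntax.

* `add c x y`, `mul x y`: arithmetic on binary numbers, `c` a carry bit.
* `le c x y`: the bit of `x < y ∨ (x = y ∧ c)`.
* `fmul`, `fadd`, `fle`: arithmetic on fractions.
* `eq`: equality of values; `look p i`: the value of variable `i` in the partial assignment `p`.
* `mean`, `score`, `gen`, `walk`: see `RDT.meanFrac`, `RDT.score`, `RDT.build` and `RDT.walk`.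
* `hasQuery t`: whether `t` has a decision node; `copies s a b`: the number of times that `a` has to
  be added to `s` to reach `b`, in unary.
* `parseNat`, `parse`: the number or tree at the beginning of a list of tokens, and the rest.
* `app`: concatenation; `print t l`: the tokens of the deterministic tree `t`, followed by `l`. -/
def body : Proc → Exp Proc
  | .add => (fun c x y : Tm =>
      branch x
        (branch y (ite c (cons b1 nil) nil) fun d y' =>
          ite c (ite d (cons b0 (call3 .add b1 nil y')) (cons b1 y')) y)
        fun b x' =>
          branch y (ite c (ite b (cons b0 (call3 .add b1 nil x')) (cons b1 x')) x) fun d y' =>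
            ite b
              (ite d
                (ite c (cons b1 (call3 .add b1 x' y')) (cons b0 (call3 .add b1 x' y')))
                (ite c (cons b0 (call3 .add b1 x' y')) (cons b1 (call3 .add b0 x' y'))))
              (ite d
                (ite c (cons b0 (call3 .add b1 x' y')) (cons b1 (call3 .add b0 x' y')))
                (ite c (cons b1 (call3 .add b0 x' y')) (cons b0 (call3 .add b0 x' y')))))
      (level 2) (level 1) (level 0) 3
  | .mul => (fun x y : Tm =>
      branch x nil fun b x' =>
        bind (call2 .mul x' y) fun r =>
          bind (branch r nil fun _ _ => cons b0 r) fun r' =>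
            ite b (call3 .add b0 y r') r')
      (level 1) (level 0) 2
  | .le => (fun c x y : Tm =>
      branch x (branch y c fun _ _ => b1) fun b x' =>
        branch y b0 fun d y' =>
          call3 .le (ite b (ite d c b0) (ite d b1 c)) x' y')
      (level 2) (level 1) (level 0) 3
  | .fmul => (fun f g : Tm =>
      branch f nil fun p d => branch g nil fun p' d' =>
        cons (call2 .mul p p') (call2 .mul d d'))
      (level 1) (level 0) 2
  | .fadd => (fun f g : Tm =>
      branch f nil fun p d => branch g nil fun p' d' =>
        cons (call3 .add b0 (call2 .mul p d') (call2 .mul p' d)) (call2 .mul d d'))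
      (level 1) (level 0) 2
  | .fle => (fun f g : Tm =>
      branch f nil fun p d => branch g nil fun p' d' =>
        call3 .le b1 (call2 .mul p d') (call2 .mul p' d))
      (level 1) (level 0) 2
  | .eq => (fun x y : Tm =>
      branch x (branch y b1 fun _ _ => b0) fun a b =>
        branch y b0 fun c d => ite (call2 .eq a c) (call2 .eq b d) b0)
      (level 1) (level 0) 2
  | .look => (fun p i : Tm =>
      branch p nil fun e p' => branch e nil fun k b =>
        ite (call2 .eq k i) (cons nil b) (call2 .look p' i))
      (level 1) (level 0) 2
  | .mean => (fun t p : Tm =>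
      caseTree t (fun v => v)
        (fun i t₀ t₁ => branch (call2 .look p i)
          (avg (call2 .mean t₀ (cons (cons i b0) p)) (call2 .mean t₁ (cons (cons i b1) p)))
          fun _ b => ite b (call2 .mean t₁ p) (call2 .mean t₀ p))
        (fun t₀ t₁ => avg (call2 .mean t₀ p) (call2 .mean t₁ p)))
      (level 1) (level 0) 2
  | .score => (fun t p s c r : Tm =>
      let avgPair (x y : Tm) : Tm := bind x fun x => bind y fun y =>
        branch x nil fun f g => branch y nil fun f' g' => cons (avg f f') (avg g g')
      caseTree t
        (fun v => cons (call2 .fmul v (call2 .fadd v (call2 .fadd s s)))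
          (call2 .fmul c (call2 .fmul v (call2 .mean r p))))
        (fun i t₀ t₁ => branch (call2 .look p i)
          (avgPair (call5 .score t₀ (cons (cons i b0) p) s c r)
            (call5 .score t₁ (cons (cons i b1) p) s c r))
          fun _ b => ite b (call5 .score t₁ p s c r) (call5 .score t₀ p s c r))
        (fun t₀ t₁ => avgPair (call5 .score t₀ p s c r) (call5 .score t₁ p s c r)))
      (level 4) (level 3) (level 2) (level 1) (level 0) 5
  | .gen => (fun j p s c r : Tm =>
      branch j (cons nil (call2 .mean r p)) fun _ j' => call6 .walk r j' p s c r)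
      (level 4) (level 3) (level 2) (level 1) (level 0) 5
  | .walk => (fun t j p s c r : Tm =>
      caseTree t
        (fun v => call5 .gen j p (call2 .fadd s v) (call2 .fadd c (cons two one)) r)
        (fun i t₀ t₁ => branch (call2 .look p i)
          (cons b1 (cons i (cons (call6 .walk t₀ j (cons (cons i b0) p) s c r)
            (call6 .walk t₁ j (cons (cons i b1) p) s c r))))
          fun _ b => ite b (call6 .walk t₁ j p s c r) (call6 .walk t₀ j p s c r))
        (fun t₀ t₁ => bind (call5 .score t₀ p s c r) fun x => bind (call5 .score t₁ p s c r) fun y =>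
          branch x nil fun f g => branch y nil fun f' g' =>
            ite (call2 .fle (call2 .fadd f g') (call2 .fadd f' g))
              (call6 .walk t₀ j p s c r) (call6 .walk t₁ j p s c r)))
      (level 5) (level 4) (level 3) (level 2) (level 1) (level 0) 6
  | .hasQuery => (fun t : Tm =>
      caseTree t (fun _ => b0) (fun _ _ _ => b1)
        (fun t₀ t₁ => ite (call1 .hasQuery t₀) b1 (call1 .hasQuery t₁)))
      (level 0) 1
  | .copies => (fun s a b : Tm =>
      ite (call3 .le b1 b s) nil (cons nil (call3 .copies (call3 .add b0 s a) a b)))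
      (level 2) (level 1) (level 0) 3
  | .parseNat => (fun l : Tm =>
      branch l nil fun tok rest =>
        let digit : Tm := branch (call1 .parseNat rest) nil fun x rest' => cons (cons tok x) rest'
        branch tok digit fun _ tok' => branch tok' digit fun _ _ => cons nil rest)
      (level 0) 1
  | .parse => (fun l : Tm =>
      branch l nil fun t0 rest => branch t0 nil fun _ t1 => branch t1 nil fun _ t2 =>
        branch t2 nil fun _ t3 => branch t3
          (branch (call1 .parseNat rest) nil fun p r₁ => branch (call1 .parseNat r₁) nil fun d r₂ =>
            cons (cons nil (cons p d)) r₂)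
          fun _ t4 => branch t4
            (branch (call1 .parseNat rest) nil fun i r₁ => branch (call1 .parse r₁) nil fun x r₂ =>
              branch (call1 .parse r₂) nil fun y r₃ => cons (cons b1 (cons i (cons x y))) r₃)
            fun _ _ => branch (call1 .parse rest) nil fun x r₁ =>
              branch (call1 .parse r₁) nil fun y r₂ => cons (cons tag2 (cons x y)) r₂)
      (level 0) 1
  | .app => (fun x y : Tm => branch x y fun a x' => cons a (call2 .app x' y))
      (level 1) (level 0) 2
  | .print => (fun t l : Tm =>
      caseTree t
        (fun v => branch v nil fun p d =>
          cons tok3 (call2 .app p (cons tok2 (call2 .app d (cons tok2 l)))))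
        (fun i t₀ t₁ => cons tok4 (call2 .app i (cons tok2 (call2 .print t₀ (call2 .print t₁ l)))))
        (fun _ _ => nil))
      (level 1) (level 0) 2
  | .main => (fun l : Tm =>
      branch (call1 .parseNat l) nil fun a r₁ => branch (call1 .parseNat r₁) nil fun b r₂ =>
        branch (call1 .parse r₂) nil fun r _ =>
          bind (ite (call1 .hasQuery r) (call3 .copies nil a b) nil) fun k =>
            call2 .print (call5 .gen k nil (cons nil one) (cons two one) r) nil)
      (level 0) 1

/-! ### Arithmetic -/

/-- A bit as a value. -/
def bitVal : Bool → Val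
  | false => .nil
  | true => .cons .nil .nil

/-- A natural number as the list of its binary digits, least significant digit first. -/
def natVal (n : ℕ) : Val := Val.ofList (n.bits.map bitVal)

theorem natVal_zero : natVal 0 = .nil := by simp [natVal, Val.ofList]

theorem natVal_bit (b : Bool) (n m : ℕ) (h : m = 2 * n + b.toNat) (hm : m ≠ 0) :
    natVal m = .cons (bitVal b) (natVal n) := by
  have : m = Nat.bit b n := by rw [h, Nat.bit_val]
  subst this
  rw [natVal, Nat.bits_append_bit]
  · simp [Val.ofList, natVal]
  · rintro rfl
    cases b <;> simp_all

theorem exists_bit {m : ℕ} (hm : m ≠ 0) : ∃ (b : Bool) (n : ℕ), m = 2 * n + b.toNat ∧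
    natVal m = .cons (bitVal b) (natVal n) := by
  refine ⟨decide (m % 2 = 1), m / 2, ?_, ?_⟩
  · by_cases h : m % 2 = 1 <;> simp [h] <;> omega
  · refine natVal_bit _ _ _ ?_ hm
    by_cases h : m % 2 = 1 <;> simp [h] <;> omega

theorem size_bitVal (b : Bool) : (bitVal b).size ≤ 3 := by cases b <;> simp [bitVal, Val.size]

theorem size_natVal {n L : ℕ} (h : n < 2 ^ L) : (natVal n).size ≤ 4 * L + 1 := by
  induction L generalizing n with
  | zero =>
    have : n = 0 := by simpa using h
    simp [this, natVal_zero, Val.size]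
  | succ L ih =>
    rcases eq_or_ne n 0 with rfl | hn
    · simp [natVal_zero, Val.size]
    obtain ⟨b, m, hm, he⟩ := exists_bit hn
    have := ih (n := m) (by rw [pow_succ] at h; omega)
    have := size_bitVal b
    rw [he, Val.size]
    omega


section

variable {M : ℕ}

/-- Ripple-carry addition; the cases are those of the bits and of the carry. -/
theorem computes_add {L : ℕ} (hM : 4 * L + 20 ≤ M) (c : Bool) {x y : ℕ} (hx : x < 2 ^ L)
    (hy : y < 2 ^ L) :
    Computes body M .add [bitVal c, natVal x, natVal y] (natVal (x + y + c.toNat)) (60 * (L + 1)) := by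
  have h1 : natVal 1 = .cons (.cons .nil .nil) .nil := by
    rw [natVal_bit true 0 1 rfl one_ne_zero, natVal_zero, bitVal]
  induction L generalizing c x y with
  | zero =>
    obtain rfl : x = 0 := by simpa using hx
    obtain rfl : y = 0 := by simpa using hy
    refine computes_of_wp fun env => ?_
    rw [natVal_zero]
    cases c <;> conv => whnf
    · exact ⟨natVal_zero.symm, by omega⟩
    · repeat (refine ⟨by simp only [Val.size]; omega, ?_⟩; conv => whnf)
      exact ⟨h1.symm, by omega⟩
  | succ L ih =>
    have h0 : 0 < 2 ^ L := Nat.two_pow_pos L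
    rw [pow_succ] at hx hy
    have ih' (c) {x y : ℕ} (hx : x < 2 ^ L) (hy : y < 2 ^ L) := ih (by omega) c hx hy
    have ih0 {y : ℕ} (hy : y < 2 ^ L) :
        Computes body M .add [bitVal true, .nil, natVal y] (natVal (y + 1)) (60 * (L + 1)) := by
      have := ih' true h0 hy
      rwa [natVal_zero, zero_add] at this
    have hsize {n : ℕ} (hn : n ≤ 2 ^ L * 2) : (natVal n).size ≤ 4 * (L + 2) + 1 :=
      size_natVal (by rw [pow_add]; omega)
    refine computes_of_wp fun env => ?_
    rcases eq_or_ne x 0 with rfl | hx0 <;> rcases eq_or_ne y 0 with rfl | hy0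
    · rw [natVal_zero]
      cases c <;> conv => whnf
      · exact ⟨natVal_zero.symm, by omega⟩
      · repeat (refine ⟨by simp only [Val.size]; omega, ?_⟩; conv => whnf)
        exact ⟨h1.symm, by omega⟩
    · obtain ⟨d, y', hyd, hy'⟩ := exists_bit hy0
      rw [natVal_zero, hy']
      cases c
      · conv => whnf
        exact ⟨by simpa using hy'.symm, by omega⟩
      have := hsize (n := y') (by omega)
      cases d <;> conv => whnf
      · repeat (refine ⟨by simp only [Val.size]; omega, ?_⟩; conv => whnf)
        exact ⟨(natVal_bit true y' _ (by simp [hyd]) (by simp)).symm, by omega⟩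
      · repeat (refine ⟨by simp only [Val.size]; omega, ?_⟩; conv => whnf)
        refine wp_call (ih0 (y := y') (by simp at hyd; omega)) fun m hm => ?_
        have := hsize (n := y' + 1) (by simp at hyd; omega)
        conv => whnf
        repeat (refine ⟨by simp only [Val.size]; omega, ?_⟩; conv => whnf)
        exact ⟨(natVal_bit false (y' + 1) _ (by simp [hyd]; ring) (by simp)).symm, by omega⟩
    · obtain ⟨b, x', hxb, hx'⟩ := exists_bit hx0
      rw [natVal_zero, hx']
      cases c
      · conv => whnf
        exact ⟨by simpa using hx'.symm, by omega⟩
      have := hsize (n := x') (by omega)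
      cases b <;> conv => whnf
      · repeat (refine ⟨by simp only [Val.size]; omega, ?_⟩; conv => whnf)
        exact ⟨(natVal_bit true x' _ (by simp [hxb]) (by simp)).symm, by omega⟩
      · repeat (refine ⟨by simp only [Val.size]; omega, ?_⟩; conv => whnf)
        refine wp_call (ih0 (y := x') (by simp at hxb; omega)) fun m hm => ?_
        have := hsize (n := x' + 1) (by simp at hxb; omega)
        conv => whnf
        repeat (refine ⟨by simp only [Val.size]; omega, ?_⟩; conv => whnf)
        exact ⟨(natVal_bit false (x' + 1) _ (by simp [hxb]; ring) (by simp)).symm, by omega⟩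
    · obtain ⟨b, x', hxb, hx'⟩ := exists_bit hx0
      obtain ⟨d, y', hyd, hy'⟩ := exists_bit hy0
      have hxL : x' < 2 ^ L := by omega
      have hyL : y' < 2 ^ L := by omega
      have hs0 := hsize (n := x' + y' + false.toNat) (by simp; omega)
      have hs1 := hsize (n := x' + y' + true.toNat) (by simp; omega)
      rw [hx', hy']
      cases b <;> cases d <;> cases c <;> (conv => whnf) <;>
        (repeat (refine ⟨by simp only [Val.size]; omega, ?_⟩; conv => whnf)) <;>
        (first
          | refine wp_call (ih' false hxL hyL) (fun m hm => ?_)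
          | refine wp_call (ih' true hxL hyL) (fun m hm => ?_)) <;>
        (conv => whnf) <;>
        (repeat (refine ⟨by simp only [Val.size]; omega, ?_⟩; conv => whnf)) <;>
        (first
          | refine ⟨(natVal_bit false _ _ ?_ ?_).symm, by omega⟩
          | refine ⟨(natVal_bit true _ _ ?_ ?_).symm, by omega⟩) <;>
        simp only [Bool.toNat_true, Bool.toNat_false] at hxb hyd ⊢ <;> omega

theorem computes_mul {L K : ℕ} (hM : 4 * (L + K) + 20 ≤ M) {x y : ℕ} (hx : x < 2 ^ L)
    (hy : y < 2 ^ K) :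
    Computes body M .mul [natVal x, natVal y] (natVal (x * y)) (100 * (L + 1) * (L + K + 1)) := by
  induction L generalizing x with
  | zero =>
    obtain rfl : x = 0 := by simpa using hx
    refine computes_of_wp fun env => ?_
    rw [natVal_zero, zero_mul, natVal_zero]
    conv => whnf
    exact ⟨rfl, by omega⟩
  | succ L ih =>
    refine computes_of_wp fun env => ?_
    rcases eq_or_ne x 0 with rfl | hx0
    · rw [natVal_zero, zero_mul, natVal_zero]
      conv => whnf
      have : 0 < (L + 1 + 1) * (L + 1 + K + 1) := by positivity
      exact ⟨rfl, by rw [mul_assoc]; omega⟩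
    obtain ⟨b, x', hxb, hx'⟩ := exists_bit hx0
    have hxL : x' < 2 ^ L := by rw [pow_succ] at hx; omega
    have hK : (0 : ℕ) < 2 ^ K := Nat.two_pow_pos K
    have hr : x' * y < 2 ^ (L + K) := by rw [pow_add]; exact Nat.mul_lt_mul'' hxL hy
    have hr' : 2 * (x' * y) < 2 ^ (L + 1 + K) := by
      rw [show L + 1 + K = L + K + 1 by ring, pow_succ]; omega
    have hy' : y < 2 ^ (L + 1 + K) := hy.trans_le (Nat.pow_le_pow_right (by omega) (by omega))
    have hs := size_natVal hr
    have hb := size_bitVal b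
    rw [hx']
    conv => whnf
    refine wp_call (ih (by omega) hxL) fun m hm => ?_
    have hadd := computes_add (M := M) (L := L + 1 + K) (by omega) false hy' hr'
    -- doubling adds a digit `0`, except that zero has no digits
    have heq : natVal (2 * (x' * y)) =
        if x' * y = 0 then .nil else .cons .nil (natVal (x' * y)) := by
      split_ifs with h
      · rw [h, mul_zero, natVal_zero]
      · exact natVal_bit false _ _ (by simp) (by omega)
    have hfin : y + 2 * (x' * y) + false.toNat = (2 * x' + true.toNat) * y := by simp; ring
    have hstep : m + 60 * (L + 1 + K + 1) + 90 ≤ 100 * (L + 1 + 1) * (L + 1 + K + 1) := by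
      nlinarith
    by_cases h : x' * y = 0
    · rw [if_pos h] at heq
      rw [h, natVal_zero]
      cases b <;> conv => whnf
      · refine ⟨?_, by omega⟩
        rw [hxb, ← natVal_zero, ← h]
        simp [mul_assoc, h]
      · rw [heq] at hadd
        refine wp_call hadd fun m' hm' => ?_
        conv => whnf
        exact ⟨by rw [hxb, hfin], by omega⟩
    · rw [if_neg h] at heq
      obtain ⟨d, z, -, hz⟩ := exists_bit h
      rw [hz] at heq hs ⊢
      conv => whnf
      refine ⟨by simp only [Val.size] at hs ⊢; omega, ?_⟩
      cases b <;> conv => whnf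
      · refine ⟨?_, by omega⟩
        rw [hxb, ← heq]
        simp [mul_assoc]
      · rw [heq] at hadd
        refine wp_call hadd fun m' hm' => ?_
        conv => whnf
        exact ⟨by rw [hxb, hfin], by omega⟩

theorem computes_le {L : ℕ} (hM : 10 ≤ M) (c : Bool) {x y : ℕ} (hx : x < 2 ^ L) (hy : y < 2 ^ L) :
    Computes body M .le [bitVal c, natVal x, natVal y]
      (bitVal (decide (x < y ∨ x = y ∧ c = true))) (60 * (L + 1)) := by
  induction L generalizing c x y with
  | zero =>
    obtain rfl : x = 0 := by simpa using hx
    obtain rfl : y = 0 := by simpa using hy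
    refine computes_of_wp fun env => ?_
    rw [natVal_zero]
    conv => whnf
    exact ⟨by cases c <;> simp, by omega⟩
  | succ L ih =>
    rw [pow_succ] at hx hy
    refine computes_of_wp fun env => ?_
    rcases eq_or_ne x 0 with rfl | hx0 <;> rcases eq_or_ne y 0 with rfl | hy0
    · rw [natVal_zero]
      conv => whnf
      exact ⟨by cases c <;> simp, by omega⟩
    · obtain ⟨d, y', hyd, hy'⟩ := exists_bit hy0
      rw [natVal_zero, hy']
      conv => whnf
      repeat (refine ⟨by simp only [Val.size]; omega, ?_⟩; conv => whnf)
      refine ⟨?_, by omega⟩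
      rw [decide_eq_true (by omega)]
      rfl
    · obtain ⟨b, x', hxb, hx'⟩ := exists_bit hx0
      rw [natVal_zero, hx']
      conv => whnf
      refine ⟨?_, by omega⟩
      rw [decide_eq_false (by omega)]
      rfl
    · obtain ⟨b, x', hxb, hx'⟩ := exists_bit hx0
      obtain ⟨d, y', hyd, hy'⟩ := exists_bit hy0
      have hxL : x' < 2 ^ L := by omega
      have hyL : y' < 2 ^ L := by omega
      rw [hx', hy']
      cases b <;> cases d <;> cases c <;> (conv => whnf) <;>
        (repeat (refine ⟨by simp only [Val.size]; omega, ?_⟩; conv => whnf)) <;>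
        (first
          | refine wp_call (ih false hxL hyL) (fun m hm => ?_)
          | refine wp_call (ih true hxL hyL) (fun m hm => ?_)) <;>
        (conv => whnf) <;>
        (refine ⟨congrArg bitVal (decide_eq_decide.2 ?_), by omega⟩) <;>
        simp only [Bool.toNat_true, Bool.toNat_false] at hxb hyd <;> simp <;> omega

/-! ### Fractions -/

/-- A fraction, given by numerator and denominator, as a value. -/
def fracVal (f : ℕ × ℕ) : Val := .cons (natVal f.1) (natVal f.2)

/-- Product of fractions, without cancellation. -/
def fmul (f g : ℕ × ℕ) : ℕ × ℕ := (f.1 * g.1, f.2 * g.2)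

/-- Sum of fractions, without cancellation. -/
def fadd (f g : ℕ × ℕ) : ℕ × ℕ := (f.1 * g.2 + g.1 * f.2, f.2 * g.2)

/-- Comparison of fractions by cross-multiplication. -/
def fle (f g : ℕ × ℕ) : Bool := decide (f.1 * g.2 ≤ g.1 * f.2)

/-- The average of two fractions, as the program computes it. -/
def favg (f g : ℕ × ℕ) : ℕ × ℕ := fmul (1, 2) (fadd f g)

/-- Numerator and denominator have at most `L` binary digits. -/
def FB (L : ℕ) (f : ℕ × ℕ) : Prop := f.1 < 2 ^ L ∧ f.2 < 2 ^ L

theorem FB.mono {L K : ℕ} {f : ℕ × ℕ} (h : FB L f) (hL : L ≤ K) : FB K f :=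
  have := Nat.pow_le_pow_right (n := 2) (by norm_num) hL
  ⟨h.1.trans_le this, h.2.trans_le this⟩

theorem FB.fmul {L K : ℕ} {f g : ℕ × ℕ} (hf : FB L f) (hg : FB K g) :
    FB (L + K) (fmul f g) := by
  refine ⟨?_, ?_⟩ <;> rw [pow_add]
  exacts [Nat.mul_lt_mul'' hf.1 hg.1, Nat.mul_lt_mul'' hf.2 hg.2]

theorem FB.fadd {L K : ℕ} {f g : ℕ × ℕ} (hf : FB L f) (hg : FB K g) :
    FB (L + K + 1) (fadd f g) := by
  have h1 := Nat.mul_lt_mul'' hf.1 hg.2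
  have h2 := Nat.mul_lt_mul'' hg.1 hf.2
  have h3 := Nat.mul_lt_mul'' hf.2 hg.2
  simp only [FB, QueryDerand.fadd, pow_succ, pow_add]
  rw [mul_comm (2 ^ K)] at h2
  omega

theorem FB.favg {L K : ℕ} {f g : ℕ × ℕ} (hf : FB L f) (hg : FB K g) :
    FB (L + K + 3) (favg f g) := by
  have h : FB 2 (1, 2) := by simp [FB]
  exact (h.fmul (hf.fadd hg)).mono (by omega)

theorem FB.size_le {L : ℕ} {f : ℕ × ℕ} (h : FB L f) : (fracVal f).size ≤ 8 * L + 3 := by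
  have := size_natVal h.1
  have := size_natVal h.2
  simp only [fracVal, Val.size]
  omega

theorem computes_fmul {L : ℕ} (hM : 40 * (L + 1) ≤ M) {f g : ℕ × ℕ} (hf : FB L f) (hg : FB L g) :
    Computes body M .fmul [fracVal f, fracVal g] (fracVal (fmul f g)) (1000 * (L + 1) ^ 2) := by
  have h1 := computes_mul (M := M) (by omega) hf.1 hg.1
  have h2 := computes_mul (M := M) (by omega) hf.2 hg.2
  have hs := (hf.fmul hg).size_le
  have : 2 * (100 * (L + 1) * (L + L + 1)) + 100 ≤ 1000 * (L + 1) ^ 2 := by nlinarith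
  refine computes_of_wp fun env => ?_
  rw [fracVal, fracVal]
  conv => whnf
  refine wp_call h2 fun m hm => ?_
  conv => whnf
  refine wp_call h1 fun m' hm' => ?_
  conv => whnf
  exact ⟨by simp only [fracVal, fmul, Val.size] at hs ⊢; omega, rfl, by omega⟩

theorem computes_fadd {L : ℕ} (hM : 40 * (L + 1) ≤ M) {f g : ℕ × ℕ} (hf : FB L f) (hg : FB L g) :
    Computes body M .fadd [fracVal f, fracVal g] (fracVal (fadd f g)) (1000 * (L + 1) ^ 2) := by
  have h1 := computes_mul (M := M) (by omega) hf.1 hg.2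
  have h2 := computes_mul (M := M) (by omega) hg.1 hf.2
  have h3 := computes_mul (M := M) (by omega) hf.2 hg.2
  have h4 := computes_add (M := M) (L := L + L) (by omega) false
    (by rw [pow_add]; exact Nat.mul_lt_mul'' hf.1 hg.2)
    (by rw [pow_add]; exact Nat.mul_lt_mul'' hg.1 hf.2)
  have hs := (hf.fadd hg).size_le
  have : 3 * (100 * (L + 1) * (L + L + 1)) + 60 * (L + L + 1) + 100 ≤ 1000 * (L + 1) ^ 2 := by
    nlinarith
  refine computes_of_wp fun env => ?_
  rw [fracVal, fracVal]
  conv => whnf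
  refine wp_call h3 fun m hm => ?_
  conv => whnf
  refine wp_call h2 fun m' hm' => ?_
  conv => whnf
  refine wp_call h1 fun m₁ hm₁ => ?_
  conv => whnf
  refine wp_call h4 fun m₂ hm₂ => ?_
  conv => whnf
  exact ⟨by simp only [fracVal, fadd, Val.size, Bool.toNat_false, add_zero] at hs ⊢; omega, rfl,
    by omega⟩

theorem computes_fle {L : ℕ} (hM : 40 * (L + 1) ≤ M) {f g : ℕ × ℕ} (hf : FB L f) (hg : FB L g) :
    Computes body M .fle [fracVal f, fracVal g] (bitVal (fle f g)) (1000 * (L + 1) ^ 2) := by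
  have h1 := computes_mul (M := M) (by omega) hf.1 hg.2
  have h2 := computes_mul (M := M) (by omega) hg.1 hf.2
  have h4 := computes_le (M := M) (L := L + L) (by omega) true
    (by rw [pow_add]; exact Nat.mul_lt_mul'' hf.1 hg.2)
    (by rw [pow_add]; exact Nat.mul_lt_mul'' hg.1 hf.2)
  have : 2 * (100 * (L + 1) * (L + L + 1)) + 60 * (L + L + 1) + 100 ≤ 1000 * (L + 1) ^ 2 := by
    nlinarith
  refine computes_of_wp fun env => ?_
  rw [fracVal, fracVal]
  conv => whnf
  refine wp_call h2 fun m hm => ?_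
  conv => whnf
  refine wp_call h1 fun m' hm' => ?_
  conv => whnf
  refine ⟨by simp only [Val.size]; omega, ?_⟩
  conv => whnf
  refine wp_call h4 fun m₁ hm₁ => ?_
  conv => whnf
  exact ⟨congrArg bitVal (decide_eq_decide.2 (by simp; omega)), by omega⟩

/-! ### Generic procedures on values -/

theorem computes_eq (hM : 10 ≤ M) (x y : Val) :
    Computes body M .eq [x, y] (bitVal (decide (x = y))) (30 * x.size) := by
  induction x generalizing y with
  | nil =>
    refine computes_of_wp fun env => ?_
    cases y <;> conv => whnf
    · refine ⟨by simp only [Val.size]; omega, ?_⟩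
      conv => whnf
      exact ⟨by simp [bitVal], by simp [Val.size]⟩
    · exact ⟨by simp [bitVal], by simp [Val.size]⟩
  | cons a b iha ihb =>
    refine computes_of_wp fun env => ?_
    cases y with
    | nil =>
      conv => whnf
      exact ⟨by simp [bitVal], by simp only [Val.size]; omega⟩
    | cons c d =>
      conv => whnf
      refine wp_call (iha c) fun m hm => ?_
      by_cases h : a = c
      · rw [decide_eq_true h]
        conv => whnf
        refine wp_call (ihb d) fun m' hm' => ?_
        conv => whnf
        exact ⟨by simp [h], by simp only [Val.size]; omega⟩
      · rw [decide_eq_false h]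
        conv => whnf
        exact ⟨by simp [h, bitVal], by simp only [Val.size]; omega⟩

theorem computes_app (l l' : List Val) (hM : (Val.ofList (l ++ l')).size ≤ M) :
    Computes body M .app [Val.ofList l, Val.ofList l'] (Val.ofList (l ++ l'))
      (20 * (l.length + 1)) := by
  induction l with
  | nil =>
    refine computes_of_wp fun env => ?_
    rw [Val.ofList]
    conv => whnf
    exact ⟨rfl, by simp⟩
  | cons a l ih =>
    simp only [List.cons_append, Val.ofList, Val.size] at hM
    refine computes_of_wp fun env => ?_
    rw [Val.ofList]
    conv => whnf
    refine wp_call (ih (by omega)) fun m hm => ?_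
    conv => whnf
    exact ⟨by omega, rfl, by simp only [List.length_cons]; omega⟩

end

/-! ### The algorithm on decision trees -/

/-- A rational number in `[0,1]` as a pair of numerator and denominator. -/
def UnitFrac.frac (v : UnitFrac) : ℕ × ℕ := (v.num, v.den)

/-- The value of variable `i` in the partial assignment `π`, an association list. -/
def look {n : ℕ} : List (Fin n × Bool) → Fin n → Option Bool
  | [], _ => none
  | e :: π, i => if e.1 = i then some e.2 else look π i

namespace RDT

variable {n : ℕ}

/-- The expectation of the output of a tree over its coins and over the variables not assigned
by `π`, as a fraction. -/
def meanFrac : RDT n → List (Fin n × Bool) → ℕ × ℕ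
  | leaf v, _ => v.frac
  | query i t₀ t₁, π =>
    match look π i with
    | none => favg (t₀.meanFrac ((i, false) :: π)) (t₁.meanFrac ((i, true) :: π))
    | some b => if b then t₁.meanFrac π else t₀.meanFrac π
  | coin t₀ t₁, π => favg (t₀.meanFrac π) (t₁.meanFrac π)

/-- Componentwise average of pairs of fractions. -/
def favgPair (x y : (ℕ × ℕ) × (ℕ × ℕ)) : (ℕ × ℕ) × (ℕ × ℕ) := (favg x.1 y.1, favg x.2 y.2)

/-- The two expectations `𝔼 v (v + 2 s)` and `𝔼 c v μ_R`, as fractions, where `v` is the output of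
the tree and the expectation is over its coins and over the variables not assigned by `π`. -/
def score (R : RDT n) (s c : ℕ × ℕ) : RDT n → List (Fin n × Bool) → (ℕ × ℕ) × (ℕ × ℕ)
  | leaf v, π => (fmul v.frac (fadd v.frac (fadd s s)), fmul c (fmul v.frac (R.meanFrac π)))
  | query i t₀ t₁, π =>
    match look π i with
    | none => favgPair (score R s c t₀ ((i, false) :: π)) (score R s c t₁ ((i, true) :: π))
    | some b => if b then score R s c t₁ π else score R s c t₀ π
  | coin t₀ t₁, π => favgPair (score R s c t₀ π) (score R s c t₁ π)

/-- Whether the first subtree of a stochastic node is the better choice: the comparison of the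
differences of the two components of `score`. -/
def prefersLeft (x y : (ℕ × ℕ) × (ℕ × ℕ)) : Bool := fle (fadd x.1 y.2) (fadd y.1 x.2)

/-- Derandomization of one copy of a tree: decision nodes are kept unless their variable is known,
at a stochastic node the subtree with the smaller score is chosen, and leaves continue with `gen`,
after the value of the leaf has been added to `s`. -/
def walk (R : RDT n) (gen : List (Fin n × Bool) → ℕ × ℕ → ℕ × ℕ → RDT n) :
    RDT n → List (Fin n × Bool) → ℕ × ℕ → ℕ × ℕ → RDT n
  | leaf v, π, s, c => gen π (fadd s v.frac) (fadd c (2, 1))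
  | query i t₀ t₁, π, s, c =>
    match look π i with
    | none => query i (walk R gen t₀ ((i, false) :: π) s c) (walk R gen t₁ ((i, true) :: π) s c)
    | some b => if b then walk R gen t₁ π s c else walk R gen t₀ π s c
  | coin t₀ t₁, π, s, c =>
    if prefersLeft (score R s c t₀ π) (score R s c t₁ π) then walk R gen t₀ π s c
    else walk R gen t₁ π s c

theorem meanFrac_mem (t : RDT n) (π : List (Fin n × Bool)) :
    0 < (t.meanFrac π).2 ∧ (t.meanFrac π).1 ≤ (t.meanFrac π).2 := by
  have key : ∀ f g : ℕ × ℕ, 0 < f.2 ∧ f.1 ≤ f.2 → 0 < g.2 ∧ g.1 ≤ g.2 →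
      0 < (favg f g).2 ∧ (favg f g).1 ≤ (favg f g).2 := by
    rintro ⟨a, b⟩ ⟨c, d⟩ ⟨hb, hab⟩ ⟨hd, hcd⟩
    simp only [favg, fmul, fadd] at *
    exact ⟨by positivity, by nlinarith [Nat.mul_le_mul_right d hab, Nat.mul_le_mul_right b hcd]⟩
  induction t generalizing π with
  | leaf v => exact ⟨v.den_pos, v.num_le_den⟩
  | query i t₀ t₁ ih₀ ih₁ =>
    rw [meanFrac]
    split
    · exact key _ _ (ih₀ _) (ih₁ _)
    · split
      exacts [ih₁ π, ih₀ π]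
  | coin t₀ t₁ ih₀ ih₁ => exact key _ _ (ih₀ _) (ih₁ _)

/-- The deterministic tree that runs `j` further derandomized copies of `R`, when the partial
assignment `π` is known, and outputs the expectation of `R` under the assignment then known. -/
def build (R : RDT n) : ℕ → List (Fin n × Bool) → ℕ × ℕ → ℕ × ℕ → RDT n
  | 0, π, _, _ => leaf ⟨_, _, (R.meanFrac_mem π).1, (R.meanFrac_mem π).2⟩
  | j + 1, π, s, c => walk R (build R j) R π s c

end RDT

/-! ### Representation of trees and assignments -/

theorem natVal_injective : Function.Injective natVal := by
  intro x
  induction x using Nat.strong_induction_on with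
  | _ x ih =>
    intro y h
    rcases eq_or_ne x 0 with rfl | hx <;> rcases eq_or_ne y 0 with rfl | hy
    · rfl
    · obtain ⟨d, y', -, hy'⟩ := exists_bit hy
      rw [natVal_zero, hy'] at h
      cases h
    · obtain ⟨d, y', -, hy'⟩ := exists_bit hx
      rw [natVal_zero, hy'] at h
      cases h
    · obtain ⟨b, x', hb, hx'⟩ := exists_bit hx
      obtain ⟨d, y', hd, hy'⟩ := exists_bit hy
      rw [hx', hy'] at h
      injection h with h1 h2
      have h3 := ih x' (by omega) h2
      have h4 : b = d := by revert h1; cases b <;> cases d <;> simp [bitVal]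
      rw [hb, hd, h3, h4]

/-- A decision tree as a value. -/
def RDT.val {n : ℕ} : RDT n → Val
  | .leaf v => .cons .nil (fracVal v.frac)
  | .query i t₀ t₁ => .cons (.cons .nil .nil) (.cons (natVal i) (.cons t₀.val t₁.val))
  | .coin t₀ t₁ => .cons (.cons .nil (.cons .nil .nil)) (.cons t₀.val t₁.val)

/-- A partial assignment as a value. -/
def asgVal {n : ℕ} : List (Fin n × Bool) → Val
  | [] => .nil
  | e :: π => .cons (.cons (natVal e.1) (bitVal e.2)) (asgVal π)

/-- An optional bit as a value. -/
def optVal : Option Bool → Val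
  | none => .nil
  | some b => .cons .nil (bitVal b)

/-- The length of the description of a tree. -/
abbrev RDT.len {n : ℕ} (t : RDT n) : ℕ := t.encode.length

theorem lt_two_pow_length_bits (k : ℕ) : k < 2 ^ k.bits.length := by
  rw [Nat.size_eq_bits_len]
  exact Nat.lt_size_self k

theorem lt_two_pow_encodeNat (k : ℕ) : k < 2 ^ (encodeNat k).length :=
  (lt_two_pow_length_bits k).trans_le (Nat.pow_le_pow_right (by norm_num) (by simp [encodeNat]))

theorem RDT.len_leaf {n : ℕ} (v : UnitFrac) :
    (leaf v : RDT n).len = 1 + (encodeNat v.num).length + (encodeNat v.den).length := by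
  simp [len, encode]; omega

theorem RDT.len_query {n : ℕ} (i : Fin n) (t₀ t₁ : RDT n) :
    (query i t₀ t₁).len = 1 + (encodeNat i).length + t₀.len + t₁.len := by
  simp [len, encode]; omega

theorem RDT.len_coin {n : ℕ} (t₀ t₁ : RDT n) :
    (coin t₀ t₁).len = 1 + t₀.len + t₁.len := by
  simp [len, encode]; omega

theorem one_le_length_encodeNat (k : ℕ) : 1 ≤ (encodeNat k).length := by simp [encodeNat]

theorem UnitFrac.fb_frac {n : ℕ} (v : UnitFrac) : FB (RDT.leaf v : RDT n).len v.frac := by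
  rw [RDT.len_leaf]
  exact ⟨(lt_two_pow_encodeNat v.num).trans_le (Nat.pow_le_pow_right (by norm_num) (by omega)),
    (lt_two_pow_encodeNat v.den).trans_le (Nat.pow_le_pow_right (by norm_num) (by omega))⟩

/-- All variables of a partial assignment have numbers with at most `L` binary digits. -/
def ABnd {n : ℕ} (L : ℕ) (π : List (Fin n × Bool)) : Prop := ∀ e ∈ π, (e.1 : ℕ) < 2 ^ L

theorem ABnd.cons {n L : ℕ} {π : List (Fin n × Bool)} (h : ABnd L π) {i : Fin n}
    (hi : (i : ℕ) < 2 ^ L) (b : Bool) : ABnd L ((i, b) :: π) := by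
  intro e he
  rcases List.mem_cons.1 he with rfl | he
  exacts [hi, h e he]

theorem ABnd.size_le {n L : ℕ} {π : List (Fin n × Bool)} (h : ABnd L π) :
    (asgVal π).size ≤ (4 * L + 6) * π.length + 1 := by
  induction π with
  | nil => simp [asgVal, Val.size]
  | cons e π ih =>
    have h1 := ih fun e he => h e (List.mem_cons_of_mem _ he)
    have h2 := size_natVal (h e List.mem_cons_self)
    have h3 := size_bitVal e.2
    simp only [asgVal, Val.size, List.length_cons, mul_add]
    omega

section

variable {M L A n : ℕ}

/-- The number of digits adds up over the leaves, and each of the fewer averages adds three more. -/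
theorem RDT.fb_meanFrac (t : RDT n) (π : List (Fin n × Bool)) :
    FB (3 * t.len) (t.meanFrac π) := by
  induction t generalizing π with
  | leaf v => exact v.fb_frac.mono (by omega)
  | query i t₀ t₁ ih₀ ih₁ =>
    have := len_query i t₀ t₁
    rw [meanFrac]
    split
    · exact ((ih₀ _).favg (ih₁ _)).mono (by omega)
    · split
      exacts [(ih₁ π).mono (by omega), (ih₀ π).mono (by omega)]
  | coin t₀ t₁ ih₀ ih₁ =>
    have := len_coin t₀ t₁
    exact ((ih₀ _).favg (ih₁ _)).mono (by omega)

theorem computes_look (hM : 10 ≤ M) (π : List (Fin n × Bool)) (hπ : ABnd L π) (i : Fin n) :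
    Computes body M .look [asgVal π, natVal i] (optVal (look π i))
      (200 * (L + 1) * (π.length + 1)) := by
  induction π with
  | nil =>
    refine computes_of_wp fun env => ?_
    rw [asgVal]
    conv => whnf
    exact ⟨rfl, by simp; omega⟩
  | cons e π ih =>
    have h1 := size_natVal (hπ e List.mem_cons_self)
    have h2 := computes_eq hM (natVal e.1) (natVal i)
    have h3 : 200 * (L + 1) * ((e :: π).length + 1) =
        200 * (L + 1) + 200 * (L + 1) * (π.length + 1) := by
      rw [List.length_cons]; ring
    have hb := size_bitVal e.2
    refine computes_of_wp fun env => ?_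
    rw [asgVal]
    conv => whnf
    by_cases h : e.1 = i
    · rw [decide_eq_true (by rw [h])] at h2
      refine wp_call h2 fun m hm => ?_
      conv => whnf
      exact ⟨by simp only [Val.size]; omega, by rw [look, if_pos h]; rfl, by omega⟩
    · rw [decide_eq_false fun h' => h (Fin.ext (natVal_injective h'))] at h2
      refine wp_call h2 fun m hm => ?_
      conv => whnf
      refine wp_call (ih fun e he => hπ e (List.mem_cons_of_mem _ he)) fun m' hm' => ?_
      conv => whnf
      exact ⟨by rw [look, if_neg h], by omega⟩

/-! ### Computation of the mean -/

theorem natVal_one : natVal 1 = .cons (.cons .nil .nil) .nil := by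
  rw [natVal_bit true 0 1 rfl one_ne_zero, natVal_zero, bitVal]

theorem natVal_two : natVal 2 = .cons .nil (.cons (.cons .nil .nil) .nil) := by
  rw [natVal_bit false 1 2 rfl two_ne_zero, natVal_one, bitVal]

/-- A bound for the number of steps of each single operation of the algorithm, if all numbers have
at most `L` binary digits and partial assignments have length at most `A`. -/
def unit (L A : ℕ) : ℕ := 1000 * (L + 1) ^ 2 * (A + 1)

theorem le_unit (L A : ℕ) : 1000 * (L + 1) ^ 2 ≤ unit L A := Nat.le_mul_of_pos_right _ (by omega)

theorem thousand_le_unit (L A : ℕ) : 1000 ≤ unit L A :=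
  (Nat.le_mul_of_pos_right _ (by positivity)).trans (le_unit L A)

theorem computes_half (hM : 40 * (L + 1) ≤ M) (hL : 2 ≤ L) {f : ℕ × ℕ} (hf : FB L f) :
    Computes body M .fmul [.cons (.cons (.cons .nil .nil) .nil)
      (.cons .nil (.cons (.cons .nil .nil) .nil)), fracVal f] (fracVal (fmul (1, 2) f))
      (unit L A) := by
  have h : FB 2 (1, 2) := by simp [FB]
  have := (computes_fmul hM (h.mono hL) hf).mono (le_unit L A)
  rwa [show fracVal (1, 2) = _ from congrArg₂ Val.cons natVal_one natVal_two] at this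

theorem computes_look' (hM : 10 ≤ M) {π : List (Fin n × Bool)} (hπ : ABnd L π)
    (hA : π.length ≤ A) {i : Fin n} {o : Option Bool} (ho : look π i = o) :
    Computes body M .look [asgVal π, natVal i] (optVal o) (unit L A) := by
  rw [← ho]
  refine (computes_look hM π hπ i).mono ?_
  have : (L + 1) * (π.length + 1) ≤ (L + 1) ^ 2 * (A + 1) := by gcongr; nlinarith
  rw [unit, mul_assoc, mul_assoc]
  omega

theorem computes_mean (hM : 40 * (L + 1) ≤ M) (hM' : (4 * L + 6) * A + 1 ≤ M) (t : RDT n)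
    (π : List (Fin n × Bool)) (hπ : ABnd L π) (hA : π.length + t.len ≤ A) (hL : 3 * t.len ≤ L) :
    Computes body M .mean [t.val, asgVal π] (fracVal (t.meanFrac π)) (5 * unit L A * t.len) := by
  have hU := thousand_le_unit L A
  induction t generalizing π with
  | leaf v =>
    refine computes_of_wp fun env => ?_
    rw [RDT.val]
    conv => whnf
    refine ⟨rfl, ?_⟩
    have : unit L A * 1 ≤ unit L A * (RDT.leaf v : RDT n).len :=
      Nat.mul_le_mul_left _ (by rw [RDT.len_leaf]; omega)
    rw [mul_assoc]
    omega
  | query i t₀ t₁ ih₀ ih₁ =>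
    have hl := RDT.len_query i t₀ t₁
    have hi := one_le_length_encodeNat i
    have hiL : (i : ℕ) < 2 ^ L :=
      (lt_two_pow_encodeNat i).trans_le (Nat.pow_le_pow_right (by norm_num) (by omega))
    have hlook {o} (ho : look π i = o) := computes_look' (M := M) (A := A) (by omega) hπ (by omega) ho
    have hs (b) := ((hπ.cons hiL b).size_le.trans
      (Nat.add_le_add_right (Nat.mul_le_mul_left _ (show _ ≤ A by simp; omega)) 1)).trans hM'
    simp only [asgVal, Val.size] at hs
    have hs0 := hs false
    have hs1 := hs true
    simp only [bitVal, Val.size] at hs0 hs1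
    have hcost : 5 * unit L A * (RDT.query i t₀ t₁).len ≥
        5 * unit L A * t₀.len + 5 * unit L A * t₁.len + 5 * unit L A := by
      rw [hl]; nlinarith
    refine computes_of_wp fun env => ?_
    rw [RDT.val, RDT.meanFrac]
    conv => whnf
    split
    next ho =>
      refine wp_call (hlook ho) fun m hm => ?_
      conv => whnf
      repeat (refine ⟨by simp only [Val.size]; omega, ?_⟩; conv => whnf)
      refine wp_call (ih₁ ((i, true) :: π) (hπ.cons hiL true) (by simp; omega) (by omega))
        fun m₁ hm₁ => ?_
      conv => whnf
      repeat (refine ⟨by simp only [Val.size]; omega, ?_⟩; conv => whnf)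
      refine wp_call (ih₀ ((i, false) :: π) (hπ.cons hiL false) (by simp; omega) (by omega))
        fun m₀ hm₀ => ?_
      conv => whnf
      have hf₀ := t₀.fb_meanFrac ((i, false) :: π)
      have hf₁ := t₁.fb_meanFrac ((i, true) :: π)
      refine wp_call ((computes_fadd hM (hf₀.mono (by omega)) (hf₁.mono (by omega))).mono
        (le_unit L A)) fun m₂ hm₂ => ?_
      conv => whnf
      repeat (refine ⟨by simp only [Val.size]; omega, ?_⟩; conv => whnf)
      refine wp_call (computes_half (A := A) hM (by omega) ((hf₀.fadd hf₁).mono (by omega)))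
        fun m₃ hm₃ => ?_
      conv => whnf
      exact ⟨rfl, by omega⟩
    next b ho =>
      refine wp_call (hlook ho) fun m hm => ?_
      cases b <;> conv => whnf
      · refine wp_call (ih₀ π hπ (by omega) (by omega)) fun m₁ hm₁ => ?_
        conv => whnf
        exact ⟨rfl, by omega⟩
      · refine wp_call (ih₁ π hπ (by omega) (by omega)) fun m₁ hm₁ => ?_
        conv => whnf
        exact ⟨rfl, by omega⟩
  | coin t₀ t₁ ih₀ ih₁ =>
    have hl := RDT.len_coin t₀ t₁
    have hcost : 5 * unit L A * (RDT.coin t₀ t₁).len =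
        5 * unit L A * t₀.len + 5 * unit L A * t₁.len + 5 * unit L A := by
      rw [hl]; ring
    refine computes_of_wp fun env => ?_
    rw [RDT.val, RDT.meanFrac]
    conv => whnf
    refine wp_call (ih₁ π hπ (by omega) (by omega)) fun m₁ hm₁ => ?_
    conv => whnf
    refine wp_call (ih₀ π hπ (by omega) (by omega)) fun m₀ hm₀ => ?_
    conv => whnf
    have hf₀ := t₀.fb_meanFrac π
    have hf₁ := t₁.fb_meanFrac π
    refine wp_call ((computes_fadd hM (hf₀.mono (by omega)) (hf₁.mono (by omega))).mono
      (le_unit L A)) fun m₂ hm₂ => ?_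
    conv => whnf
    repeat (refine ⟨by simp only [Val.size]; omega, ?_⟩; conv => whnf)
    refine wp_call (computes_half (A := A) hM (by omega) ((hf₀.fadd hf₁).mono (by omega)))
      fun m₃ hm₃ => ?_
    conv => whnf
    exact ⟨rfl, by omega⟩

end

/-! ### Computation of the scores -/

section

variable {M L A n : ℕ}

/-- A pair of fractions as a value. -/
def pairVal (x : (ℕ × ℕ) × (ℕ × ℕ)) : Val := .cons (fracVal x.1) (fracVal x.2)

/-- If `s` and `c` have at most `S` digits, each leaf contributes at most `3 S + 3 |R| + 3` digits per
unit of its length. -/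
theorem RDT.fb_score {S : ℕ} (R : RDT n) {s c : ℕ × ℕ} (hs : FB S s) (hc : FB S c) (t : RDT n)
    (π : List (Fin n × Bool)) :
    FB ((3 * S + 3 * R.len + 3) * t.len) (score R s c t π).1 ∧
      FB ((3 * S + 3 * R.len + 3) * t.len) (score R s c t π).2 := by
  induction t generalizing π with
  | leaf v =>
    have h1 := len_leaf (n := n) v
    have h2 := one_le_length_encodeNat v.num
    have h3 := one_le_length_encodeNat v.den
    have h4 := Nat.mul_le_mul_left S (show 3 ≤ (leaf v : RDT n).len by omega)
    have h5 := Nat.mul_le_mul_left R.len (show 3 ≤ (leaf v : RDT n).len by omega)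
    have hv := v.fb_frac (n := n)
    rw [add_mul, add_mul, mul_assoc, mul_assoc]
    exact ⟨(hv.fmul (hv.fadd (hs.fadd hs))).mono (by omega),
      (hc.fmul (hv.fmul (R.fb_meanFrac π))).mono (by omega)⟩
  | query i t₀ t₁ ih₀ ih₁ =>
    have h := len_query i t₀ t₁
    have h0 : (3 * S + 3 * R.len + 3) * t₀.len + (3 * S + 3 * R.len + 3) * t₁.len + 3 ≤
        (3 * S + 3 * R.len + 3) * (query i t₀ t₁).len := by rw [h]; nlinarith
    rw [score]
    split
    · exact ⟨((ih₀ _).1.favg (ih₁ _).1).mono h0, ((ih₀ _).2.favg (ih₁ _).2).mono h0⟩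
    · split
      exacts [⟨(ih₁ π).1.mono (by omega), (ih₁ π).2.mono (by omega)⟩,
        ⟨(ih₀ π).1.mono (by omega), (ih₀ π).2.mono (by omega)⟩]
  | coin t₀ t₁ ih₀ ih₁ =>
    have h := len_coin t₀ t₁
    have h0 : (3 * S + 3 * R.len + 3) * t₀.len + (3 * S + 3 * R.len + 3) * t₁.len + 3 ≤
        (3 * S + 3 * R.len + 3) * (coin t₀ t₁).len := by rw [h]; nlinarith
    exact ⟨((ih₀ _).1.favg (ih₁ _).1).mono h0, ((ih₀ _).2.favg (ih₁ _).2).mono h0⟩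

set_option maxHeartbeats 1000000 in
theorem computes_score {S : ℕ} (hM : 40 * (L + 1) ≤ M) (hM' : (4 * L + 6) * A + 1 ≤ M)
    (R : RDT n) {s c : ℕ × ℕ} (hs : FB S s) (hc : FB S c) (hR : 3 * R.len ≤ L) (t : RDT n)
    (π : List (Fin n × Bool)) (hπ : ABnd L π) (hA : π.length + t.len + R.len ≤ A)
    (hL : (3 * S + 3 * R.len + 3) * t.len ≤ L) :
    Computes body M .score [t.val, asgVal π, fracVal s, fracVal c, R.val]
      (pairVal (RDT.score R s c t π)) (10 * unit L A * (R.len + 1) * t.len) := by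
  have hU := thousand_le_unit L A
  induction t generalizing π with
  | leaf v =>
    have h1 := RDT.len_leaf (n := n) v
    have h2 := one_le_length_encodeNat v.num
    have h3 := one_le_length_encodeNat v.den
    have h4 := Nat.mul_le_mul_left S (show 3 ≤ (RDT.leaf v : RDT n).len by omega)
    have h5 := Nat.mul_le_mul_left R.len (show 3 ≤ (RDT.leaf v : RDT n).len by omega)
    have hv := v.fb_frac (n := n)
    obtain ⟨hb1, hb2⟩ := RDT.fb_score R hs hc (.leaf v) π
    have hsz1 := (hb1.mono hL).size_le
    have hsz2 := (hb2.mono hL).size_le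
    rw [add_mul, add_mul, mul_assoc, mul_assoc] at hL
    have hcost : 10 * unit L A * (R.len + 1) * (RDT.leaf v : RDT n).len ≥
        10 * unit L A + 5 * unit L A * R.len := by
      calc _ ≤ 10 * unit L A * (R.len + 1) * 1 := by nlinarith
        _ ≤ _ := by gcongr; omega
    have hss := hs.fadd hs
    have hop {f g : ℕ × ℕ} (hf : FB L f) (hg : FB L g) :=
      (computes_fmul hM hf hg).mono (le_unit L A)
    have hop' {f g : ℕ × ℕ} (hf : FB L f) (hg : FB L g) :=
      (computes_fadd hM hf hg).mono (le_unit L A)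
    have hvL : FB L v.frac := hv.mono (by omega)
    refine computes_of_wp fun env => ?_
    rw [RDT.val, RDT.score]
    conv => whnf
    refine wp_call (computes_mean hM hM' R π hπ (by omega) hR) fun m hm => ?_
    conv => whnf
    refine wp_call (hop hvL ((R.fb_meanFrac π).mono hR)) fun m₁ hm₁ => ?_
    conv => whnf
    refine wp_call (hop (hc.mono (by omega)) ((hv.fmul (R.fb_meanFrac π)).mono (by omega)))
      fun m₂ hm₂ => ?_
    conv => whnf
    refine wp_call (hop' (hs.mono (by omega)) (hs.mono (by omega))) fun m₃ hm₃ => ?_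
    conv => whnf
    refine wp_call (hop' hvL (hss.mono (by omega))) fun m₄ hm₄ => ?_
    conv => whnf
    refine wp_call (hop hvL ((hv.fadd hss).mono (by omega))) fun m₅ hm₅ => ?_
    conv => whnf
    rw [RDT.score] at hsz1 hsz2
    refine ⟨?_, rfl, by omega⟩
    refine le_trans (Nat.add_le_add (Nat.add_le_add_left hsz1 1) hsz2) (by omega)
  | query i t₀ t₁ ih₀ ih₁ =>
    have hl := RDT.len_query i t₀ t₁
    have hi := one_le_length_encodeNat i
    have hE : (3 * S + 3 * R.len + 3) * t₀.len + (3 * S + 3 * R.len + 3) * t₁.len +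
        (3 * S + 3 * R.len + 3) * (encodeNat i).length ≤ L := by
      refine le_trans ?_ hL; rw [hl]; nlinarith
    have hE' := Nat.mul_le_mul (show 3 ≤ 3 * S + 3 * R.len + 3 by omega) (le_refl (encodeNat i).length)
    have hiL : (i : ℕ) < 2 ^ L :=
      (lt_two_pow_encodeNat i).trans_le (Nat.pow_le_pow_right (by norm_num) (by omega))
    have hlook {o} (ho : look π i = o) := computes_look' (M := M) (A := A) (by omega) hπ (by omega) ho
    have hs (b) := ((hπ.cons hiL b).size_le.trans
      (Nat.add_le_add_right (Nat.mul_le_mul_left _ (show _ ≤ A by simp; omega)) 1)).trans hM'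
    simp only [asgVal, Val.size] at hs
    have hs0 := hs false
    have hs1 := hs true
    simp only [bitVal, Val.size] at hs0 hs1
    have hcost : 10 * unit L A * (R.len + 1) * (RDT.query i t₀ t₁).len ≥
        10 * unit L A * (R.len + 1) * t₀.len + 10 * unit L A * (R.len + 1) * t₁.len +
          10 * unit L A := by
      rw [hl]
      have := Nat.zero_le (10 * unit L A * R.len)
      nlinarith [Nat.zero_le (10 * unit L A * (R.len + 1) * (encodeNat i).length)]
    refine computes_of_wp fun env => ?_
    rw [RDT.val, RDT.score]
    conv => whnf
    split
    next ho =>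
      refine wp_call (hlook ho) fun m hm => ?_
      conv => whnf
      repeat (refine ⟨by simp only [Val.size]; omega, ?_⟩; conv => whnf)
      refine wp_call (ih₀ ((i, false) :: π) (hπ.cons hiL false) (by simp; omega) (by omega))
        fun m₀ hm₀ => ?_
      conv => whnf
      repeat (refine ⟨by simp only [Val.size]; omega, ?_⟩; conv => whnf)
      refine wp_call (ih₁ ((i, true) :: π) (hπ.cons hiL true) (by simp; omega) (by omega))
        fun m₁ hm₁ => ?_
      conv => whnf
      obtain ⟨hf₀, hg₀⟩ := RDT.fb_score R ‹FB S s› hc t₀ ((i, false) :: π)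
      obtain ⟨hf₁, hg₁⟩ := RDT.fb_score R ‹FB S s› hc t₁ ((i, true) :: π)
      refine wp_call ((computes_fadd hM (hg₀.mono (by omega)) (hg₁.mono (by omega))).mono
        (le_unit L A)) fun m₂ hm₂ => ?_
      conv => whnf
      repeat (refine ⟨by simp only [Val.size]; omega, ?_⟩; conv => whnf)
      refine wp_call (computes_half (A := A) hM (by omega) ((hg₀.fadd hg₁).mono (by omega)))
        fun m₃ hm₃ => ?_
      conv => whnf
      refine wp_call ((computes_fadd hM (hf₀.mono (by omega)) (hf₁.mono (by omega))).mono
        (le_unit L A)) fun m₄ hm₄ => ?_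
      conv => whnf
      repeat (refine ⟨by simp only [Val.size]; omega, ?_⟩; conv => whnf)
      refine wp_call (computes_half (A := A) hM (by omega) ((hf₀.fadd hf₁).mono (by omega)))
        fun m₅ hm₅ => ?_
      conv => whnf
      have hsz1 := ((hf₀.favg hf₁).mono (show _ ≤ L by omega)).size_le
      have hsz2 := ((hg₀.favg hg₁).mono (show _ ≤ L by omega)).size_le
      refine ⟨?_, rfl, by omega⟩
      exact le_trans (Nat.add_le_add (Nat.add_le_add_left hsz1 1) hsz2) (by omega)
    next b ho =>
      refine wp_call (hlook ho) fun m hm => ?_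
      cases b <;> conv => whnf
      · refine wp_call (ih₀ π hπ (by omega) (by omega)) fun m₁ hm₁ => ?_
        conv => whnf
        exact ⟨rfl, by omega⟩
      · refine wp_call (ih₁ π hπ (by omega) (by omega)) fun m₁ hm₁ => ?_
        conv => whnf
        exact ⟨rfl, by omega⟩
  | coin t₀ t₁ ih₀ ih₁ =>
    have hl := RDT.len_coin t₀ t₁
    have hE : (3 * S + 3 * R.len + 3) * t₀.len + (3 * S + 3 * R.len + 3) * t₁.len + 3 ≤ L := by
      refine le_trans ?_ hL; rw [hl]; nlinarith
    have hcost : 10 * unit L A * (R.len + 1) * (RDT.coin t₀ t₁).len ≥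
        10 * unit L A * (R.len + 1) * t₀.len + 10 * unit L A * (R.len + 1) * t₁.len +
          10 * unit L A := by
      rw [hl]
      nlinarith [Nat.zero_le (10 * unit L A * R.len)]
    refine computes_of_wp fun env => ?_
    rw [RDT.val, RDT.score]
    conv => whnf
    refine wp_call (ih₀ π hπ (by omega) (by omega)) fun m₀ hm₀ => ?_
    conv => whnf
    refine wp_call (ih₁ π hπ (by omega) (by omega)) fun m₁ hm₁ => ?_
    conv => whnf
    obtain ⟨hf₀, hg₀⟩ := RDT.fb_score R hs hc t₀ π
    obtain ⟨hf₁, hg₁⟩ := RDT.fb_score R hs hc t₁ π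
    refine wp_call ((computes_fadd hM (hg₀.mono (by omega)) (hg₁.mono (by omega))).mono
      (le_unit L A)) fun m₂ hm₂ => ?_
    conv => whnf
    repeat (refine ⟨by simp only [Val.size]; omega, ?_⟩; conv => whnf)
    refine wp_call (computes_half (A := A) hM (by omega) ((hg₀.fadd hg₁).mono (by omega)))
      fun m₃ hm₃ => ?_
    conv => whnf
    refine wp_call ((computes_fadd hM (hf₀.mono (by omega)) (hf₁.mono (by omega))).mono
      (le_unit L A)) fun m₄ hm₄ => ?_
    conv => whnf
    repeat (refine ⟨by simp only [Val.size]; omega, ?_⟩; conv => whnf)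
    refine wp_call (computes_half (A := A) hM (by omega) ((hf₀.fadd hf₁).mono (by omega)))
      fun m₅ hm₅ => ?_
    conv => whnf
    have hsz1 := ((hf₀.favg hf₁).mono (show _ ≤ L by omega)).size_le
    have hsz2 := ((hg₀.favg hg₁).mono (show _ ≤ L by omega)).size_le
    refine ⟨?_, rfl, by omega⟩
    exact le_trans (Nat.add_le_add (Nat.add_le_add_left hsz1 1) hsz2) (by omega)

end

/-! ### Computation of the output tree -/

section

variable {M L A n : ℕ}

/-- The cost recursion of `RDT.walk` where one subtree of length `x` is entered: `V * l` pays for the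
node and for the scores of its subtrees, `W` is the cost of what follows a leaf, and `q`, `q'` are query
complexities. -/
theorem walk_cost_step {V W q q' x l : ℕ} (hx : x + 1 ≤ l) (hq : q' ≤ q) :
    V * l + 2 ^ q' * (V * x ^ 2 + W) ≤ 2 ^ q * (V * l ^ 2 + W) := by
  have h1 : 2 ^ q' ≤ 2 ^ q := Nat.pow_le_pow_right (by norm_num) hq
  have h2 : 1 ≤ 2 ^ q := Nat.one_le_two_pow
  have h3 : l + x ^ 2 ≤ l ^ 2 := by nlinarith
  calc V * l + 2 ^ q' * (V * x ^ 2 + W) ≤ 2 ^ q * (V * l) + 2 ^ q * (V * x ^ 2 + W) := by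
        refine Nat.add_le_add ?_ (by gcongr)
        exact Nat.le_mul_of_pos_left (V * l) h2
    _ = 2 ^ q * (V * (l + x ^ 2) + W) := by ring
    _ ≤ _ := by gcongr

/-- The cost recursion of `RDT.walk` where both subtrees are entered. -/
theorem walk_cost_query {V W q₀ q₁ x₀ x₁ l : ℕ} (h₀ : x₀ + 1 ≤ l) (h₁ : x₁ + 1 ≤ l) :
    V * l + (2 ^ q₀ * (V * x₀ ^ 2 + W) + 2 ^ q₁ * (V * x₁ ^ 2 + W)) ≤
      2 ^ (max q₀ q₁ + 1) * (V * l ^ 2 + W) := by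
  have a := walk_cost_step (V := V) (W := W) h₀ (le_max_left q₀ q₁)
  have b := walk_cost_step (V := V) (W := W) h₁ (le_max_right q₀ q₁)
  have : 2 ^ (max q₀ q₁ + 1) * (V * l ^ 2 + W) = 2 * (2 ^ max q₀ q₁ * (V * l ^ 2 + W)) := by ring
  omega

/-- One copy of `R`. Here `S` bounds the digits of `s` and `c` during this copy, `S'` those at its end,
and `A'` bounds the length of the partial assignment at its end. -/
theorem computes_walk {S S' A' j W : ℕ} (hM : 40 * (L + 1) ≤ M) (hM' : (4 * L + 6) * A + 1 ≤ M)
    (R : RDT n) (gen : List (Fin n × Bool) → ℕ × ℕ → ℕ × ℕ → RDT n)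
    (hA' : A' + R.len ≤ A) (hS' : S + R.len + 3 ≤ S')
    (hL : 2 * ((3 * S + 3 * R.len + 3) * R.len) + 1 ≤ L)
    (hgen : ∀ π s c, ABnd L π → π.length ≤ A' → FB S' s → FB S' c → (gen π s c).val.size ≤ M →
      Computes body M .gen [.unary j, asgVal π, fracVal s, fracVal c, R.val] (gen π s c).val W)
    (t : RDT n) (ht : t.len ≤ R.len) (π : List (Fin n × Bool)) (hπ : ABnd L π)
    (hA : π.length + t.len ≤ A') {s c : ℕ × ℕ} (hs : FB S s) (hc : FB S c)
    (hsize : (RDT.walk R gen t π s c).val.size ≤ M) :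
    Computes body M .walk [t.val, .unary j, asgVal π, fracVal s, fracVal c, R.val]
      (RDT.walk R gen t π s c).val
      (2 ^ t.queryComplexity * (10 * unit L A * (R.len + 1) * t.len ^ 2 + W)) := by
  have hU := thousand_le_unit L A
  have hcost {l : ℕ} (hl : 1 ≤ l) : 10 * unit L A ≤ 10 * unit L A * (R.len + 1) * l := by
    rw [mul_assoc]
    exact Nat.le_mul_of_pos_right _ (by positivity)
  have hSL : S ≤ L ∨ R.len = 0 := by
    rcases Nat.eq_zero_or_pos R.len with h | h
    · exact .inr h
    · left; nlinarith
  have hRL : 3 * R.len ≤ L := by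
    have h3 := Nat.mul_le_mul_right R.len (show 3 ≤ 3 * S + 3 * R.len + 3 by omega)
    omega
  induction t generalizing π with
  | leaf v =>
    have h1 := RDT.len_leaf (n := n) v
    have h2 := one_le_length_encodeNat v.num
    have h3 := one_le_length_encodeNat v.den
    have hv := v.fb_frac (n := n)
    have h21 : FB 2 (2, 1) := by simp [FB]
    rw [RDT.walk] at hsize
    refine computes_of_wp fun env => ?_
    rw [RDT.val, RDT.walk]
    conv => whnf
    repeat (refine ⟨by (try simp only [Val.size]); omega, ?_⟩; conv => whnf)
    have hadd := (computes_fadd hM (hc.mono (by omega)) (h21.mono (by omega))).mono (le_unit L A)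
    rw [show fracVal (2, 1) = _ from congrArg₂ Val.cons natVal_two natVal_one] at hadd
    refine wp_call hadd fun m hm => ?_
    conv => whnf
    refine wp_call ((computes_fadd hM (hs.mono (by omega)) (hv.mono (by omega))).mono (le_unit L A))
      fun m₁ hm₁ => ?_
    conv => whnf
    refine wp_call (hgen π _ _ hπ (by omega) ((hs.fadd hv).mono (by omega))
      ((hc.fadd h21).mono (by omega)) hsize) fun m₂ hm₂ => ?_
    conv => whnf
    refine ⟨rfl, ?_⟩
    have := walk_cost_step (V := 10 * unit L A * (R.len + 1)) (W := W) (q := 0) (q' := 0) (x := 0)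
      (l := (RDT.leaf v : RDT n).len) (by omega) le_rfl
    have := hcost (l := (RDT.leaf v : RDT n).len) (by omega)
    simp only [RDT.queryComplexity, pow_zero, one_mul] at *
    omega
  | query i t₀ t₁ ih₀ ih₁ =>
    have hl := RDT.len_query i t₀ t₁
    have hi := one_le_length_encodeNat i
    have hiL : (i : ℕ) < 2 ^ L :=
      (lt_two_pow_encodeNat i).trans_le (Nat.pow_le_pow_right (by norm_num) (by omega))
    have hlook {o} (ho : look π i = o) := computes_look' (M := M) (A := A) (by omega) hπ (by omega) ho
    have hsz (b) := ((hπ.cons hiL b).size_le.trans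
      (Nat.add_le_add_right (Nat.mul_le_mul_left _ (show _ ≤ A by simp; omega)) 1)).trans hM'
    simp only [asgVal, Val.size] at hsz
    have hs0 := hsz false
    have hs1 := hsz true
    simp only [bitVal, Val.size] at hs0 hs1
    have hc1 := hcost (l := (RDT.query i t₀ t₁).len) (by omega)
    rw [RDT.walk] at hsize
    refine computes_of_wp fun env => ?_
    rw [RDT.val, RDT.walk]
    conv => whnf
    split
    next ho =>
      have hq := walk_cost_query (V := 10 * unit L A * (R.len + 1)) (W := W)
        (q₀ := t₀.queryComplexity) (q₁ := t₁.queryComplexity) (x₀ := t₀.len) (x₁ := t₁.len)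
        (l := (RDT.query i t₀ t₁).len) (by omega) (by omega)
      rw [ho] at hsize
      simp only [RDT.val, Val.size] at hsize
      refine wp_call (hlook ho) fun m hm => ?_
      conv => whnf
      repeat (refine ⟨by (try simp only [Val.size]); omega, ?_⟩; conv => whnf)
      refine wp_call (ih₁ (by omega) ((i, true) :: π) (hπ.cons hiL true) (by simp; omega)
        (by omega)) fun m₁ hm₁ => ?_
      conv => whnf
      repeat (refine ⟨by (try simp only [Val.size]); omega, ?_⟩; conv => whnf)
      refine wp_call (ih₀ (by omega) ((i, false) :: π) (hπ.cons hiL false) (by simp; omega)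
        (by omega)) fun m₀ hm₀ => ?_
      conv => whnf
      repeat (refine ⟨by (try simp only [Val.size]); omega, ?_⟩; conv => whnf)
      refine ⟨rfl, ?_⟩
      rw [← RDT.queryComplexity.eq_2 i] at hq
      generalize 2 ^ t₀.queryComplexity *
        (10 * unit L A * (R.len + 1) * t₀.len ^ 2 + W) = x₀ at hm₀ hq
      generalize 2 ^ t₁.queryComplexity *
        (10 * unit L A * (R.len + 1) * t₁.len ^ 2 + W) = x₁ at hm₁ hq
      generalize 2 ^ (RDT.query i t₀ t₁).queryComplexity *
        (10 * unit L A * (R.len + 1) * (RDT.query i t₀ t₁).len ^ 2 + W) = y at hq ⊢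
      generalize 10 * unit L A * (R.len + 1) = V at *
      clear * - hU hm hm₀ hm₁ hq hc1
      generalize (RDT.query i t₀ t₁).len = l at *
      generalize unit L A = U at *
      simp only [Nat.reduceAdd, Nat.reduceSub]
      omega
    next b ho =>
      rw [ho] at hsize
      refine wp_call (hlook ho) fun m hm => ?_
      cases b <;> conv => whnf
      · have hq := walk_cost_step (V := 10 * unit L A * (R.len + 1)) (W := W)
          (q := (RDT.query i t₀ t₁).queryComplexity) (q' := t₀.queryComplexity) (x := t₀.len)
          (l := (RDT.query i t₀ t₁).len) (by omega) (by rw [RDT.queryComplexity]; omega)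
        refine wp_call (ih₀ (by omega) π hπ (by omega) hsize) fun m₁ hm₁ => ?_
        conv => whnf
        refine ⟨rfl, ?_⟩
        generalize 2 ^ t₀.queryComplexity *
          (10 * unit L A * (R.len + 1) * t₀.len ^ 2 + W) = x at hm₁ hq
        generalize 2 ^ (RDT.query i t₀ t₁).queryComplexity *
          (10 * unit L A * (R.len + 1) * (RDT.query i t₀ t₁).len ^ 2 + W) = y at hq ⊢
        generalize 10 * unit L A * (R.len + 1) = V at *
        clear * - hU hm hm₁ hq hc1
        generalize (RDT.query i t₀ t₁).len = l at *
        generalize unit L A = U at *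
        simp only [Nat.reduceAdd, Nat.reduceSub]
        omega
      · have hq := walk_cost_step (V := 10 * unit L A * (R.len + 1)) (W := W)
          (q := (RDT.query i t₀ t₁).queryComplexity) (q' := t₁.queryComplexity) (x := t₁.len)
          (l := (RDT.query i t₀ t₁).len) (by omega) (by rw [RDT.queryComplexity]; omega)
        refine wp_call (ih₁ (by omega) π hπ (by omega) hsize) fun m₁ hm₁ => ?_
        conv => whnf
        refine ⟨rfl, ?_⟩
        generalize 2 ^ t₁.queryComplexity *
          (10 * unit L A * (R.len + 1) * t₁.len ^ 2 + W) = x at hm₁ hq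
        generalize 2 ^ (RDT.query i t₀ t₁).queryComplexity *
          (10 * unit L A * (R.len + 1) * (RDT.query i t₀ t₁).len ^ 2 + W) = y at hq ⊢
        generalize 10 * unit L A * (R.len + 1) = V at *
        clear * - hU hm hm₁ hq hc1
        generalize (RDT.query i t₀ t₁).len = l at *
        generalize unit L A = U at *
        simp only [Nat.reduceAdd, Nat.reduceSub]
        omega
  | coin t₀ t₁ ih₀ ih₁ =>
    have hl := RDT.len_coin t₀ t₁
    have hc1 := hcost le_rfl
    have hE {x : ℕ} (hx : x ≤ R.len) : 2 * ((3 * S + 3 * R.len + 3) * x) + 1 ≤ L :=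
      le_trans (by gcongr) hL
    have hE0 := hE (x := t₀.len) (by omega)
    have hE1 := hE (x := t₁.len) (by omega)
    have hmul : 10 * unit L A * (R.len + 1) * (RDT.coin t₀ t₁).len =
        10 * unit L A * (R.len + 1) * t₀.len + 10 * unit L A * (R.len + 1) * t₁.len +
          10 * unit L A * (R.len + 1) * 1 := by rw [hl]; ring
    have hsc (t : RDT n) (ht : t.len < (RDT.coin t₀ t₁).len) := computes_score hM hM' R hs hc hRL t π
      hπ (by omega) (by have := hE (x := t.len) (by omega); omega)
    rw [RDT.walk] at hsize
    refine computes_of_wp fun env => ?_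
    rw [RDT.val, RDT.walk]
    conv => whnf
    refine wp_call (hsc t₀ (by omega)) fun m₀ hm₀ => ?_
    conv => whnf
    refine wp_call (hsc t₁ (by omega)) fun m₁ hm₁ => ?_
    conv => whnf
    obtain ⟨hf₀, hg₀⟩ := RDT.fb_score R hs hc t₀ π
    obtain ⟨hf₁, hg₁⟩ := RDT.fb_score R hs hc t₁ π
    have hEE : (3 * S + 3 * R.len + 3) * t₀.len + (3 * S + 3 * R.len + 3) * t₁.len + 1 ≤ L := by
      omega
    refine wp_call ((computes_fadd hM (hf₁.mono (by omega)) (hg₀.mono (by omega))).mono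
      (le_unit L A)) fun m₂ hm₂ => ?_
    conv => whnf
    refine wp_call ((computes_fadd hM (hf₀.mono (by omega)) (hg₁.mono (by omega))).mono
      (le_unit L A)) fun m₃ hm₃ => ?_
    conv => whnf
    have hle := (computes_fle hM ((hf₀.fadd hg₁).mono (show _ ≤ L by omega))
      ((hf₁.fadd hg₀).mono (show _ ≤ L by omega))).mono (le_unit L A)
    -- which subtree is entered
    have hpref : fle (fadd (RDT.score R s c t₀ π).1 (RDT.score R s c t₁ π).2)
      (fadd (RDT.score R s c t₁ π).1 (RDT.score R s c t₀ π).2) =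
        RDT.prefersLeft (RDT.score R s c t₀ π) (RDT.score R s c t₁ π) := rfl
    rw [hpref] at hle
    split
    next ho =>
      rw [ho] at hle hsize
      have hq := walk_cost_step (V := 10 * unit L A * (R.len + 1)) (W := W)
        (q := (RDT.coin t₀ t₁).queryComplexity) (q' := t₀.queryComplexity) (x := t₀.len)
        (l := (RDT.coin t₀ t₁).len) (by omega) (by rw [RDT.queryComplexity]; omega)
      refine wp_call hle fun m₄ hm₄ => ?_
      conv => whnf
      refine wp_call (ih₀ (by omega) π hπ (by omega) hsize) fun m₅ hm₅ => ?_
      conv => whnf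
      refine ⟨rfl, ?_⟩
      generalize 2 ^ t₀.queryComplexity *
        (10 * unit L A * (R.len + 1) * t₀.len ^ 2 + W) = x at hm₅ hq
      generalize 2 ^ (RDT.coin t₀ t₁).queryComplexity *
        (10 * unit L A * (R.len + 1) * (RDT.coin t₀ t₁).len ^ 2 + W) = y at hq ⊢
      generalize 10 * unit L A * (R.len + 1) = V at *
      clear * - hU hm₀ hm₁ hm₂ hm₃ hm₄ hm₅ hmul hq hc1
      generalize (RDT.coin t₀ t₁).len = l at *
      generalize unit L A = U at *
      simp only [Nat.reduceAdd, Nat.reduceSub]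
      omega
    next ho =>
      rw [Bool.eq_false_of_not_eq_true ho] at hle hsize
      have hq := walk_cost_step (V := 10 * unit L A * (R.len + 1)) (W := W)
        (q := (RDT.coin t₀ t₁).queryComplexity) (q' := t₁.queryComplexity) (x := t₁.len)
        (l := (RDT.coin t₀ t₁).len) (by omega) (by rw [RDT.queryComplexity]; omega)
      refine wp_call hle fun m₄ hm₄ => ?_
      conv => whnf
      refine wp_call (ih₁ (by omega) π hπ (by omega) hsize) fun m₅ hm₅ => ?_
      conv => whnf
      refine ⟨rfl, ?_⟩
      generalize 2 ^ t₁.queryComplexity *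
        (10 * unit L A * (R.len + 1) * t₁.len ^ 2 + W) = x at hm₅ hq
      generalize 2 ^ (RDT.coin t₀ t₁).queryComplexity *
        (10 * unit L A * (R.len + 1) * (RDT.coin t₀ t₁).len ^ 2 + W) = y at hq ⊢
      generalize 10 * unit L A * (R.len + 1) = V at *
      clear * - hU hm₀ hm₁ hm₂ hm₃ hm₄ hm₅ hmul hq hc1
      generalize (RDT.coin t₀ t₁).len = l at *
      generalize unit L A = U at *
      simp only [Nat.reduceAdd, Nat.reduceSub]
      omega

theorem RDT.one_le_len (t : RDT n) : 1 ≤ t.len := by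
  cases t <;> rw [len, encode, List.length_cons] <;> omega

/-- All remaining copies of `R`. Each of them adds at most `|R| + 3` digits to `s` and `c` and at most
`|R|` entries to the partial assignment. -/
theorem computes_build (hM : 40 * (L + 1) ≤ M) (hM' : (4 * L + 6) * A + 1 ≤ M) (R : RDT n)
    (j S : ℕ) (hL : 2 * ((3 * (S + j * (R.len + 3)) + 3 * R.len + 3) * R.len) + 1 ≤ L)
    (π : List (Fin n × Bool)) (hπ : ABnd L π) (hA : π.length + (j + 1) * R.len ≤ A) {s c : ℕ × ℕ}
    (hs : FB S s) (hc : FB S c) (hsize : (R.build j π s c).val.size ≤ M) :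
    Computes body M .gen [.unary j, asgVal π, fracVal s, fracVal c, R.val] (R.build j π s c).val
      (2 ^ (j * R.queryComplexity) * (10 * unit L A * (R.len + 1) * ((R.len ^ 2 + 1) * (j + 1)))) := by
  have hU := thousand_le_unit L A
  have h1 := R.one_le_len
  have hRL : 3 * R.len ≤ L := by
    have h3 := Nat.mul_le_mul_right R.len (show 3 ≤ 3 * (S + j * (R.len + 3)) + 3 * R.len + 3 by omega)
    omega
  induction j generalizing S π s c with
  | zero =>
    have hsz := ((R.fb_meanFrac π).mono hRL).size_le
    refine computes_of_wp fun env => ?_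
    rw [Val.unary, RDT.build, RDT.val]
    conv => whnf
    refine wp_call (computes_mean hM hM' R π hπ (by omega) hRL) fun m hm => ?_
    conv => whnf
    refine ⟨by simp only [Val.size]; omega, rfl, ?_⟩
    have : 5 * unit L A * R.len + 1000 ≤
        2 ^ (0 * R.queryComplexity) * (10 * unit L A * (R.len + 1) * ((R.len ^ 2 + 1) * (0 + 1))) := by
      simp only [zero_mul, pow_zero, one_mul, zero_add, mul_one]
      calc 5 * unit L A * R.len + 1000 ≤ 10 * unit L A * (R.len + 1) * 1 := by nlinarith
        _ ≤ _ := by gcongr; omega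
    omega
  | succ j ih =>
    have hA1 : π.length + R.len + (j + 1) * R.len ≤ A := by
      refine le_trans (le_of_eq ?_) hA; ring
    have hA2 : R.len ≤ (j + 1) * R.len := Nat.le_mul_of_pos_left _ (by omega)
    have hLS : 2 * ((3 * S + 3 * R.len + 3) * R.len) + 1 ≤ L :=
      le_trans (by gcongr; omega) hL
    have hw := computes_walk (S := S) (S' := S + R.len + 3) (A' := π.length + R.len) (j := j) hM hM' R
      (R.build j) (by omega) le_rfl hLS
      (fun π' s' c' hπ' hA' hs' hc' hsz' => ih (S + R.len + 3)
        (le_trans (le_of_eq (by ring)) hL) π' hπ' (by omega) hs' hc' hsz')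
      R le_rfl π hπ le_rfl hs hc hsize
    refine computes_of_wp fun env => ?_
    rw [Val.unary]
    conv => whnf
    refine wp_call hw fun m hm => ?_
    conv => whnf
    refine ⟨rfl, ?_⟩
    rw [show (j + 1) * R.queryComplexity = R.queryComplexity + j * R.queryComplexity by ring, pow_add]
    have hV : 1000 ≤ 10 * unit L A * (R.len + 1) := by nlinarith
    generalize 10 * unit L A * (R.len + 1) = V at hm hV ⊢
    have h2 : 1 ≤ 2 ^ R.queryComplexity := Nat.one_le_two_pow
    have h3 : 1 ≤ 2 ^ (j * R.queryComplexity) := Nat.one_le_two_pow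
    generalize 2 ^ R.queryComplexity = a at hm h2 ⊢
    generalize 2 ^ (j * R.queryComplexity) = b at hm h3 ⊢
    have h4 : a * (V * R.len ^ 2 + b * (V * ((R.len ^ 2 + 1) * (j + 1)))) + V ≤
        a * b * (V * ((R.len ^ 2 + 1) * (j + 1 + 1))) := by
      have h5 : a * (V * R.len ^ 2) * 1 ≤ a * (V * R.len ^ 2) * b := by gcongr
      have h6 : V * 1 ≤ V * (a * b) := by gcongr; exact Nat.mul_pos h2 h3
      calc _ = a * (V * R.len ^ 2) * 1 + a * b * (V * ((R.len ^ 2 + 1) * (j + 1))) + V * 1 := by ring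
        _ ≤ a * (V * R.len ^ 2) * b + a * b * (V * ((R.len ^ 2 + 1) * (j + 1))) + V * (a * b) := by
          omega
        _ = _ := by ring
    omega

end

section

variable {M L A n : ℕ}

/-! ### Size of the output -/

/-- A decision node of the output adds at most `4 L + 10` to the size of its two subtrees, so that
`size + (4 L + 10)` at most doubles. -/
theorem RDT.size_walk_le {X : ℕ} (R : RDT n)
    (gen : List (Fin n × Bool) → ℕ × ℕ → ℕ × ℕ → RDT n)
    (hgen : ∀ π s c, (gen π s c).val.size + (4 * L + 10) ≤ X) (t : RDT n) (ht : t.len ≤ L)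
    (π : List (Fin n × Bool)) (s c : ℕ × ℕ) :
    (walk R gen t π s c).val.size + (4 * L + 10) ≤ 2 ^ t.queryComplexity * X := by
  have hmono {q q' : ℕ} (h : q ≤ q') : 2 ^ q * X ≤ 2 ^ q' * X := by
    gcongr
    norm_num
  induction t generalizing π with
  | leaf v => simpa [walk, queryComplexity] using hgen _ _ _
  | query i t₀ t₁ ih₀ ih₁ =>
    have hl := len_query i t₀ t₁
    have hi : (natVal i).size ≤ 4 * L + 1 := size_natVal
      ((lt_two_pow_encodeNat i).trans_le (Nat.pow_le_pow_right (by norm_num) (by omega)))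
    have h₀ : 2 ^ t₀.queryComplexity * X ≤ 2 ^ max t₀.queryComplexity t₁.queryComplexity * X :=
      hmono (le_max_left _ _)
    have h₁ : 2 ^ t₁.queryComplexity * X ≤ 2 ^ max t₀.queryComplexity t₁.queryComplexity * X :=
      hmono (le_max_right _ _)
    rw [walk, queryComplexity, pow_succ, mul_right_comm]
    split
    · have a := ih₀ (by omega) ((i, false) :: π)
      have b := ih₁ (by omega) ((i, true) :: π)
      simp only [val, Val.size]
      omega
    · split
      · have := ih₁ (by omega) π
        omega
      · have := ih₀ (by omega) π
        omega
  | coin t₀ t₁ ih₀ ih₁ =>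
    have hl := len_coin t₀ t₁
    rw [walk, queryComplexity]
    split
    · exact (ih₀ (by omega) π).trans (hmono (le_max_left _ _))
    · exact (ih₁ (by omega) π).trans (hmono (le_max_right _ _))

theorem RDT.size_build_le (R : RDT n) (hL : 3 * R.len ≤ L) (j : ℕ) (π : List (Fin n × Bool))
    (s c : ℕ × ℕ) :
    (R.build j π s c).val.size + (4 * L + 10) ≤ 2 ^ (j * R.queryComplexity) * (12 * L + 15) := by
  induction j generalizing π s c with
  | zero =>
    have := ((R.fb_meanFrac π).mono hL).size_le
    simp only [build, val, Val.size, UnitFrac.frac, Prod.mk.eta, zero_mul, pow_zero, one_mul]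
    omega
  | succ j ih =>
    have := R.size_walk_le (L := L) (build R j) ih R (by omega) π s c
    rwa [← mul_assoc, ← pow_add, show R.queryComplexity + j * R.queryComplexity =
      (j + 1) * R.queryComplexity by ring] at this

theorem size_natVal_bits (k : ℕ) : (natVal k).size + 3 ≤ 4 * (encodeNat k).length := by
  have := size_natVal (lt_two_pow_length_bits k)
  simp only [encodeNat, List.length_append, List.length_map, List.length_singleton]
  omega

theorem length_encodeNat_le (k : ℕ) : (encodeNat k).length ≤ (natVal k).size := by
  have : ∀ l : List Bool, l.length + 1 ≤ (Val.ofList (l.map bitVal)).size := by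
    intro l
    induction l with
    | nil => simp [Val.ofList, Val.size]
    | cons b l ih => simp only [List.map_cons, Val.ofList, Val.size, List.length_cons]; omega
  simpa [encodeNat, natVal] using this k.bits

theorem RDT.len_le_size_val (t : RDT n) : t.len ≤ t.val.size := by
  induction t with
  | leaf v =>
    have := length_encodeNat_le v.num
    have := length_encodeNat_le v.den
    simp only [len_leaf, val, fracVal, UnitFrac.frac, Val.size]
    omega
  | query i t₀ t₁ ih₀ ih₁ =>
    have := length_encodeNat_le i
    simp only [len_query, val, Val.size]
    omega
  | coin t₀ t₁ ih₀ ih₁ =>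
    simp only [len_coin, val, Val.size]
    omega

theorem RDT.size_val_le (t : RDT n) : t.val.size ≤ 12 * t.len := by
  induction t with
  | leaf v =>
    have := size_natVal_bits v.num
    have := size_natVal_bits v.den
    simp only [len_leaf, val, fracVal, UnitFrac.frac, Val.size]
    omega
  | query i t₀ t₁ ih₀ ih₁ =>
    have := size_natVal_bits i
    simp only [len_query, val, Val.size]
    omega
  | coin t₀ t₁ ih₀ ih₁ =>
    simp only [len_coin, val, Val.size]
    omega

/-! ### Reading and printing trees -/

theorem tokens_bit (b : Bool) (w : List Symb) :
    tokens (.bit b :: w) = .cons (bitVal b) (tokens w) := by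
  rw [tokens_cons]
  cases b <;> rfl

theorem tokens_sep (w : List Symb) :
    tokens (.sep :: w) = .cons (.cons .nil (.cons .nil .nil)) (tokens w) := tokens_cons _ _

theorem tokens_leafMark (w : List Symb) :
    tokens (.leafMark :: w) = .cons (.cons .nil (.cons .nil (.cons .nil .nil))) (tokens w) :=
  tokens_cons _ _

theorem tokens_queryMark (w : List Symb) :
    tokens (.queryMark :: w) =
      .cons (.cons .nil (.cons .nil (.cons .nil (.cons .nil .nil)))) (tokens w) :=
  tokens_cons _ _

theorem tokens_coinMark (w : List Symb) :
    tokens (.coinMark :: w) =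
      .cons (.cons .nil (.cons .nil (.cons .nil (.cons .nil (.cons .nil .nil))))) (tokens w) :=
  tokens_cons _ _

theorem RDT.encode_leaf_append (v : UnitFrac) (w : List Symb) :
    (leaf v : RDT n).encode ++ w = .leafMark :: (encodeNat v.num ++ (encodeNat v.den ++ w)) := by
  simp [encode]

theorem RDT.encode_query_append (i : Fin n) (t₀ t₁ : RDT n) (w : List Symb) :
    (query i t₀ t₁).encode ++ w =
      .queryMark :: (encodeNat i ++ (t₀.encode ++ (t₁.encode ++ w))) := by
  simp [encode]

theorem RDT.encode_coin_append (t₀ t₁ : RDT n) (w : List Symb) :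
    (coin t₀ t₁).encode ++ w = .coinMark :: (t₀.encode ++ (t₁.encode ++ w)) := by
  simp [encode]

theorem computes_app_natVal (k : ℕ) (w : List Symb)
    (hM : 12 * ((encodeNat k).length + w.length) + 1 ≤ M) :
    Computes body M .app [natVal k, .cons (.cons .nil (.cons .nil .nil)) (tokens w)]
      (tokens (encodeNat k ++ w)) (20 * (encodeNat k).length) := by
  have h : tokens (encodeNat k ++ w) = Val.ofList (k.bits.map bitVal ++
      (Symb.sep :: w).map fun s => Val.unary s.code) := by
    rw [tokens, encodeNat, List.append_assoc, List.map_append, List.map_map]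
    congr 3
    funext b
    cases b <;> rfl
  have := size_tokens_le (encodeNat k ++ w)
  rw [List.length_append] at this
  rw [h, ← tokens_sep, natVal, tokens]
  refine (computes_app _ _ (by rw [← h]; omega)).mono ?_
  simp [encodeNat]

theorem computes_print (t : RDT n) (ht : t.IsDeterministic) (w : List Symb)
    (hM : 12 * (t.len + w.length) + 1 ≤ M) :
    Computes body M .print [t.val, tokens w] (tokens (t.encode ++ w)) (100 * t.len) := by
  induction t generalizing w with
  | leaf v =>
    have hl := RDT.len_leaf (n := n) v
    have h1 := computes_app_natVal (M := M) v.den w (by omega)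
    have h2 := computes_app_natVal (M := M) v.num (encodeNat v.den ++ w)
      (by rw [List.length_append]; omega)
    have h3 := size_tokens_le w
    have h4 := size_tokens_le (encodeNat v.den ++ w)
    have h5 := size_tokens_le (encodeNat v.num ++ (encodeNat v.den ++ w))
    simp only [List.length_append] at h4 h5
    have h6 := one_le_length_encodeNat v.num
    refine computes_of_wp fun env => ?_
    rw [RDT.val, RDT.encode_leaf_append, tokens_leafMark, fracVal]
    conv => whnf
    repeat (refine ⟨by (try simp only [Val.size]); omega, ?_⟩; conv => whnf)
    refine wp_call h1 fun m₁ hm₁ => ?_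
    conv => whnf
    repeat (refine ⟨by (try simp only [Val.size]); omega, ?_⟩; conv => whnf)
    refine wp_call h2 fun m₂ hm₂ => ?_
    conv => whnf
    repeat (refine ⟨by (try simp only [Val.size]); omega, ?_⟩; conv => whnf)
    refine ⟨rfl, ?_⟩
    simp only [Nat.reduceAdd, Nat.reduceSub]
    omega
  | query i t₀ t₁ ih₀ ih₁ =>
    have hl := RDT.len_query i t₀ t₁
    have e₀ : t₀.encode.length = t₀.len := rfl
    have e₁ : t₁.encode.length = t₁.len := rfl
    have h1 := computes_app_natVal (M := M) i (t₀.encode ++ (t₁.encode ++ w))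
      (by simp only [List.length_append]; omega)
    have h3 := size_tokens_le w
    have h4 := size_tokens_le (t₀.encode ++ (t₁.encode ++ w))
    have h5 := size_tokens_le (encodeNat i ++ (t₀.encode ++ (t₁.encode ++ w)))
    simp only [List.length_append] at h4 h5
    refine computes_of_wp fun env => ?_
    rw [RDT.val, RDT.encode_query_append, tokens_queryMark]
    conv => whnf
    refine wp_call (ih₁ ht.2 w (by omega)) fun m₁ hm₁ => ?_
    conv => whnf
    refine wp_call (ih₀ ht.1 _ (by rw [List.length_append]; omega)) fun m₂ hm₂ => ?_
    conv => whnf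
    repeat (refine ⟨by (try simp only [Val.size]); omega, ?_⟩; conv => whnf)
    refine wp_call h1 fun m₃ hm₃ => ?_
    conv => whnf
    repeat (refine ⟨by (try simp only [Val.size]); omega, ?_⟩; conv => whnf)
    refine ⟨rfl, ?_⟩
    simp only [Nat.reduceAdd, Nat.reduceSub]
    omega
  | coin t₀ t₁ => exact ht.elim

theorem computes_parseNat (k : ℕ) (w : List Symb)
    (hM : 12 * ((encodeNat k).length + w.length) + 1 ≤ M) :
    Computes body M .parseNat [tokens (encodeNat k ++ w)] (.cons (natVal k) (tokens w))
      (50 * (encodeNat k).length) := by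
  have hw := size_tokens_le w
  have key : ∀ l : List Bool, 12 * (l.length + 1 + w.length) + 1 ≤ M →
      (Val.ofList (l.map bitVal)).size ≤ 4 * l.length + 1 ∧
      Computes body M .parseNat [tokens (l.map Symb.bit ++ Symb.sep :: w)]
        (.cons (Val.ofList (l.map bitVal)) (tokens w)) (50 * (l.length + 1)) := by
    intro l
    induction l with
    | nil =>
      refine fun hM => ⟨by simp [Val.ofList, Val.size], computes_of_wp fun env => ?_⟩
      rw [List.map_nil, List.nil_append, tokens_sep, List.map_nil, Val.ofList]
      conv => whnf
      repeat (refine ⟨by (try simp only [Val.size]); omega, ?_⟩; conv => whnf)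
      refine ⟨rfl, ?_⟩
      simp only [Nat.reduceAdd, Nat.reduceSub, List.length_nil]
      omega
    | cons b l ih =>
      intro hM
      rw [List.length_cons] at hM
      obtain ⟨h1, h2⟩ := ih (by omega)
      have hb := size_bitVal b
      rw [List.map_cons, List.map_cons, List.cons_append, tokens_bit, Val.ofList, List.length_cons]
      refine ⟨by simp only [Val.size]; omega, computes_of_wp fun env => ?_⟩
      cases b <;> rw [bitVal] at hb ⊢ <;> (conv => whnf) <;>
        refine wp_call h2 (fun m hm => ?_) <;> (conv => whnf) <;>
        (repeat (refine ⟨by (try simp only [Val.size]); omega, ?_⟩; conv => whnf)) <;>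
        refine ⟨rfl, ?_⟩ <;> simp only [Nat.reduceAdd, Nat.reduceSub] <;> omega
  have := (key k.bits (by simpa [encodeNat] using hM)).2
  rw [encodeNat, List.append_assoc]
  exact this.mono (by simp)

theorem computes_parse (t : RDT n) (w : List Symb) (hM : 12 * (t.len + w.length) + 12 ≤ M) :
    Computes body M .parse [tokens (t.encode ++ w)] (.cons t.val (tokens w)) (200 * t.len) := by
  have hw := size_tokens_le w
  induction t generalizing w with
  | leaf v =>
    have hl := RDT.len_leaf (n := n) v
    have h1 := computes_parseNat (M := M) v.den w (by omega)
    have h2 := computes_parseNat (M := M) v.num (encodeNat v.den ++ w)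
      (by rw [List.length_append]; omega)
    have := size_natVal_bits v.num
    have := size_natVal_bits v.den
    refine computes_of_wp fun env => ?_
    rw [RDT.val, RDT.encode_leaf_append, tokens_leafMark, fracVal]
    conv => whnf
    refine wp_call h2 fun m₁ hm₁ => ?_
    conv => whnf
    refine wp_call h1 fun m₂ hm₂ => ?_
    conv => whnf
    repeat (refine ⟨by (try simp only [Val.size]); omega, ?_⟩; conv => whnf)
    refine ⟨rfl, ?_⟩
    simp only [Nat.reduceAdd, Nat.reduceSub]
    omega
  | query i t₀ t₁ ih₀ ih₁ =>
    have hl := RDT.len_query i t₀ t₁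
    have e₀ : t₀.encode.length = t₀.len := rfl
    have e₁ : t₁.encode.length = t₁.len := rfl
    have h1 := computes_parseNat (M := M) i (t₀.encode ++ (t₁.encode ++ w))
      (by simp only [List.length_append]; omega)
    have := size_natVal_bits i
    have := t₀.size_val_le
    have := t₁.size_val_le
    refine computes_of_wp fun env => ?_
    rw [RDT.val, RDT.encode_query_append, tokens_queryMark]
    conv => whnf
    refine wp_call h1 fun m₁ hm₁ => ?_
    conv => whnf
    refine wp_call (ih₀ (t₁.encode ++ w) (by rw [List.length_append]; omega) (size_tokens_le _))
      fun m₂ hm₂ => ?_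
    conv => whnf
    refine wp_call (ih₁ w (by omega) hw) fun m₃ hm₃ => ?_
    conv => whnf
    repeat (refine ⟨by (try simp only [Val.size]); omega, ?_⟩; conv => whnf)
    refine ⟨rfl, ?_⟩
    simp only [Nat.reduceAdd, Nat.reduceSub]
    omega
  | coin t₀ t₁ ih₀ ih₁ =>
    have hl := RDT.len_coin t₀ t₁
    have e₀ : t₀.encode.length = t₀.len := rfl
    have e₁ : t₁.encode.length = t₁.len := rfl
    have := t₀.size_val_le
    have := t₁.size_val_le
    refine computes_of_wp fun env => ?_
    rw [RDT.val, RDT.encode_coin_append, tokens_coinMark]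
    conv => whnf
    refine wp_call (ih₀ (t₁.encode ++ w) (by rw [List.length_append]; omega) (size_tokens_le _))
      fun m₂ hm₂ => ?_
    conv => whnf
    refine wp_call (ih₁ w (by omega) hw) fun m₃ hm₃ => ?_
    conv => whnf
    repeat (refine ⟨by (try simp only [Val.size]); omega, ?_⟩; conv => whnf)
    refine ⟨rfl, ?_⟩
    simp only [Nat.reduceAdd, Nat.reduceSub]
    omega

/-! ### The number of copies -/

theorem computes_hasQuery (hM : 10 ≤ M) (t : RDT n) :
    Computes body M .hasQuery [t.val] (bitVal (decide (t.queryComplexity ≠ 0))) (50 * t.len) := by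
  induction t with
  | leaf v =>
    have hl := RDT.len_leaf (n := n) v
    refine computes_of_wp fun env => ?_
    rw [RDT.val]
    conv => whnf
    refine ⟨by simp [RDT.queryComplexity, bitVal], ?_⟩
    simp only [Nat.reduceAdd, Nat.reduceSub]
    omega
  | query i t₀ t₁ =>
    have hl := RDT.len_query i t₀ t₁
    refine computes_of_wp fun env => ?_
    rw [RDT.val]
    conv => whnf
    repeat (refine ⟨by (try simp only [Val.size]); omega, ?_⟩; conv => whnf)
    refine ⟨by simp [RDT.queryComplexity, bitVal], ?_⟩
    simp only [Nat.reduceAdd, Nat.reduceSub]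
    omega
  | coin t₀ t₁ ih₀ ih₁ =>
    have hl := RDT.len_coin t₀ t₁
    refine computes_of_wp fun env => ?_
    rw [RDT.val, RDT.queryComplexity]
    conv => whnf
    by_cases h : t₀.queryComplexity = 0
    · rw [decide_eq_false (by simpa using h)] at ih₀
      refine wp_call ih₀ fun m hm => ?_
      conv => whnf
      refine wp_call ih₁ fun m' hm' => ?_
      conv => whnf
      refine ⟨by simp [h], ?_⟩
      simp only [Nat.reduceAdd, Nat.reduceSub]
      omega
    · rw [decide_eq_true (by simpa using h)] at ih₀
      refine wp_call ih₀ fun m hm => ?_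
      conv => whnf
      repeat (refine ⟨by (try simp only [Val.size]); omega, ?_⟩; conv => whnf)
      refine ⟨by simp [h, bitVal], ?_⟩
      simp only [Nat.reduceAdd, Nat.reduceSub]
      omega

/-- The least `k` with `b ≤ s + k a` is found by counting upwards. -/
theorem computes_copies {s a b k : ℕ} (hM : 40 * (L + 1) ≤ M) (hMk : 2 * k + 1 ≤ M)
    (hlt : ∀ j < k, s + j * a < b) (hle : b ≤ s + k * a) (hb : b + a < 2 ^ L)
    (hs : s + k * a < 2 ^ L) :
    Computes body M .copies [natVal s, natVal a, natVal b] (.unary k)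
      (200 * (L + 1) * (k + 1)) := by
  induction k generalizing s with
  | zero =>
    have h := computes_le (M := M) (by omega) true (show b < 2 ^ L by omega) (show s < 2 ^ L by omega)
    rw [decide_eq_true (by simp; omega)] at h
    refine computes_of_wp fun env => ?_
    conv => whnf
    repeat (refine ⟨by (try simp only [Val.size]); omega, ?_⟩; conv => whnf)
    refine wp_call h fun m hm => ?_
    conv => whnf
    refine ⟨rfl, ?_⟩
    simp only [Nat.reduceAdd, Nat.reduceSub]
    omega
  | succ k ih =>
    have hsb : s < b := by simpa using hlt 0 (by omega)
    have hsk : s + a + k * a = s + (k + 1) * a := by ring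
    have h := computes_le (M := M) (by omega) true (show b < 2 ^ L by omega) (show s < 2 ^ L by omega)
    rw [decide_eq_false (by simp; omega)] at h
    have h1 := computes_add (M := M) (by omega) false (show s < 2 ^ L by omega)
      (show a < 2 ^ L by omega)
    rw [Bool.toNat_false, add_zero] at h1
    have h2 := ih (s := s + a) (by omega) (fun j hj => by
      have := hlt (j + 1) (by omega)
      rw [add_mul] at this
      omega) (by omega) (by omega)
    have hsz := Val.size_unary k
    have hcost : 200 * (L + 1) * (k + 1 + 1) = 200 * (L + 1) * (k + 1) + 200 * (L + 1) := by ring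
    refine computes_of_wp fun env => ?_
    conv => whnf
    repeat (refine ⟨by (try simp only [Val.size]); omega, ?_⟩; conv => whnf)
    refine wp_call h fun m hm => ?_
    conv => whnf
    refine wp_call h1 fun m₁ hm₁ => ?_
    conv => whnf
    refine wp_call h2 fun m₂ hm₂ => ?_
    conv => whnf
    refine ⟨by simp only [Val.size]; omega, rfl, ?_⟩
    simp only [Nat.reduceAdd, Nat.reduceSub]
    omega

end

/-! ### Conditional expectations -/

/-- The point `x`, changed according to the partial assignment `π`. -/
def override {n : ℕ} (π : List (Fin n × Bool)) (x : Fin n → Bool) : Fin n → Bool :=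
  fun i => (look π i).getD (x i)

/-- The expectation of `f` over the variables that are not assigned by `π`. -/
noncomputable def condExp {n : ℕ} (π : List (Fin n × Bool)) (f : (Fin n → Bool) → ℝ) : ℝ :=
  𝔼 x, f (override π x)

section condExp

variable {n : ℕ} (π : List (Fin n × Bool)) (f g : (Fin n → Bool) → ℝ)

theorem condExp_nil : condExp [] f = 𝔼 x, f x := rfl

theorem condExp_add : condExp π (fun x => f x + g x) = condExp π f + condExp π g :=
  Finset.expect_add_distrib _ _ _

theorem condExp_sub : condExp π (fun x => f x - g x) = condExp π f - condExp π g :=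
  Finset.expect_sub_distrib _ _ _

theorem condExp_const_mul (c : ℝ) : condExp π (fun x => c * f x) = c * condExp π f :=
  (Finset.mul_expect _ _ _).symm

theorem condExp_const (c : ℝ) : condExp π (fun _ => c) = c := Fintype.expect_const c

variable {π f g} in
theorem condExp_mono (h : ∀ x, f x ≤ g x) : condExp π f ≤ condExp π g :=
  Finset.expect_le_expect fun _ _ => h _

variable {π f g} in
theorem condExp_congr (h : ∀ x, f (override π x) = g (override π x)) : condExp π f = condExp π g :=
  Finset.expect_congr rfl fun x _ => h x

theorem override_cons_self (i : Fin n) (b : Bool) (x : Fin n → Bool) :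
    override ((i, b) :: π) x i = b := by simp [override, look]

variable {π} in
theorem override_of_some {i : Fin n} {b : Bool} (h : look π i = some b) (x : Fin n → Bool) :
    override π x i = b := by simp [override, h]

variable {π} in
/-- The law of total expectation for a variable that is not assigned. -/
theorem condExp_split {i : Fin n} (h : look π i = none) :
    condExp π f = (condExp ((i, false) :: π) f + condExp ((i, true) :: π) f) / 2 := by
  -- both values of `x i` are compared by means of the involution that flips it
  let flip : Equiv.Perm (Fin n → Bool) :=
    Function.Involutive.toPerm (fun x => Function.update x i (!x i)) fun x => by simp
  have hflip (x) : flip x = Function.update x i (!x i) := rfl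
  have h1 (x) : override π x = override ((i, x i) :: π) x := by
    funext j
    rcases eq_or_ne i j with rfl | hj
    · simp [override, look, h]
    · simp [override, look, hj]
  have h2 (b x) : override ((i, b) :: π) (flip x) = override ((i, b) :: π) x := by
    funext j
    rcases eq_or_ne i j with rfl | hj
    · simp [override, look]
    · simp [override, look, hj, hflip, Function.update_of_ne hj.symm]
  have h3 : condExp π f = 𝔼 x, f (override ((i, !x i) :: π) x) := by
    refine (Fintype.expect_equiv flip _ _ fun x => ?_).symm
    rw [h1, h2]
    simp [hflip]
  have h4 : condExp π f + condExp π f =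
      condExp ((i, false) :: π) f + condExp ((i, true) :: π) f := by
    nth_rewrite 2 [h3]
    simp only [condExp]
    rw [← Finset.expect_add_distrib, ← Finset.expect_add_distrib]
    refine Finset.expect_congr rfl fun x _ => ?_
    rw [h1]
    cases x i
    · rfl
    · exact add_comm _ _
  linarith

/-- Among all constants, the mean minimizes the expected squared distance. -/
theorem condExp_sq_sub_mean_le (a : ℝ) :
    condExp π (fun x => (condExp π f - f x) ^ 2) ≤ condExp π fun x => (a - f x) ^ 2 := by
  have key (c : ℝ) : condExp π (fun x => (c - f x) ^ 2) =
      c ^ 2 - 2 * c * condExp π f + condExp π fun x => f x ^ 2 := by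
    rw [← condExp_const_mul, ← condExp_const π (c ^ 2), ← condExp_sub, ← condExp_add]
    congr 1
    funext x
    ring
  rw [key, key]
  nlinarith [sq_nonneg (a - condExp π f)]

end condExp

namespace RDT

variable {n : ℕ}

/-! ### Moments of the output of a tree -/

/-- The expectation of `w (R(x, r))` over `r`, by recursion on the tree. -/
noncomputable def moment (w : ℝ → ℝ) : RDT n → (Fin n → Bool) → ℝ
  | leaf v, _ => w v.value
  | query i t₀ t₁, x => if x i then t₁.moment w x else t₀.moment w x
  | coin t₀ t₁, x => (t₀.moment w x + t₁.moment w x) / 2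

/-- Superfluous random bits do not matter, which makes an induction on the tree possible. -/
theorem expect_run_ofFn (t : RDT n) (x : Fin n → Bool) {m : ℕ} (hm : t.randomnessComplexity ≤ m) :
    𝔼 r : Fin m → Bool, t.run x (List.ofFn r) = t.moment id x := by
  induction t generalizing m with
  | leaf v => simp only [run, moment, Fintype.expect_const, id]
  | query i t₀ t₁ ih₀ ih₁ =>
    rw [randomnessComplexity, max_le_iff] at hm
    simp only [run, moment]
    split
    exacts [ih₁ hm.2, ih₀ hm.1]
  | coin t₀ t₁ ih₀ ih₁ =>
    rw [randomnessComplexity] at hm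
    obtain ⟨m, rfl⟩ : ∃ k, m = k + 1 := ⟨m - 1, by omega⟩
    rw [← Fintype.expect_equiv (Fin.consEquiv fun _ : Fin (m + 1) => Bool)
      (fun p => if p.1 then t₁.run x (List.ofFn p.2) else t₀.run x (List.ofFn p.2)) _
      (fun p => by simp [Fin.consEquiv, List.ofFn_succ, run]), ← Finset.univ_product_univ,
      Finset.expect_product]
    have h : (Finset.univ : Finset Bool).card = 2 := rfl
    simp only [Finset.expect_eq_sum_div_card (s := (Finset.univ : Finset Bool)), h, Fintype.sum_bool,
      moment, if_true, Bool.false_eq_true, if_false]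
    rw [ih₀ (by omega), ih₁ (by omega), Nat.cast_two, add_comm]

theorem mean_eq_moment (R : RDT n) (x : Fin n → Bool) : R.mean x = R.moment id x :=
  R.expect_run_ofFn x le_rfl

theorem value_mem (v : UnitFrac) : 0 ≤ v.value ∧ v.value ≤ 1 := by
  have h : (0 : ℝ) < v.den := by exact_mod_cast v.den_pos
  have h' : (v.num : ℝ) ≤ v.den := by exact_mod_cast v.num_le_den
  exact ⟨by unfold UnitFrac.value; positivity, (div_le_one h).2 h'⟩

theorem moment_sq_le_one (t : RDT n) (x : Fin n → Bool) : t.moment (· ^ 2) x ≤ 1 := by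
  induction t with
  | leaf v =>
    have := value_mem v
    simp only [moment]
    nlinarith
  | query i t₀ t₁ ih₀ ih₁ =>
    rw [moment]
    split <;> assumption
  | coin t₀ t₁ ih₀ ih₁ =>
    rw [moment]
    linarith

theorem moment_const (w : ℝ → ℝ) (t : RDT n) (ht : t.queryComplexity = 0) (x y : Fin n → Bool) :
    t.moment w x = t.moment w y := by
  induction t with
  | leaf v => rfl
  | query i t₀ t₁ => simp [queryComplexity] at ht
  | coin t₀ t₁ ih₀ ih₁ =>
    rw [queryComplexity, Nat.max_eq_zero_iff] at ht
    rw [moment, moment, ih₀ ht.1, ih₁ ht.2]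

theorem condExp_of_moment_query_some {w : ℝ → ℝ} {π : List (Fin n × Bool)} {i : Fin n} {b : Bool}
    (h : look π i = some b) (t₀ t₁ : RDT n) (x : Fin n → Bool) :
    (query i t₀ t₁).moment w (override π x) = (if b then t₁ else t₀).moment w (override π x) := by
  rw [moment, override_of_some h]
  cases b <;> rfl

/-! ### The values of the computed fractions -/

end RDT

/-- The real number denoted by a fraction. -/
noncomputable def fval (f : ℕ × ℕ) : ℝ := (f.1 : ℝ) / f.2

theorem fval_fmul (f g : ℕ × ℕ) : fval (fmul f g) = fval f * fval g := by
  simp [fval, fmul, mul_div_mul_comm]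

theorem fval_fadd {f g : ℕ × ℕ} (hf : 0 < f.2) (hg : 0 < g.2) :
    fval (fadd f g) = fval f + fval g := by
  have hf' : (f.2 : ℝ) ≠ 0 := by exact_mod_cast hf.ne'
  have hg' : (g.2 : ℝ) ≠ 0 := by exact_mod_cast hg.ne'
  simp only [fval, fadd]
  push_cast
  field_simp

theorem fval_favg {f g : ℕ × ℕ} (hf : 0 < f.2) (hg : 0 < g.2) :
    fval (favg f g) = (fval f + fval g) / 2 := by
  rw [favg, fval_fmul, fval_fadd hf hg]
  simp [fval]
  ring

theorem fle_iff {f g : ℕ × ℕ} (hf : 0 < f.2) (hg : 0 < g.2) :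
    fle f g = true ↔ fval f ≤ fval g := by
  have hf' : (0 : ℝ) < f.2 := by exact_mod_cast hf
  have hg' : (0 : ℝ) < g.2 := by exact_mod_cast hg
  rw [fle, decide_eq_true_iff, fval, fval, div_le_div_iff₀ hf' hg']
  exact_mod_cast Iff.rfl

theorem favg_den_pos {f g : ℕ × ℕ} (hf : 0 < f.2) (hg : 0 < g.2) : 0 < (favg f g).2 := by
  simp only [favg, fmul, fadd]
  positivity

namespace RDT

variable {n : ℕ}

theorem fval_meanFrac (t : RDT n) (π : List (Fin n × Bool)) :
    fval (t.meanFrac π) = condExp π (t.moment id) := by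
  induction t generalizing π with
  | leaf v => exact (condExp_const π _).symm
  | query i t₀ t₁ ih₀ ih₁ =>
    rw [meanFrac]
    split
    next h =>
      rw [fval_favg (meanFrac_mem _ _).1 (meanFrac_mem _ _).1, ih₀, ih₁, condExp_split _ h]
      congr 2 <;> exact condExp_congr fun x => by simp [moment, override_cons_self]
    next b h =>
      rw [condExp_congr fun x => condExp_of_moment_query_some h t₀ t₁ x]
      cases b
      exacts [ih₀ π, ih₁ π]
  | coin t₀ t₁ ih₀ ih₁ =>
    rw [meanFrac, fval_favg (meanFrac_mem _ _).1 (meanFrac_mem _ _).1, ih₀, ih₁, ← condExp_add,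
      div_eq_inv_mul, ← condExp_const_mul]
    exact condExp_congr fun x => by simp only [moment]; ring

theorem score_den_pos (R : RDT n) {s c : ℕ × ℕ} (hs : 0 < s.2) (hc : 0 < c.2) (t : RDT n)
    (π : List (Fin n × Bool)) : 0 < (score R s c t π).1.2 ∧ 0 < (score R s c t π).2.2 := by
  induction t generalizing π with
  | leaf v =>
    have := v.den_pos
    have := (R.meanFrac_mem π).1
    simp only [score, fmul, fadd, UnitFrac.frac]
    constructor <;> positivity
  | query i t₀ t₁ ih₀ ih₁ =>
    rw [score]
    split
    · exact ⟨favg_den_pos (ih₀ _).1 (ih₁ _).1, favg_den_pos (ih₀ _).2 (ih₁ _).2⟩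
    · split
      exacts [ih₁ π, ih₀ π]
  | coin t₀ t₁ ih₀ ih₁ =>
    exact ⟨favg_den_pos (ih₀ _).1 (ih₁ _).1, favg_den_pos (ih₀ _).2 (ih₁ _).2⟩

theorem fval_score (R : RDT n) {s c : ℕ × ℕ} (hs : 0 < s.2) (hc : 0 < c.2) (t : RDT n)
    (π : List (Fin n × Bool)) :
    fval (score R s c t π).1 =
        condExp π (fun x => t.moment (· ^ 2) x + 2 * fval s * t.moment id x) ∧
      fval (score R s c t π).2 =
        condExp π (fun x => fval c * (t.moment id x * R.moment id x)) := by
  induction t generalizing π with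
  | leaf v =>
    have hv : fval v.frac = v.value := rfl
    simp only [score, fval_fmul, moment, id]
    rw [fval_fadd v.den_pos (Nat.mul_pos hs hs), fval_fadd hs hs, condExp_const, condExp_const_mul,
      condExp_const_mul, fval_meanFrac, hv]
    exact ⟨by ring, rfl⟩
  | query i t₀ t₁ ih₀ ih₁ =>
    have d₀ := R.score_den_pos hs hc t₀ ((i, false) :: π)
    have d₁ := R.score_den_pos hs hc t₁ ((i, true) :: π)
    rw [score]
    split
    next h =>
      rw [favgPair, fval_favg d₀.1 d₁.1, fval_favg d₀.2 d₁.2, (ih₀ _).1, (ih₀ _).2, (ih₁ _).1,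
        (ih₁ _).2, condExp_split _ h, condExp_split (fun x => fval c * _) h]
      constructor <;> congr 2 <;> exact condExp_congr fun x => by simp [moment, override_cons_self]
    next b h =>
      rw [condExp_congr (g := fun x => (if b then t₁ else t₀).moment (· ^ 2) x +
          2 * fval s * (if b then t₁ else t₀).moment id x) fun x => by
          rw [condExp_of_moment_query_some h, condExp_of_moment_query_some h],
        condExp_congr (f := fun x => fval c * _)
          (g := fun x => fval c * ((if b then t₁ else t₀).moment id x * R.moment id x)) fun x => by
          rw [condExp_of_moment_query_some h]]
      cases b
      exacts [ih₀ π, ih₁ π]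
  | coin t₀ t₁ ih₀ ih₁ =>
    have d₀ := R.score_den_pos hs hc t₀ π
    have d₁ := R.score_den_pos hs hc t₁ π
    rw [score, favgPair, fval_favg d₀.1 d₁.1, fval_favg d₀.2 d₁.2, (ih₀ _).1, (ih₀ _).2, (ih₁ _).1,
      (ih₁ _).2, ← condExp_add, ← condExp_add, div_eq_inv_mul, ← condExp_const_mul, div_eq_inv_mul,
      ← condExp_const_mul]
    constructor <;> exact condExp_congr fun x => by simp only [moment]; ring

/-! ### The potential argument -/

/-- The potential of a state inside a copy of `R`, with remaining subtree `t`: the conditional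
expectation, over independent random choices in `t` and in `j` further copies of `R`, of the square
of the difference between the sum of all leaf values and the corresponding multiple of the mean. The
earlier leaf values sum up to `s`, and `c / 2` copies have been started. -/
noncomputable def potential (R : RDT n) (j : ℕ) (s c : ℝ) (t : RDT n) (x : Fin n → Bool) : ℝ :=
  t.moment (· ^ 2) x + 2 * t.moment id x * (s - c / 2 * R.moment id x) +
    (s - c / 2 * R.moment id x) ^ 2 + j * (R.moment (· ^ 2) x - R.moment id x ^ 2)

/-- The potential of a state between two copies of `R`, when `c / 2 - 1` copies are finished and `j`
copies remain. -/
noncomputable def potential' (R : RDT n) (j : ℕ) (s c : ℝ) (x : Fin n → Bool) : ℝ :=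
  (s - (c / 2 - 1) * R.moment id x) ^ 2 + j * (R.moment (· ^ 2) x - R.moment id x ^ 2)

/-- If the potential between copies bounds the error of `gen`, then the potential inside a copy bounds
the error of `RDT.walk`: at a stochastic node the potential is the average over both subtrees, and
the subtree with the smaller potential is entered. -/
theorem condExp_sq_walk_le (R : RDT n) (gen : List (Fin n × Bool) → ℕ × ℕ → ℕ × ℕ → RDT n)
    (j : ℕ) (κ : ℝ) {s c : ℕ × ℕ} (hs : 0 < s.2) (hc : 0 < c.2)
    (hgen : ∀ π s' c', 0 < s'.2 → 0 < c'.2 → fval c' = fval c + 2 →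
      κ ^ 2 * condExp π (fun x => ((gen π s' c').run x [] - R.moment id x) ^ 2) ≤
        condExp π (R.potential' j (fval s') (fval c')))
    (t : RDT n) (π : List (Fin n × Bool)) :
    κ ^ 2 * condExp π (fun x => ((walk R gen t π s c).run x [] - R.moment id x) ^ 2) ≤
      condExp π (R.potential j (fval s) (fval c) t) := by
  induction t generalizing π with
  | leaf v =>
    have h1 : fval (fadd s v.frac) = fval s + v.value := fval_fadd hs v.den_pos
    have h2 : fval (fadd c (2, 1)) = fval c + 2 := by
      rw [fval_fadd hc one_pos]
      simp [fval]
    refine (hgen π _ _ (Nat.mul_pos hs v.den_pos) (Nat.mul_pos hc one_pos) h2).trans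
      (le_of_eq (condExp_congr fun x => ?_))
    rw [h1, h2]
    simp only [potential, potential', moment, id]
    ring
  | query i t₀ t₁ ih₀ ih₁ =>
    rw [walk]
    split
    next h =>
      rw [condExp_split _ h, condExp_split (R.potential _ _ _ _) h]
      refine le_trans (le_of_eq ?_) (le_trans (div_le_div_of_nonneg_right
        (add_le_add (ih₀ ((i, false) :: π)) (ih₁ ((i, true) :: π))) zero_le_two) (le_of_eq ?_))
      · rw [mul_div_assoc', mul_add]
        congr 3 <;> exact condExp_congr fun x => by simp [run, override_cons_self]
      · congr 2 <;> exact condExp_congr fun x => by simp [potential, moment, override_cons_self]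
    next b h =>
      rw [condExp_congr (f := R.potential _ _ _ _)
        (g := R.potential j (fval s) (fval c) (if b then t₁ else t₀)) fun x => by
        simp only [potential, condExp_of_moment_query_some h]]
      cases b
      exacts [ih₀ π, ih₁ π]
  | coin t₀ t₁ ih₀ ih₁ =>
    have d₀ := R.score_den_pos hs hc t₀ π
    have d₁ := R.score_den_pos hs hc t₁ π
    have e₀ := R.fval_score hs hc t₀ π
    have e₁ := R.fval_score hs hc t₁ π
    -- the part of the potential that does not depend on the subtree
    let rest : (Fin n → Bool) → ℝ := fun x => (fval s - fval c / 2 * R.moment id x) ^ 2 +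
      j * (R.moment (· ^ 2) x - R.moment id x ^ 2)
    have key (t : RDT n) : condExp π (R.potential j (fval s) (fval c) t) =
        condExp π (fun x => t.moment (· ^ 2) x + 2 * fval s * t.moment id x) -
          condExp π (fun x => fval c * (t.moment id x * R.moment id x)) + condExp π rest := by
      rw [← condExp_sub, ← condExp_add]
      exact condExp_congr fun x => by simp only [potential, rest]; ring
    have havg : condExp π (R.potential j (fval s) (fval c) (coin t₀ t₁)) =
        (condExp π (R.potential j (fval s) (fval c) t₀) +
          condExp π (R.potential j (fval s) (fval c) t₁)) / 2 := by
      rw [← condExp_add, div_eq_inv_mul, ← condExp_const_mul]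
      exact condExp_congr fun x => by simp only [potential, moment]; ring
    have hpref : prefersLeft (score R s c t₀ π) (score R s c t₁ π) = true ↔
        condExp π (R.potential j (fval s) (fval c) t₀) ≤
          condExp π (R.potential j (fval s) (fval c) t₁) := by
      rw [prefersLeft, fle_iff (Nat.mul_pos d₀.1 d₁.2) (Nat.mul_pos d₁.1 d₀.2), fval_fadd d₀.1 d₁.2,
        fval_fadd d₁.1 d₀.2, e₀.1, e₀.2, e₁.1, e₁.2, key, key]
      constructor <;> intro <;> linarith
    rw [walk, havg]
    split
    next h =>
      have := hpref.1 h
      linarith [ih₀ π]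
    next h =>
      have := not_le.1 fun h' => h (hpref.2 h')
      linarith [ih₁ π]

/-- The number `κ` of all copies is `c / 2 - 1` finished ones and `j` remaining ones. -/
theorem condExp_sq_build_le (R : RDT n) (κ : ℝ) (j : ℕ) (π : List (Fin n × Bool)) {s c : ℕ × ℕ}
    (hs : 0 < s.2) (hc : 0 < c.2) (hκ : fval c = 2 * (κ - j + 1)) :
    κ ^ 2 * condExp π (fun x => ((R.build j π s c).run x [] - R.moment id x) ^ 2) ≤
      condExp π (R.potential' j (fval s) (fval c)) := by
  induction j generalizing π s c with
  | zero =>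
    have h : ∀ x, (R.build 0 π s c).run x [] = condExp π (R.moment id) := fun x =>
      R.fval_meanFrac π
    simp only [h]
    rcases eq_or_ne κ 0 with rfl | h0
    · rw [zero_pow two_ne_zero, zero_mul, ← condExp_const π 0]
      exact condExp_mono fun x => by simp only [potential', Nat.cast_zero, zero_mul]; positivity
    refine (mul_le_mul_of_nonneg_left (condExp_sq_sub_mean_le π _ (fval s / κ))
      (sq_nonneg κ)).trans (le_of_eq ?_)
    rw [← condExp_const_mul]
    refine condExp_congr fun x => ?_
    rw [potential', hκ]
    simp only [Nat.cast_zero]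
    field_simp
    ring
  | succ j ih =>
    refine (R.condExp_sq_walk_le (R.build j) j κ hs hc (fun π' s' c' hs' hc' h => ih π' hs' hc' ?_)
      R π).trans (le_of_eq (condExp_congr fun x => ?_))
    · rw [h, hκ]
      push_cast
      ring
    · simp only [potential, potential']
      push_cast
      ring

/-- The mean squared error of the tree built with `k` copies. -/
theorem expect_sq_build_le (R : RDT n) {k : ℕ} (hk : 0 < k) :
    𝔼 x, ((R.build k [] (0, 1) (2, 1)).run x [] - R.mean x) ^ 2 ≤ 1 / (k : ℝ) := by
  have hk' : (0 : ℝ) < k := by exact_mod_cast hk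
  have h := R.condExp_sq_build_le k k [] (s := (0, 1)) (c := (2, 1)) one_pos one_pos
    (by simp [fval])
  have h' : condExp [] (R.potential' k (fval (0, 1)) (fval (2, 1))) ≤ k := by
    rw [← condExp_const [] (k : ℝ)]
    refine condExp_mono fun x => ?_
    have := R.moment_sq_le_one x
    simp only [potential', fval]
    norm_num
    nlinarith [sq_nonneg (R.moment id x)]
  simp only [mean_eq_moment]
  rw [condExp_nil] at h
  rw [le_div_iff₀ hk']
  refine le_of_mul_le_mul_left ?_ hk'
  nlinarith [h.trans h']

/-- Without queries the mean function is constant, and no copy is needed. -/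
theorem expect_sq_build_zero (R : RDT n) (hR : R.queryComplexity = 0) (s c : ℕ × ℕ) :
    𝔼 x, ((R.build 0 [] s c).run x [] - R.mean x) ^ 2 = 0 := by
  refine (Finset.expect_congr rfl fun x _ => ?_).trans (Fintype.expect_const 0)
  have h : (R.build 0 [] s c).run x [] = condExp [] (R.moment id) := R.fval_meanFrac []
  rw [h, mean_eq_moment, condExp_congr (g := fun _ => R.moment id x) fun y => moment_const _ _ hR _ _,
    condExp_const]
  ring

/-! ### Shape of the output -/

theorem queryComplexity_walk_le {X : ℕ} (R : RDT n)
    (gen : List (Fin n × Bool) → ℕ × ℕ → ℕ × ℕ → RDT n)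
    (hgen : ∀ π s c, (gen π s c).queryComplexity ≤ X) (t : RDT n) (π : List (Fin n × Bool))
    (s c : ℕ × ℕ) : (walk R gen t π s c).queryComplexity ≤ t.queryComplexity + X := by
  induction t generalizing π with
  | leaf v => simpa [walk, queryComplexity] using hgen _ _ _
  | query i t₀ t₁ ih₀ ih₁ =>
    rw [walk, queryComplexity]
    split
    · have := ih₀ ((i, false) :: π)
      have := ih₁ ((i, true) :: π)
      rw [queryComplexity]
      omega
    · split
      · exact (ih₁ π).trans (by omega)
      · exact (ih₀ π).trans (by omega)
  | coin t₀ t₁ ih₀ ih₁ =>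
    rw [walk, queryComplexity]
    split
    · exact (ih₀ π).trans (by omega)
    · exact (ih₁ π).trans (by omega)

theorem queryComplexity_build_le (R : RDT n) (j : ℕ) (π : List (Fin n × Bool)) (s c : ℕ × ℕ) :
    (R.build j π s c).queryComplexity ≤ j * R.queryComplexity := by
  induction j generalizing π s c with
  | zero => simp [build, queryComplexity]
  | succ j ih =>
    have := R.queryComplexity_walk_le (R.build j) ih R π s c
    rw [build]
    refine this.trans (le_of_eq ?_)
    ring

theorem isDeterministic_walk (R : RDT n) (gen : List (Fin n × Bool) → ℕ × ℕ → ℕ × ℕ → RDT n)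
    (hgen : ∀ π s c, (gen π s c).IsDeterministic) (t : RDT n) (π : List (Fin n × Bool))
    (s c : ℕ × ℕ) : (walk R gen t π s c).IsDeterministic := by
  induction t generalizing π with
  | leaf v => exact hgen _ _ _
  | query i t₀ t₁ ih₀ ih₁ =>
    rw [walk]
    split
    · exact ⟨ih₀ _, ih₁ _⟩
    · split
      exacts [ih₁ π, ih₀ π]
  | coin t₀ t₁ ih₀ ih₁ =>
    rw [walk]
    split
    exacts [ih₀ π, ih₁ π]

theorem isDeterministic_build (R : RDT n) (j : ℕ) (π : List (Fin n × Bool)) (s c : ℕ × ℕ) :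
    (R.build j π s c).IsDeterministic := by
  induction j generalizing π s c with
  | zero => trivial
  | succ j ih => exact R.isDeterministic_walk _ ih R π s c

end RDT

section

variable {M L A n : ℕ}

/-- The number of copies of `R` for accuracy `a / b`: none if `R` makes no queries, and the quotient
`b / a`, rounded up, otherwise. -/
def RDT.copies (R : RDT n) (a b : ℕ) : ℕ := if R.queryComplexity = 0 then 0 else (b + (a - 1)) / a

/-- The derandomization of `R` with accuracy `a / b`. -/
def RDT.derand (R : RDT n) (a b : ℕ) : RDT n := R.build (R.copies a b) [] (0, 1) (2, 1)

theorem computes_copies_zero {a b k : ℕ} (hM : 40 * (L + 1) ≤ M) (hMk : 2 * k + 1 ≤ M)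
    (ha : 0 < a) (hk : k = (b + (a - 1)) / a) (hab : 2 * (a + b) < 2 ^ L) :
    Computes body M .copies [.nil, natVal a, natVal b] (.unary k) (200 * (L + 1) * (k + 1)) := by
  have h1 := Nat.div_mul_le_self (b + (a - 1)) a
  have h2 := Nat.lt_div_mul_add ha (a := b + (a - 1))
  rw [← hk] at h1 h2
  have := computes_copies (s := 0) (a := a) (b := b) hM hMk (fun j hj => ?_) (by omega) (by omega)
    (by omega)
  · rwa [natVal_zero] at this
  · have : (j + 1) * a ≤ k * a := Nat.mul_le_mul_right a hj
    rw [add_mul] at this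
    omega

/-- The whole algorithm; `L` bounds the digits of all numbers, `A` the lengths of partial assignments
and `M` the sizes of values. -/
theorem computes_main {a b k : ℕ} (R : RDT n) (hk : R.copies a b = k) (ha : 0 < a)
    (hM : 40 * (L + 1) ≤ M) (hM' : (4 * L + 6) * A + 1 ≤ M)
    (hMin : 12 * ((encodeFraction a b).length + R.len) + 12 ≤ M) (hMk : 2 * k + 1 ≤ M)
    (hMD : 12 * (R.derand a b).val.size + 1 ≤ M)
    (hL : 2 * ((3 * (2 + k * (R.len + 3)) + 3 * R.len + 3) * R.len) + 1 ≤ L)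
    (hab : 2 * (a + b) < 2 ^ L) (hA : (k + 1) * R.len ≤ A) :
    Computes body M .main [tokens (encodeFraction a b ++ R.encode)]
      (tokens (R.derand a b).encode)
      (250 * ((encodeFraction a b).length + R.len) + 200 * (L + 1) * (k + 1) +
        2 ^ (k * R.queryComplexity) *
          (10 * unit L A * (R.len + 1) * ((R.len ^ 2 + 1) * (k + 1))) +
        100 * (R.derand a b).val.size + 1000) := by
  have e₀ : R.encode.length = R.len := rfl
  have hf : (encodeFraction a b).length = (encodeNat a).length + (encodeNat b).length := by
    rw [encodeFraction, List.length_append]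
  have h1 := computes_parseNat (M := M) a (encodeNat b ++ (R.encode ++ []))
    (by simp only [List.length_append, List.length_nil]; omega)
  have h2 := computes_parseNat (M := M) b (R.encode ++ [])
    (by simp only [List.length_append, List.length_nil]; omega)
  have h3 := computes_parse (M := M) R [] (by rw [List.length_nil]; omega)
  have h4 := computes_hasQuery (M := M) (by omega) R
  have h5 := computes_build hM hM' R k 2 hL [] (fun e he => by simp at he) (by simpa using hA)
    (s := (0, 1)) (c := (2, 1)) (by simp [FB]) (by simp [FB])
    (by rw [RDT.derand, hk] at hMD; omega)
  rw [show fracVal (0, 1) = _ from congrArg₂ Val.cons natVal_zero natVal_one,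
    show fracVal (2, 1) = _ from congrArg₂ Val.cons natVal_two natVal_one, asgVal] at h5
  have hlen := (R.derand a b).len_le_size_val
  have h6 := computes_print (M := M) (R.derand a b) (R.isDeterministic_build _ _ _ _) []
    (by rw [List.length_nil]; omega)
  have hD : R.build k [] (0, 1) (2, 1) = R.derand a b := by rw [RDT.derand, hk]
  have hnil : tokens [] = .nil := rfl
  rw [hD] at h5
  rw [List.append_nil, hnil] at h6
  rw [show encodeFraction a b ++ R.encode = encodeNat a ++ (encodeNat b ++ (R.encode ++ [])) by
    simp [encodeFraction]]
  generalize 2 ^ (k * R.queryComplexity) *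
    (10 * unit L A * (R.len + 1) * ((R.len ^ 2 + 1) * (k + 1))) = B at *
  refine computes_of_wp fun env => ?_
  conv => whnf
  refine wp_call h1 fun m₁ hm₁ => ?_
  conv => whnf
  refine wp_call h2 fun m₂ hm₂ => ?_
  conv => whnf
  refine wp_call h3 fun m₃ hm₃ => ?_
  conv => whnf
  by_cases hq : R.queryComplexity = 0
  · obtain rfl : k = 0 := by rw [← hk, RDT.copies, if_pos hq]
    rw [Val.unary] at h5
    rw [decide_eq_false (by simpa using hq)] at h4
    refine wp_call h4 fun m₄ hm₄ => ?_
    conv => whnf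
    repeat (refine ⟨by (try simp only [Val.size]); omega, ?_⟩; conv => whnf)
    refine wp_call h5 fun m₅ hm₅ => ?_
    conv => whnf
    refine wp_call h6 fun m₆ hm₆ => ?_
    conv => whnf
    refine ⟨rfl, ?_⟩
    simp only [Nat.reduceAdd, Nat.reduceSub]
    omega
  · have h7 := computes_copies_zero hM hMk ha (by rw [← hk, RDT.copies, if_neg hq]) hab
    rw [decide_eq_true (by simpa using hq)] at h4
    refine wp_call h4 fun m₄ hm₄ => ?_
    conv => whnf
    refine wp_call h7 fun m₇ hm₇ => ?_
    conv => whnf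
    repeat (refine ⟨by (try simp only [Val.size]); omega, ?_⟩; conv => whnf)
    refine wp_call h5 fun m₅ hm₅ => ?_
    conv => whnf
    refine wp_call h6 fun m₆ hm₆ => ?_
    conv => whnf
    refine ⟨rfl, ?_⟩
    simp only [Nat.reduceAdd, Nat.reduceSub]
    omega

/-! ### The running time -/

theorem pow_le_of_le {x y i j : ℕ} (hx : 1 ≤ x) (hxy : x ≤ y) (hij : i ≤ j) : x ^ i ≤ y ^ j :=
  (Nat.pow_le_pow_right hx hij).trans (Nat.pow_le_pow_left hxy j)

/-- With `Y = |R| + k + |(a, b)| + 1` and `P = 2 ^ (k q)`, the choices `L = 50 Y³`, `A = Y²` and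
`M = 10⁴ P Y⁵` satisfy all conditions of `computes_main`. -/
theorem outputsWithin_derand {a b : ℕ} (R : RDT n) (ha : 0 < a) :
    OutputsWithin (interpreter body .main) (encodeFraction a b ++ R.encode)
      (R.derand a b).encode
      (10 ^ 15 * ((2 ^ (R.copies a b * R.queryComplexity)) ^ 2 *
        (R.len + R.copies a b + (encodeFraction a b).length + 1) ^ 17)) := by
  have hN := R.one_le_len
  obtain ⟨k, hk⟩ : ∃ k, R.copies a b = k := ⟨_, rfl⟩
  have hD : (R.derand a b).val.size ≤ _ := le_trans (Nat.le_add_right _ _)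
    (R.size_build_le (L := 50 * (R.len + k + (encodeFraction a b).length + 1) ^ 3) (by
      have : R.len * 1 ≤ (R.len + k + (encodeFraction a b).length + 1) ^ 3 := by
        rw [pow_succ']; gcongr
        · omega
        · exact Nat.one_le_pow _ _ (by omega)
      omega) _ _ _ _)
  rw [hk] at hD ⊢
  have hab : 2 * (a + b) < 2 ^ (encodeFraction a b).length * 4 := by
    have h1 := lt_two_pow_encodeNat a
    have h2 := lt_two_pow_encodeNat b
    have h3 := Nat.pow_le_pow_right (n := 2) (by norm_num)
      (show (encodeNat a).length ≤ (encodeFraction a b).length by simp [encodeFraction])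
    have h4 := Nat.pow_le_pow_right (n := 2) (by norm_num)
      (show (encodeNat b).length ≤ (encodeFraction a b).length by simp [encodeFraction])
    omega
  obtain ⟨l, hl⟩ : ∃ l, (encodeFraction a b).length = l := ⟨_, rfl⟩
  obtain ⟨N, hNN⟩ : ∃ N, R.len = N := ⟨_, rfl⟩
  obtain ⟨Y, hY⟩ : ∃ Y, N + k + l + 1 = Y := ⟨_, rfl⟩
  obtain ⟨P, hP⟩ : ∃ P, 2 ^ (k * R.queryComplexity) = P := ⟨_, rfl⟩
  have hP1 : 1 ≤ P := hP ▸ Nat.one_le_two_pow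
  have hY1 : 1 ≤ Y := by omega
  rw [hl] at hab
  rw [hl, hNN, hP, hY] at hD ⊢
  rw [hNN] at hN
  have hkN : k * N ≤ Y * Y := Nat.mul_le_mul (by omega) (by omega)
  have hY3 : Y ≤ Y ^ 3 := by simpa using pow_le_of_le (i := 1) (j := 3) hY1 le_rfl (by norm_num)
  have hY23 : Y ^ 2 ≤ Y ^ 3 := pow_le_of_le hY1 le_rfl (by norm_num)
  have hY35 : Y ^ 3 ≤ P * Y ^ 5 :=
    (pow_le_of_le hY1 le_rfl (by norm_num)).trans (Nat.le_mul_of_pos_left _ hP1)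
  have hPY : P * Y ^ 3 ≤ P * Y ^ 5 := Nat.mul_le_mul_left _ (pow_le_of_le hY1 le_rfl (by norm_num))
  have hY0 : 1 ≤ Y ^ 3 := Nat.one_le_pow _ _ hY1
  have hPY0 : P ≤ P * Y ^ 3 := Nat.le_mul_of_pos_right _ hY0
  have hY25 : Y ^ 2 ≤ Y ^ 5 := pow_le_of_le hY1 le_rfl (by norm_num)
  have hY5 : Y ^ 5 ≤ P * Y ^ 5 := Nat.le_mul_of_pos_left _ hP1
  have hD' : (R.derand a b).val.size ≤ 615 * (P * Y ^ 3) := by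
    refine hD.trans ?_
    calc P * (12 * (50 * Y ^ 3) + 15) = 600 * (P * Y ^ 3) + 15 * P := by ring
      _ ≤ _ := by omega
  have hL : 2 * ((3 * (2 + k * (N + 3)) + 3 * N + 3) * N) + 1 ≤ 50 * Y ^ 3 := by
    have h1 : k * N * N ≤ Y ^ 3 := by
      calc k * N * N ≤ Y * Y * Y := Nat.mul_le_mul hkN (by omega)
        _ = Y ^ 3 := by ring
    have h2 : N * N ≤ Y ^ 2 := by rw [sq]; exact Nat.mul_le_mul (by omega) (by omega)
    calc _ = 6 * (k * N * N) + 18 * (k * N) + 6 * (N * N) + 18 * N + 1 := by ring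
      _ ≤ 50 * Y ^ 3 := by rw [← sq] at hkN; omega
  have hA : (k + 1) * N ≤ Y ^ 2 := by rw [sq]; exact Nat.mul_le_mul (by omega) (by omega)
  have hab' : 2 * (a + b) < 2 ^ (50 * Y ^ 3) := by
    refine hab.trans_le ?_
    rw [show (4 : ℕ) = 2 ^ 2 by norm_num, ← pow_add]
    exact Nat.pow_le_pow_right (by norm_num) (by omega)
  have hLA : (4 * (50 * Y ^ 3) + 6) * Y ^ 2 + 1 ≤ 10000 * (P * Y ^ 5) := by
    calc _ = 200 * Y ^ 5 + 6 * Y ^ 2 + 1 := by ring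
      _ ≤ _ := by omega
  have hmain := computes_main (L := 50 * Y ^ 3) (A := Y ^ 2) (M := 10000 * (P * Y ^ 5)) R hk ha
    (by omega) hLA (by rw [hl, hNN]; omega) (by omega) (by omega) (by rw [hNN]; exact hL) hab'
    (by rw [hNN]; exact hA)
  rw [hl, hNN, hP] at hmain
  have hU : unit (50 * Y ^ 3) (Y ^ 2) ≤ 5202000 * Y ^ 8 := by
    calc unit (50 * Y ^ 3) (Y ^ 2) ≤ 1000 * (51 * Y ^ 3) ^ 2 * (2 * Y ^ 2) := by
          rw [unit]
          gcongr
          · omega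
          · have := Nat.one_le_pow 2 _ hY1
            omega
      _ = 102 * 51 * 1000 * Y ^ 8 := by ring
      _ = _ := by norm_num
  have hB : P * (10 * unit (50 * Y ^ 3) (Y ^ 2) * (N + 1) * ((N ^ 2 + 1) * (k + 1))) ≤
      52020000 * (P * Y ^ 12) := by
    calc _ ≤ P * (10 * (5202000 * Y ^ 8) * Y * (Y ^ 2 * Y)) := by
          gcongr
          · omega
          · nlinarith
          · omega
      _ = 10 * 5202000 * (P * Y ^ 12) := by ring
      _ = _ := by norm_num
  have hP12 : P * Y ^ 3 ≤ P * Y ^ 12 := Nat.mul_le_mul_left _ (pow_le_of_le hY1 le_rfl (by norm_num))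
  have hC : 200 * (50 * Y ^ 3 + 1) * (k + 1) ≤ 10200 * (P * Y ^ 12) := by
    calc _ ≤ 200 * (51 * Y ^ 3) * Y := by
          gcongr
          · omega
          · omega
      _ = 10200 * (1 * Y ^ 4) := by ring
      _ ≤ 10200 * (P * Y ^ 12) := by
        gcongr
        norm_num
  have hPY12 : Y ^ 3 ≤ P * Y ^ 12 := (Nat.le_mul_of_pos_left _ hP1).trans hP12
  have hn : 250 * (l + N) + 200 * (50 * Y ^ 3 + 1) * (k + 1) +
      P * (10 * unit (50 * Y ^ 3) (Y ^ 2) * (N + 1) * ((N ^ 2 + 1) * (k + 1))) +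
      100 * (R.derand a b).val.size + 1000 + 1 ≤ 10 ^ 8 * (P * Y ^ 12) := by omega
  obtain ⟨m, hm, he⟩ := hmain []
  rw [List.append_nil] at he
  cases he with
  | @call _ _ _ m he =>
    obtain ⟨s⟩ := outputsWithin_interpreter body .main he (by
      refine (size_tokens_le _).trans ?_
      have : R.encode.length = N := hNN
      rw [List.length_append, hl, this]
      omega)
    refine ⟨⟨s.1, s.2.trans ?_⟩⟩
    calc 40 * (10000 * (P * Y ^ 5) + 1) * (m + 1) ≤
          40 * (20000 * (P * Y ^ 5)) * (10 ^ 8 * (P * Y ^ 12)) := by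
          gcongr
          · omega
          · omega
      _ = 800000 * 10 ^ 8 * (P ^ 2 * Y ^ 17) := by ring
      _ ≤ _ := by gcongr; norm_num

end

/-! ### Accuracy and running time for a given `ε` -/

variable {n : ℕ}

theorem RDT.copies_bounds (R : RDT n) {a b : ℕ} (ha : 0 < a) (hR : R.queryComplexity ≠ 0) :
    b ≤ R.copies a b * a ∧ R.copies a b * a ≤ b + a := by
  have h1 := Nat.div_mul_le_self (b + (a - 1)) a
  have h2 := Nat.lt_div_mul_add ha (a := b + (a - 1))
  rw [copies, if_neg hR]
  omega

theorem RDT.copies_le_two_div (R : RDT n) {a b : ℕ} (ha : 0 < a) (hb : 0 < b) {ε : ℝ} (hε : ε < 1 / 2)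
    (h : ε = a / b) : (R.copies a b : ℝ) ≤ 2 / ε := by
  have ha' : (0 : ℝ) < a := by exact_mod_cast ha
  have hb' : (0 : ℝ) < b := by exact_mod_cast hb
  have hε0 : 0 < ε := by rw [h]; positivity
  by_cases hR : R.queryComplexity = 0
  · rw [copies, if_pos hR, Nat.cast_zero]
    positivity
  have h1 : (R.copies a b : ℝ) * a ≤ b + a := by exact_mod_cast (R.copies_bounds ha hR).2
  have hab : (a : ℝ) ≤ b := by
    rw [h, div_lt_iff₀ hb'] at hε
    linarith
  rw [h, div_div_eq_mul_div, le_div_iff₀ ha']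
  linarith

theorem RDT.expect_sq_derand_le (R : RDT n) {a b : ℕ} (ha : 0 < a) (hb : 0 < b) :
    𝔼 x, ((R.derand a b).run x [] - R.mean x) ^ 2 ≤ (a : ℝ) / b := by
  have ha' : (0 : ℝ) < a := by exact_mod_cast ha
  have hb' : (0 : ℝ) < b := by exact_mod_cast hb
  by_cases hR : R.queryComplexity = 0
  · rw [derand, copies, if_pos hR, R.expect_sq_build_zero hR]
    positivity
  have hba := (R.copies_bounds (b := b) ha hR).1
  have hk : 0 < R.copies a b := by
    by_contra h0
    rw [Nat.eq_zero_of_not_pos h0] at hba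
    omega
  refine (R.expect_sq_build_le hk).trans ?_
  rw [div_le_div_iff₀ (by exact_mod_cast hk) hb', one_mul, mul_comm]
  exact_mod_cast hba

theorem RDT.queryComplexity_derand_le (R : RDT n) {a b q : ℕ} (ha : 0 < a) (hb : 0 < b) {ε : ℝ}
    (hε : ε < 1 / 2) (h : ε = a / b) (hq : R.queryComplexity ≤ q) :
    ((R.copies a b * R.queryComplexity : ℕ) : ℝ) ≤ 2 * (q / ε) := by
  have hε0 : 0 < ε := by
    rw [h]
    exact div_pos (by exact_mod_cast ha) (by exact_mod_cast hb)
  have hq' : (R.queryComplexity : ℝ) ≤ q := by exact_mod_cast hq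
  calc ((R.copies a b * R.queryComplexity : ℕ) : ℝ) = R.copies a b * R.queryComplexity := by
        push_cast; rfl
    _ ≤ 2 / ε * q := mul_le_mul (R.copies_le_two_div ha hb hε h) hq' (by positivity) (by positivity)
    _ = 2 * (q / ε) := by ring

/-- The number of copies is at most exponential in the total number of queries, because no copies are
used if the tree makes no queries. -/
theorem RDT.copies_le_two_pow (R : RDT n) (a b : ℕ) :
    R.copies a b ≤ 2 ^ (R.copies a b * R.queryComplexity) := by
  by_cases hR : R.queryComplexity = 0
  · simp [copies, hR]
  · exact Nat.lt_two_pow_self.le.trans (Nat.pow_le_pow_right (by norm_num)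
      (Nat.le_mul_of_pos_right _ (Nat.pos_of_ne_zero hR)))

theorem time_le {N k l P : ℕ} (hN : 1 ≤ N) (hP : 1 ≤ P) (hk : k ≤ P) :
    10 ^ 15 * (P ^ 2 * (N + k + l + 1) ^ 17) ≤ 10 ^ 30 * (N ^ 19 * P ^ 19) + 10 ^ 30 * l ^ 19 := by
  have h1 : N + k + l + 1 ≤ 3 * (N * P) + l := by nlinarith
  have h2 : P ≤ 3 * (N * P) + l := by nlinarith
  calc 10 ^ 15 * (P ^ 2 * (N + k + l + 1) ^ 17)
      ≤ 10 ^ 15 * ((3 * (N * P) + l) ^ 2 * (3 * (N * P) + l) ^ 17) := by gcongr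
    _ = 10 ^ 15 * (3 * (N * P) + l) ^ 19 := by rw [← pow_add]
    _ ≤ 10 ^ 15 * (2 ^ (19 - 1) * ((3 * (N * P)) ^ 19 + l ^ 19)) := by
      gcongr
      exact add_pow_le (Nat.zero_le _) (Nat.zero_le _) _
    _ = 10 ^ 15 * 2 ^ 18 * 3 ^ 19 * (N ^ 19 * P ^ 19) + 10 ^ 15 * 2 ^ 18 * l ^ 19 := by ring
    _ ≤ _ := by gcongr <;> norm_num

/-- The derandomization theorem, with a machine all of whose stacks have finite alphabets. (The
definition of `Turing.FinTM2` requires this of the input stack only.) -/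
theorem exists_finite_machine :
    ∃ (M : Turing.TM2ComputableAux Symb Symb) (C : ℕ), (∀ k, Finite (M.tm.Γ k)) ∧
      ∀ (n q : ℕ) (R : RDT n), R.queryComplexity ≤ q →
      ∀ (ε : ℝ) (a b : ℕ), 0 < ε → ε < 1 / 2 → ε = (a : ℝ) / (b : ℝ) →
      ∃ (D : RDT n) (t : ℕ),
        OutputsWithin M (encodeFraction a b ++ R.encode) D.encode t ∧
        (t : ℝ) ≤ (C : ℝ) * (R.encode.length : ℝ) ^ C * (2 : ℝ) ^ ((C : ℝ) * ((q : ℝ) / ε))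
          + (C : ℝ) * ((encodeFraction a b).length : ℝ) ^ C ∧
        D.IsDeterministic ∧
        (D.queryComplexity : ℝ) ≤ (C : ℝ) * ((q : ℝ) / ε) ∧
        (𝔼 x : Fin n → Bool, (D.run x [] - R.mean x) ^ 2) ≤ ε := by
  -- the value of `C` is hidden, so that powers with exponent `C` are not evaluated
  obtain ⟨C, hC⟩ : ∃ C : ℕ, 10 ^ 30 ≤ C := ⟨_, le_rfl⟩
  have hC19 : 19 ≤ C := le_trans (by norm_num) hC
  have hC38 : (38 : ℝ) ≤ C := by exact_mod_cast le_trans (by norm_num) hC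
  refine ⟨interpreter body .main, C, finite_alphabets_interpreter body .main, ?_⟩
  intro n q R hq ε a b hε0 hε h
  have ha : 0 < a := Nat.pos_of_ne_zero fun h0 => by simp [h, h0] at hε0
  have hb : 0 < b := Nat.pos_of_ne_zero fun h0 => by simp [h, h0] at hε0
  have hkq := R.queryComplexity_derand_le ha hb hε h hq
  have hqε : 0 ≤ (q : ℝ) / ε := by positivity
  refine ⟨R.derand a b, _, outputsWithin_derand R ha, ?_, R.isDeterministic_build _ _ _ _, ?_, ?_⟩
  · have hN : 1 ≤ R.len := R.one_le_len
    have hl : 1 ≤ (encodeFraction a b).length := by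
      rw [encodeFraction, List.length_append]
      have := one_le_length_encodeNat a
      omega
    have ht := time_le (l := (encodeFraction a b).length) hN Nat.one_le_two_pow
      (R.copies_le_two_pow a b)
    refine (Nat.cast_le.2 ht).trans ?_
    have hpow : ((2 : ℝ) ^ (R.copies a b * R.queryComplexity)) ^ 19 ≤
        (2 : ℝ) ^ ((C : ℝ) * ((q : ℝ) / ε)) := by
      rw [← pow_mul, ← Real.rpow_natCast]
      refine Real.rpow_le_rpow_of_exponent_le one_le_two ?_
      rw [Nat.cast_mul]
      push_cast at hkq ⊢
      nlinarith
    push_cast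
    rw [← mul_assoc]
    gcongr
    · exact_mod_cast hC
    · exact_mod_cast hN
    · exact_mod_cast hC
    · exact_mod_cast hl
  · refine le_trans (Nat.cast_le.2 (R.queryComplexity_build_le _ _ _ _)) (hkq.trans ?_)
    gcongr
    linarith
  · rw [h]
    exact R.expect_sq_derand_le ha hb

end QueryDerand

theorem mainTheorem1 :
    ∃ (M : Turing.TM2ComputableAux QueryDerand.Symb QueryDerand.Symb) (C : ℕ),
      ∀ (n q : ℕ) (R : QueryDerand.RDT n), R.queryComplexity ≤ q →
      ∀ (ε : ℝ) (a b : ℕ), 0 < ε → ε < 1 / 2 → ε = (a : ℝ) / (b : ℝ) →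
      ∃ (D : QueryDerand.RDT n) (t : ℕ),
        QueryDerand.OutputsWithin M (QueryDerand.encodeFraction a b ++ R.encode) D.encode t ∧
        (t : ℝ) ≤ (C : ℝ) * (R.encode.length : ℝ) ^ C * (2 : ℝ) ^ ((C : ℝ) * ((q : ℝ) / ε))
          + (C : ℝ) * ((QueryDerand.encodeFraction a b).length : ℝ) ^ C ∧
        D.IsDeterministic ∧
        (D.queryComplexity : ℝ) ≤ (C : ℝ) * ((q : ℝ) / ε) ∧
        (𝔼 x : Fin n → Bool, (D.run x [] - R.mean x) ^ 2) ≤ ε := by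
  obtain ⟨M, C, -, h⟩ := QueryDerand.exists_finite_machine
  exact ⟨M, C, h⟩
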